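/- **Setting.** Let $m\ge 1$. For $i=1,\dots,m$ let channel $i$ delay the packet sent at time $k$ by a random time $\chi_{i,k}\in\{0,\dots,\bar\chi_i\}$; the $\chi_{i,k}$ are independent over all $i,k$, with $\Pr\{\chi_{i,k}=j\}=p_{ij}$, $\sum_j p_{ij}=1$. With nonnegative receiver weights $\alpha_{i,j}$, the channel output is $u_{di}(k)=\sum_{j=0}^{\bar\chi_i}\alpha_{i,j}\mathbf 1\{\chi_{i,k-j}=j\}\,u_i(k-j)$. Let $\mu_{i,j}$ and $r_{i,jl}$ be the means and covariances of $\alpha_{i,j}\mathbf 1\{\chi_{i,n}=j\}$, $0\le j\le\bar\chi_i$. Put $H_i(z)=\sum_j\mu_{i,j}z^{-j}$, $H=\mathrm{diag}\{H_1,\dots,H_m\}$, and $S_i(z)=\sum_{|\lambda|\le\bar\chi_i}r_i(\lambda)z^{-\lambda}$ with $r_i(\lambda)=\sum_{j=0}^{\bar\chi_i-|\lambda|}r_{i,j(j+|\lambda|)}$. Assume that $H_i$ has no zeros in $|z|\ge1$ (including $\infty$), and let $\Phi_i$ be a real polynomial in $z^{-1}$ without zeros in $|z|>1$ (including $\infty$)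 such that $S_i(z)=\Phi_i(z)\Phi_i(z^{-1})$. Put $W_i=H_i^{-1}\Phi_i$. Let $P$ be a strictly proper real rational $m\times m$ plant and $K$ a proper real rational $m\times m$ controller, and let $G=K(I+PHK)^{-1}P$. Consider the loop, at rest before time $0$, $$u=Ge,\qquad e=v-d,\qquad d_i(k)=\sum_{j}\big(\alpha_{i,j}\mathbf 1\{\chi_{i,k-j}=j\}-\mu_{i,j}\big)u_i(k-j).$$ It is *mean-square internally stable* if the negative feedback loop of $PH$ and $K$ is internally stable and, for every zero-mean i.i.d. vector noise $v$ with finite diagonal covariance that is independent of the delays, the second moments of $e(k)$ and $u(k)$ are bounded uniformly in $k$. The system is *mean-square stabilizable* if some proper $K$ makes it mean-square internally stable. Let $PH=NM^{-1}=\tilde M^{-1}\tilde N$ be a doubly coprime factorization over $\mathcal{RH}_\infty$ (the real rational proper functions with all poles in $|z|<1$), with $$\begin{bmatrix}\tilde V&\tilde U\\-\tilde N&\tilde M\end{bmatrix}\begin{bmatrix}M&-U\\N&V\end{bmatrix}=\begin{bmatrix}M&-U\\N&V\end{bmatrix}\begin{bmatrix}\tilde V&\tilde U\\-\tilde N&\tilde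 M\end{bmatrix}=I,$$ all blocks in $\mathcal{RH}_\infty$, and define $$\rho_{\min}=\inf_{Q\in\mathcal{RH}_\infty}\rho(J(Q)),\qquad J(Q)_{ij}=\big\|[(U+MQ)\tilde N]_{ij}W_j\big\|_2^2,$$ where $\rho$ is the spectral radius and $\|f\|_2^2=\frac1{2\pi}\int_{-\pi}^{\pi}|f(e^{\mathrm i\theta})|^2d\theta$. **Theorem.** Suppose that $P$ is minimum phase with input delays $\tau_i\ge1$, in the sense that $\tilde N=\tilde N_{out}\,\mathrm{diag}\{z^{-\tau_1},\dots,z^{-\tau_m}\}$ with $\tilde N_{out},\tilde N_{out}^{-1}\in\mathcal{RH}_\infty$. Let $M=M_{in}M_{out}$ with $M_{in}$ inner (in $\mathcal{RH}_\infty$ and unitary on $|z|=1$) and $M_{out}$ outer (in $\mathcal{RH}_\infty$ and nonsingular at every $|z|>1$), and let $M_{in}(z)=D_{in}+C_{in}(zI-A_{in})^{-1}B_{in}$ be a real minimal realization. Put $\hat A=A_{in}-B_{in}D_{in}^{-1}C_{in}$ and $b_i=\hat A^{\tau_i-1}W_i(\hat A)B_{in}D_{in}^{-1}e_i$. Then: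 1. For every diagonal $\Gamma=\mathrm{diag}\{\gamma_1,\dots,\gamma_m\}$ with all $\gamma_i>0$, the equation $$X=A_{in}^*XA_{in}+C_{in}^*\Gamma C_{in}-(A_{in}^*XB_{in}+C_{in}^*\Gamma D_{in})(D_{in}^*\Gamma D_{in}+B_{in}^*XB_{in})^{-1}(B_{in}^*XA_{in}+D_{in}^*\Gamma C_{in})$$ has a unique solution $X=X(\Gamma)>0$, and $$\rho_{\min}=\inf_{\Gamma}\big\{\mu:\ b_i^*X(\Gamma)b_i\le\mu\,e_i^*\Gamma e_i,\ i=1,\dots,m\big\},$$ the infimum being over all such $\Gamma$ and the real numbers $\mu$ admissible for them. 2. For each $i$ the Lyapunov equation $X_i=\hat AX_i\hat A^*-B_{in}D_{in}^{-1}e_ie_i^*D_{in}^{-*}B_{in}^*$ has a unique solution, it satisfies $X_i\ge0$, and $$\rho_{\min}=\inf_{\gamma_1,\dots,\gamma_m>0}\Big\{\mu>0:\ \sum_{j=1}^m\gamma_jX_j>\frac{\gamma_i}{\mu}\,b_ib_i^*,\ i=1,\dots,m\Big\}.$$ 3. The system is mean-square stabilizable if and only if $\rho_{\min}<1$. -/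

import Mathlib

open Polynomial MeasureTheory ProbabilityTheory

noncomputable section

namespace MSStab

/-! ### Real rational transfer functions in the variable `z = RatFunc.X` -/

/-- A square transfer matrix with `m` inputs and `m` outputs. -/
abbrev TFMatrix (m : ℕ) := Matrix (Fin m) (Fin m) (RatFunc ℝ)

def IsProper (f : RatFunc ℝ) : Prop := f.num.degree ≤ f.denom.degree

def IsStrictlyProper (f : RatFunc ℝ) : Prop := f.num.degree < f.denom.degree

/-- `f ∈ RH∞`: proper, and all poles in the open unit disc. -/
def IsRHInf (f : RatFunc ℝ) : Prop :=
  IsProper f ∧ ∀ z : ℂ, aeval z f.denom = 0 → ‖z‖ < 1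

/-- The value of `f` at a complex point. -/
def evalC (f : RatFunc ℝ) (z : ℂ) : ℂ := f.eval (algebraMap ℝ ℂ) z

/-- The value of `f` at a square matrix. -/
def evalMat {n : ℕ} (f : RatFunc ℝ) (A : Matrix (Fin n) (Fin n) ℝ) :
    Matrix (Fin n) (Fin n) ℝ :=
  aeval A f.num * (aeval A f.denom)⁻¹

/-- The squared `H₂` norm `(1/2π) ∫ |f(e^{iθ})|² dθ`. -/
def h2NormSq (f : RatFunc ℝ) : ℝ :=
  (2 * Real.pi)⁻¹ *
    ∫ θ in (-Real.pi)..Real.pi, ‖evalC f (Complex.exp (θ * Complex.I))‖ ^ 2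

/-- The coefficient of `z^{-k}` in the expansion at infinity of a proper `f`: with
`N = deg (denom f)`, the coefficients of `w^N num(1/w) / (w^N denom(1/w))`. -/
def impulseResponse (f : RatFunc ℝ) (k : ℕ) : ℝ :=
  PowerSeries.coeff k
    (((f.num.reflect f.denom.natDegree : ℝ[X]) : PowerSeries ℝ) *
      ((f.denom.reflect f.denom.natDegree : ℝ[X]) : PowerSeries ℝ)⁻¹)

/-- The rational function `q(z^{-1})`. -/
def inZInv (q : ℝ[X]) : RatFunc ℝ := aeval (RatFunc.X⁻¹ : RatFunc ℝ) q

def MatRHInf {m : ℕ} (M : TFMatrix m) : Prop := ∀ i j, IsRHInf (M i j)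

/-- Invertible in `RH∞`. -/
def MatRHInfUnit {m : ℕ} (M : TFMatrix m) : Prop :=
  MatRHInf M ∧ ∃ M' : TFMatrix m, MatRHInf M' ∧ M * M' = 1 ∧ M' * M = 1

def evalMatC {m : ℕ} (M : TFMatrix m) (z : ℂ) : Matrix (Fin m) (Fin m) ℂ :=
  M.map fun f => evalC f z

/-- Inner: in `RH∞` and unitary on the unit circle. -/
def IsInner {m : ℕ} (M : TFMatrix m) : Prop :=
  MatRHInf M ∧ ∀ z : ℂ, ‖z‖ = 1 → (evalMatC M z).conjTranspose * evalMatC M z = 1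

/-- Outer (square case): in `RH∞` and of full rank at every point outside the closed unit disc. -/
def IsOuter {m : ℕ} (M : TFMatrix m) : Prop :=
  MatRHInf M ∧ ∀ z : ℂ, 1 < ‖z‖ → (evalMatC M z).det ≠ 0

/-- The doubly coprime factorization `L = N M⁻¹ = Mt⁻¹ Nt` over `RH∞`, with the double
Bezout identity. -/
structure IsDoublyCoprime {m : ℕ} (L N M Nt Mt U V Ut Vt : TFMatrix m) : Prop where
  rhInf : MatRHInf N ∧ MatRHInf M ∧ MatRHInf Nt ∧ MatRHInf Mt ∧
    MatRHInf U ∧ MatRHInf V ∧ MatRHInf Ut ∧ MatRHInf Vt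
  det_right : M.det ≠ 0
  det_left : Mt.det ≠ 0
  right : L = N * M⁻¹
  left : L = Mt⁻¹ * Nt
  bezout₁ : Matrix.fromBlocks Vt Ut (-Nt) Mt * Matrix.fromBlocks M (-U) N V = 1
  bezout₂ : Matrix.fromBlocks M (-U) N V * Matrix.fromBlocks Vt Ut (-Nt) Mt = 1

/-! ### State-space realizations -/

/-- `T(z) = D + C (zI - A)⁻¹ B`. -/
def IsRealization {m n : ℕ} (T : TFMatrix m) (A : Matrix (Fin n) (Fin n) ℝ)
    (B : Matrix (Fin n) (Fin m) ℝ) (C : Matrix (Fin m) (Fin n) ℝ)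
    (D : Matrix (Fin m) (Fin m) ℝ) : Prop :=
  T = D.map RatFunc.C + C.map RatFunc.C *
    ((RatFunc.X : RatFunc ℝ) • (1 : Matrix (Fin n) (Fin n) (RatFunc ℝ)) - A.map RatFunc.C)⁻¹ *
      B.map RatFunc.C

/-- Minimality of a realization: `(A, B)` is controllable and `(C, A)` is observable. -/
def IsMinimal {m n : ℕ} (A : Matrix (Fin n) (Fin n) ℝ)
    (B : Matrix (Fin n) (Fin m) ℝ) (C : Matrix (Fin m) (Fin n) ℝ) : Prop :=
  (∀ x : Fin n → ℝ, (∀ k : ℕ, Matrix.vecMul x (A ^ k * B) = 0) → x = 0) ∧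
  (∀ x : Fin n → ℝ, (∀ k : ℕ, (C * A ^ k).mulVec x = 0) → x = 0)

/-! ### The stochastic channel -/

/-- `m` parallel channels with random transmission delays. Channel `i` delays a packet by
`j ∈ {0, …, maxDelay i}` steps with probability `p i j`, and the receiver gives the weight
`α i j` to a packet received with delay `j`. -/
structure Channel (m : ℕ) where
  maxDelay : Fin m → ℕ
  p : Fin m → ℕ → ℝ
  α : Fin m → ℕ → ℝ
  p_nonneg : ∀ i j, 0 ≤ p i j
  p_sum : ∀ i, ∑ j ∈ Finset.range (maxDelay i + 1), p i j = 1
  α_nonneg : ∀ i j, 0 ≤ α i j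

namespace Channel

variable {m : ℕ} (Ch : Channel m)

/-- The impulse response `h_i(n + j, n)` when the delay of the packet sent at time `n` is `x`. -/
def h (i : Fin m) (x j : ℕ) : ℝ := if x = j then Ch.α i j else 0

/-- The mean `μ_{i,j}` of `h_i(n + j, n)`. -/
def mean (i : Fin m) (j : ℕ) : ℝ :=
  ∑ x ∈ Finset.range (Ch.maxDelay i + 1), Ch.p i x * Ch.h i x j

/-- The covariance `r_{i,jl}` of `h_i(n + j, n)` and `h_i(n + l, n)`. -/
def cov (i : Fin m) (j l : ℕ) : ℝ :=
  ∑ x ∈ Finset.range (Ch.maxDelay i + 1),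
    Ch.p i x * ((Ch.h i x j - Ch.mean i j) * (Ch.h i x l - Ch.mean i l))

/-- `r_i(λ) = ∑_{j = 0}^{χ̄_i - |λ|} r_{i,j(j+|λ|)}`. -/
def r (i : Fin m) (l : ℤ) : ℝ :=
  ∑ j ∈ Finset.range (Ch.maxDelay i + 1 - l.natAbs), Ch.cov i j (j + l.natAbs)

/-- The energy spectral density `S_{Ω_i}(z) = ∑_{|λ| ≤ χ̄_i} r_i(λ) z^{-λ}`. -/
def S (i : Fin m) : RatFunc ℝ :=
  ∑ l ∈ Finset.Icc (-(Ch.maxDelay i : ℤ)) (Ch.maxDelay i : ℤ),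
    RatFunc.C (Ch.r i l) * (RatFunc.X : RatFunc ℝ) ^ (-l)

/-- The mean part `H_i = ∑_j μ_{i,j} z^{-j}`, as a polynomial in `z^{-1}`. -/
def HPoly (i : Fin m) : ℝ[X] :=
  ∑ j ∈ Finset.range (Ch.maxDelay i + 1), Polynomial.C (Ch.mean i j) * Polynomial.X ^ j

/-- The nominal system `H = diag(H_1, …, H_m)`. -/
def H : TFMatrix m := Matrix.diagonal fun i => inZInv (Ch.HPoly i)

/-- The mean parts are minimum phase: `H_i(z)` has no zeros in `|z| ≥ 1`, including infinity. -/
def MeanMinPhase : Prop := ∀ i, ∀ w : ℂ, ‖w‖ ≤ 1 → aeval w (Ch.HPoly i) ≠ 0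

/-- `Φ_i(z) = φ(z^{-1})` is a minimum-phase spectral factor of `S_{Ω_i}`:
`S_{Ω_i}(z) = Φ_i(z) Φ_i(z^{-1})`, and `Φ_i` has no zeros in `|z| > 1`, including infinity. -/
def IsSpectralFactor (i : Fin m) (φ : ℝ[X]) : Prop :=
  Ch.S i = inZInv φ * aeval (RatFunc.X : RatFunc ℝ) φ ∧
    ∀ w : ℂ, ‖w‖ < 1 → aeval w φ ≠ 0

/-- The coefficient of frequency variation `W_i = H_i⁻¹ Φ_i`. -/
def W (φ : Fin m → ℝ[X]) (i : Fin m) : RatFunc ℝ :=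
  (inZInv (Ch.HPoly i))⁻¹ * inZInv (φ i)

/-- The output `d_i(k) = ∑_j h̃_i(k, k-j) u_i(k-j)` of the zero-mean uncertainty `Ω_i`, for a
realization `x n = χ_{i,n}` of the delays and an input that vanishes at negative times. -/
def uncertaintyOutput (i : Fin m) (x : ℕ → ℕ) (u : ℕ → ℝ) (k : ℕ) : ℝ :=
  ∑ j ∈ Finset.range (Ch.maxDelay i + 1),
    if j ≤ k then (Ch.h i (x (k - j)) j - Ch.mean i j) * u (k - j) else 0

/-- The delays `χ_{i,k}` are independent, over all channels and times, with the prescribed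
probability mass functions. -/
structure IsDelayProcess {Ω : Type} [MeasurableSpace Ω] (μ : Measure Ω)
    (χ : Fin m → ℕ → Ω → ℕ) : Prop where
  measurable : ∀ i k, Measurable (χ i k)
  pmf : ∀ i k, ∀ j ∈ Finset.range (Ch.maxDelay i + 1),
    μ {ω | χ i k ω = j} = ENNReal.ofReal (Ch.p i j)
  indep : iIndepFun (fun q : Fin m × ℕ => χ q.1 q.2) μ

end Channel

/-! ### Mean-square stability and stabilizability -/

/-- I.i.d. vector white noise with mean zero and a finite diagonal covariance matrix. -/
structure IsWhiteNoise {m : ℕ} {Ω : Type} [MeasurableSpace Ω] (μ : Measure Ω)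
    (v : ℕ → Ω → Fin m → ℝ) : Prop where
  measurable : ∀ k, Measurable (v k)
  indep : iIndepFun v μ
  identDistrib : ∀ k, IdentDistrib (v k) (v 0) μ μ
  memLp : ∀ k i, MemLp (fun ω => v k ω i) 2 μ
  mean_zero : ∀ k i, ∫ ω, v k ω i ∂μ = 0
  cov_diag : ∀ k i j, i ≠ j → ∫ ω, v k ω i * v k ω j ∂μ = 0

/-- The nominal system `G = K (I + P H K)⁻¹ P` from `d` to `u`. -/
def nominalG {m : ℕ} (P H K : TFMatrix m) : TFMatrix m := K * (1 + P * H * K)⁻¹ * P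

/-- `K` is a proper controller that internally stabilizes the negative feedback loop of
`L` and `K`: the loop is well defined and its four closed-loop maps are in `RH∞`. -/
def InternallyStabilizes {m : ℕ} (L K : TFMatrix m) : Prop :=
  (∀ i j, IsProper (K i j)) ∧ (1 + L * K).det ≠ 0 ∧
    MatRHInf (1 + L * K)⁻¹ ∧ MatRHInf (K * (1 + L * K)⁻¹) ∧
    MatRHInf ((1 + L * K)⁻¹ * L) ∧ MatRHInf (K * (1 + L * K)⁻¹ * L)

/-- The signals of the feedback loop of `G` and `Ω`, started at rest at time `0`:
`e = v - d`, `u = G e`, `d = Ω u`. -/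
def IsLoop {m : ℕ} (Ch : Channel m) (G : TFMatrix m) {Ω : Type}
    (χ : Fin m → ℕ → Ω → ℕ) (v e u : ℕ → Ω → Fin m → ℝ) : Prop :=
  ∀ k ω i,
    e k ω i = v k ω i -
      Ch.uncertaintyOutput i (fun l => χ i l ω) (fun l => u l ω i) k ∧
    u k ω i = ∑ l ∈ Finset.range (k + 1), ∑ j, impulseResponse (G i j) (k - l) * e l ω j

/-- The second moments of the components of `s(k)` are bounded uniformly in time. -/
def BoundedVariance {m : ℕ} {Ω : Type} [MeasurableSpace Ω] (μ : Measure Ω)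
    (s : ℕ → Ω → Fin m → ℝ) : Prop :=
  ∃ b : ℝ, ∀ k i, ∫⁻ ω, ENNReal.ofReal (s k ω i ^ 2) ∂μ ≤ ENNReal.ofReal b

/-- Mean-square internal stability of the loop of plant `P`, channel `Ch` and controller `K`. -/
def MSInternallyStable {m : ℕ} (Ch : Channel m) (P K : TFMatrix m) : Prop :=
  InternallyStabilizes (P * Ch.H) K ∧
  ∀ (Ω : Type) [MeasurableSpace Ω] (μ : Measure Ω) [IsProbabilityMeasure μ]
    (χ : Fin m → ℕ → Ω → ℕ) (v e u : ℕ → Ω → Fin m → ℝ),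
    Ch.IsDelayProcess μ χ → IsWhiteNoise μ v →
    IndepFun (fun ω k => v k ω) (fun ω (q : Fin m × ℕ) => χ q.1 q.2 ω) μ →
    IsLoop Ch (nominalG P Ch.H K) χ v e u →
    BoundedVariance μ e ∧ BoundedVariance μ u

def MSStabilizable {m : ℕ} (Ch : Channel m) (P : TFMatrix m) : Prop :=
  ∃ K : TFMatrix m, MSInternallyStable Ch P K

/-! ### The stabilization radius -/

/-- The spectral radius of a real square matrix (over its complex eigenvalues). -/
def specRad {m : ℕ} (J : Matrix (Fin m) (Fin m) ℝ) : ℝ :=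
  (spectralRadius ℂ (J.map (algebraMap ℝ ℂ))).toReal

/-- `J(Q)` has the entries `‖[(U + M Q) Nt]_{ij} W_j‖₂²`. -/
def JMat {m : ℕ} (U M Nt : TFMatrix m) (W : Fin m → RatFunc ℝ) (Q : TFMatrix m) :
    Matrix (Fin m) (Fin m) ℝ :=
  Matrix.of fun i j => h2NormSq (((U + M * Q) * Nt) i j * W j)

/-- `ρ_min = inf_{Q ∈ RH∞} ρ(J(Q))`. -/
def rhoMin {m : ℕ} (U M Nt : TFMatrix m) (W : Fin m → RatFunc ℝ) : ℝ :=
  sInf {ρ : ℝ | ∃ Q : TFMatrix m, MatRHInf Q ∧ ρ = specRad (JMat U M Nt W Q)}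

section Formulas

variable {m n : ℕ} (A : Matrix (Fin n) (Fin n) ℝ) (B : Matrix (Fin n) (Fin m) ℝ)
  (C : Matrix (Fin m) (Fin n) ℝ) (D : Matrix (Fin m) (Fin m) ℝ)

/-- `Â = A - B D⁻¹ C`. -/
def Ahat : Matrix (Fin n) (Fin n) ℝ := A - B * D⁻¹ * C

/-- The discrete algebraic Riccati equation with weight `Γ`. -/
def IsDARESolution (Γ : Matrix (Fin m) (Fin m) ℝ) (X : Matrix (Fin n) (Fin n) ℝ) : Prop :=
  X = A.transpose * X * A + C.transpose * Γ * C -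
    (A.transpose * X * B + C.transpose * Γ * D) *
      (D.transpose * Γ * D + B.transpose * X * B)⁻¹ *
      (B.transpose * X * A + D.transpose * Γ * C)

/-- `X = Â X Âᵀ - B D⁻¹ e_i e_iᵀ D⁻ᵀ Bᵀ`. -/
def IsLyapunovSolution (i : Fin m) (X : Matrix (Fin n) (Fin n) ℝ) : Prop :=
  X = Ahat A B C D * X * (Ahat A B C D).transpose -
    Matrix.vecMulVec ((B * D⁻¹).mulVec (Pi.single i 1)) ((B * D⁻¹).mulVec (Pi.single i 1))

/-- The vector `b_i = Â^{τ_i - 1} W_i(Â) B D⁻¹ e_i`. -/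
def bVec (W : Fin m → RatFunc ℝ) (τ : Fin m → ℕ) (i : Fin m) : Fin n → ℝ :=
  ((Ahat A B C D) ^ (τ i - 1) * evalMat (W i) (Ahat A B C D) * B * D⁻¹).mulVec (Pi.single i 1)

/-- The numbers `μ` such that `b_iᵀ X b_i ≤ μ γ_i` for all `i`, for some positive diagonal matrix
`Γ = diag(γ_1, …, γ_m)` and a positive definite solution `X` of the Riccati equation for `Γ`. -/
def riccatiSet (W : Fin m → RatFunc ℝ) (τ : Fin m → ℕ) : Set ℝ :=
  {μ | ∃ γ : Fin m → ℝ, (∀ i, 0 < γ i) ∧ ∃ X : Matrix (Fin n) (Fin n) ℝ,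
    X.PosDef ∧ IsDARESolution A B C D (Matrix.diagonal γ) X ∧
    ∀ i, bVec A B C D W τ i ⬝ᵥ X.mulVec (bVec A B C D W τ i) ≤ μ * γ i}

/-- The numbers `μ > 0` such that `∑_j γ_j X_j > (γ_i / μ) b_i b_iᵀ` for all `i`, for some
`γ_1, …, γ_m > 0`. -/
def lmiSet (W : Fin m → RatFunc ℝ) (τ : Fin m → ℕ)
    (Xs : Fin m → Matrix (Fin n) (Fin n) ℝ) : Set ℝ :=
  {μ | 0 < μ ∧ ∃ γ : Fin m → ℝ, (∀ i, 0 < γ i) ∧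
    ∀ i, (∑ j, γ j • Xs j - (γ i / μ) •
      Matrix.vecMulVec (bVec A B C D W τ i) (bVec A B C D W τ i)).PosDef}

end Formulas

end MSStab

end

noncomputable section

namespace MSStab

/-! ### Proper rational functions and their expansion at infinity -/

/-! Two separate arguments meet in the matrix J(Q).

Stability. Sorted by packets, u(k) is the filtered noise minus a sum over earlier packets; the
packet sent at time n through channel j contributes u_j(n) times a kernel that depends only on its
own random delay. These kernels are centred, the delays are independent, and u_j(n) involves only
packets sent before n, so all cross terms vanish in the mean (`IsInputRecursion.integral_sq`). The
second moments therefore satisfy a renewal equation with nonnegative kernels. Their total masses are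
‖G_ij Φ_j‖², because S_j = Φ_j(z)Φ_j(1/z) is the mean energy spectrum of a packet
(`Channel.hasSum_energy`). Spectral radius below one gives bounded solutions (`renewal_bounded`).
Otherwise unit white noise drives the moments to infinity (`renewal_unbounded`,
`specRad_lt_one_of_boundedVariance`). By the Youla parametrization G H = (U + MQ)Ñ, so the masses
are the entries of J(Q), and stabilizability means ρ(J(Q)) < 1 for some Q, that is ρ_min < 1.

Optimization. For J ≥ 0, ρ(J) < r yields a positive γ with γᵀJ < rγᵀ entrywise, and γᵀJ ≤ rγᵀ yields
ρ(J) ≤ r. For fixed γ the cost splits into columns. Since Ñ_out is a unit, the columns of Q Ñ_out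
are free. After its delay is removed, column j runs through g₀ + M q W_j. Because M_out and W_j are
outer, this set is dense in g₀ + M_in H₂ (`exists_h2NormSq_sub_mul_lt`). Membership in this coset is
decided by the n functionals ℓ(g) = ∑ₖ (C Aᵏ)ᵀ gₖ: ℓ vanishes on the stable range of M_in and
nowhere else (`InnerRealization.ell_tf_mulVec`, `InnerRealization.exists_tf_mulVec_eq`). The Bezout
identity fixes its value, ℓ(g) = -P b_j, with P the observability Gramian (`YoulaData.ell_column`).
The least weighted norm under this constraint is b_jᵀ Y⁻¹ b_j with Y = ∑ γ_i⁻¹ X_i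
(`InnerRealization.quad_le_of_ell_eq`, `InnerRealization.exists_ell_eq_and_quad_eq`).

Both formulas follow. Inverting the Riccati equation turns it into the Lyapunov equation of Y, so
X(Γ) = Y⁻¹ (`InnerRealization.isDARESolution_iff`), and a Schur complement turns b_jᵀ Y⁻¹ b_j < μγ_j
into the matrix inequality, with γ replaced by its reciprocals. -/

theorem isProper_iff_natDegree {f : RatFunc ℝ} :
    IsProper f ↔ f.num.natDegree ≤ f.denom.natDegree := by
  unfold IsProper
  rw [Polynomial.degree_eq_natDegree f.denom_ne_zero, Polynomial.natDegree_le_iff_degree_le]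

/-- The expansion at infinity, as a power series in `z⁻¹`. -/
def imp (f : RatFunc ℝ) : PowerSeries ℝ := PowerSeries.mk (impulseResponse f)

@[simp] theorem coeff_imp (f : RatFunc ℝ) (k : ℕ) :
    PowerSeries.coeff k (imp f) = impulseResponse f k := by
  simp [imp]

theorem coe_reflect_ne_zero {b : ℝ[X]} (hb : b ≠ 0) (N : ℕ) :
    ((b.reflect N : ℝ[X]) : PowerSeries ℝ) ≠ 0 := by
  intro h
  have h' : b.reflect N = 0 := by exact_mod_cast h
  exact hb (Polynomial.reflect_eq_zero_iff.1 h')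

/-- The reflected denominator has constant term 1, the leading coefficient of the monic denominator,
so the power series inverse is a true inverse. The algebra of expansions uses this product form,
which contains no inverse. -/
theorem imp_mul_reflect_denom (f : RatFunc ℝ) :
    imp f * ((f.denom.reflect f.denom.natDegree : ℝ[X]) : PowerSeries ℝ) =
      ((f.num.reflect f.denom.natDegree : ℝ[X]) : PowerSeries ℝ) := by
  have h1 : imp f = ((f.num.reflect f.denom.natDegree : ℝ[X]) : PowerSeries ℝ) *
      ((f.denom.reflect f.denom.natDegree : ℝ[X]) : PowerSeries ℝ)⁻¹ := by
    ext k; simp [impulseResponse]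
  have h0 : PowerSeries.constantCoeff
      ((f.denom.reflect f.denom.natDegree : ℝ[X]) : PowerSeries ℝ) ≠ 0 := by
    rw [← PowerSeries.coeff_zero_eq_constantCoeff_apply, Polynomial.coeff_coe,
      Polynomial.coeff_reflect, Polynomial.revAt_zero]
    have := f.monic_denom
    rw [Polynomial.Monic, Polynomial.leadingCoeff] at this
    rw [this]; exact one_ne_zero
  rw [h1, mul_assoc, PowerSeries.inv_mul_cancel _ h0, mul_one]

theorem num_mul_eq_of_eq_div {f : RatFunc ℝ} {a b : ℝ[X]} (hb : b ≠ 0)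
    (hf : f = algebraMap _ _ a / algebraMap _ _ b) : f.num * b = a * f.denom :=
  (RatFunc.num_mul_eq_mul_denom_iff hb).2 hf

theorem isProper_of_eq_div {f : RatFunc ℝ} {a b : ℝ[X]} (hb : b ≠ 0)
    (hf : f = algebraMap _ _ a / algebraMap _ _ b) (hab : a.natDegree ≤ b.natDegree) :
    IsProper f := by
  rw [isProper_iff_natDegree]
  have h := num_mul_eq_of_eq_div hb hf
  by_cases ha : a = 0
  · have : f.num = 0 := by
      have h' : f.num * b = 0 := by rw [h, ha, zero_mul]
      exact (mul_eq_zero.1 h').resolve_right hb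
    simp [this]
  · have hn : f.num ≠ 0 := by
      intro h0; rw [h0, zero_mul] at h
      exact mul_ne_zero ha f.denom_ne_zero h.symm
    have := congrArg Polynomial.natDegree h
    rw [Polynomial.natDegree_mul hn hb, Polynomial.natDegree_mul ha f.denom_ne_zero] at this
    omega

/-- Reflecting numerator and denominator at the same N multiplies both by z⁻ᴺ. Unreduced fractions
are allowed, so products and sums of fractions can be expanded without cancelling common factors. -/
theorem imp_mul_reflect {f : RatFunc ℝ} {a b : ℝ[X]} {N : ℕ} (hb : b ≠ 0)
    (hf : f = algebraMap _ _ a / algebraMap _ _ b) (hp : IsProper f)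
    (ha : a.natDegree ≤ N) (hbN : b.natDegree ≤ N) :
    imp f * ((b.reflect N : ℝ[X]) : PowerSeries ℝ) = ((a.reflect N : ℝ[X]) : PowerSeries ℝ) := by
  have h := num_mul_eq_of_eq_div hb hf
  have h1 := congrArg (Polynomial.reflect (f.denom.natDegree + N)) h
  rw [Polynomial.reflect_mul _ _ (isProper_iff_natDegree.1 hp) hbN,
    add_comm, Polynomial.reflect_mul _ _ ha le_rfl] at h1
  have h2 := congrArg (fun p : ℝ[X] => (p : PowerSeries ℝ)) h1
  simp only [Polynomial.coe_mul] at h2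
  rw [← imp_mul_reflect_denom] at h2
  have h3 := coe_reflect_ne_zero f.denom_ne_zero f.denom.natDegree
  apply mul_right_cancel₀ h3
  linear_combination h2

theorem imp_eq_of_mul_reflect {f : RatFunc ℝ} {a b : ℝ[X]} {N : ℕ} (hb : b ≠ 0)
    (hf : f = algebraMap _ _ a / algebraMap _ _ b) (hp : IsProper f)
    (ha : a.natDegree ≤ N) (hbN : b.natDegree ≤ N) {s : PowerSeries ℝ}
    (hs : s * ((b.reflect N : ℝ[X]) : PowerSeries ℝ) = ((a.reflect N : ℝ[X]) : PowerSeries ℝ)) :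
    imp f = s :=
  mul_right_cancel₀ (coe_reflect_ne_zero hb N)
    ((imp_mul_reflect hb hf hp ha hbN).trans hs.symm)

theorem mul_eq_div (f g : RatFunc ℝ) : f * g =
    algebraMap _ _ (f.num * g.num) / algebraMap _ _ (f.denom * g.denom) := by
  conv_lhs => rw [← f.num_div_denom, ← g.num_div_denom]
  rw [div_mul_div_comm, map_mul, map_mul]

theorem add_eq_div (f g : RatFunc ℝ) : f + g =
    algebraMap _ _ (f.num * g.denom + f.denom * g.num) /
      algebraMap _ _ (f.denom * g.denom) := by
  have h1 := RatFunc.algebraMap_ne_zero f.denom_ne_zero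
  have h2 := RatFunc.algebraMap_ne_zero g.denom_ne_zero
  conv_lhs => rw [← f.num_div_denom, ← g.num_div_denom]
  rw [div_add_div _ _ h1 h2]; simp only [map_add, map_mul]

theorem IsProper.mul {f g : RatFunc ℝ} (hf : IsProper f) (hg : IsProper g) :
    IsProper (f * g) := by
  refine isProper_of_eq_div (mul_ne_zero f.denom_ne_zero g.denom_ne_zero) (mul_eq_div f g) ?_
  rw [Polynomial.natDegree_mul f.denom_ne_zero g.denom_ne_zero]
  exact Polynomial.natDegree_mul_le.trans
    (add_le_add (isProper_iff_natDegree.1 hf) (isProper_iff_natDegree.1 hg))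

theorem natDegree_add_num_le {f g : RatFunc ℝ} (hf : IsProper f) (hg : IsProper g) :
    (f.num * g.denom + f.denom * g.num).natDegree ≤ f.denom.natDegree + g.denom.natDegree :=
  (Polynomial.natDegree_add_le _ _).trans (max_le
    (Polynomial.natDegree_mul_le.trans (add_le_add (isProper_iff_natDegree.1 hf) le_rfl))
    (Polynomial.natDegree_mul_le.trans (add_le_add le_rfl (isProper_iff_natDegree.1 hg))))

theorem IsProper.add {f g : RatFunc ℝ} (hf : IsProper f) (hg : IsProper g) :
    IsProper (f + g) := by
  refine isProper_of_eq_div (mul_ne_zero f.denom_ne_zero g.denom_ne_zero) (add_eq_div f g) ?_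
  rw [Polynomial.natDegree_mul f.denom_ne_zero g.denom_ne_zero]
  exact natDegree_add_num_le hf hg

theorem isProper_C (c : ℝ) : IsProper (RatFunc.C c) := by
  rw [isProper_iff_natDegree]; simp

theorem isProper_X_inv : IsProper (RatFunc.X : RatFunc ℝ)⁻¹ :=
  isProper_of_eq_div (a := 1) (b := Polynomial.X) Polynomial.X_ne_zero
    (by rw [map_one, RatFunc.algebraMap_X, one_div]) (by simp)

theorem IsProper.neg {f : RatFunc ℝ} (hf : IsProper f) : IsProper (-f) := by
  have := (isProper_C (-1)).mul hf
  simpa using this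

/-- The ring of proper rational functions. -/
def properRing : Subring (RatFunc ℝ) where
  carrier := {f | IsProper f}
  mul_mem' := IsProper.mul
  one_mem' := by simpa using isProper_C 1
  add_mem' := IsProper.add
  zero_mem' := by simpa using isProper_C 0
  neg_mem' := IsProper.neg

theorem imp_mul {f g : RatFunc ℝ} (hf : IsProper f) (hg : IsProper g) :
    imp (f * g) = imp f * imp g := by
  have hf' := isProper_iff_natDegree.1 hf
  have hg' := isProper_iff_natDegree.1 hg
  refine imp_eq_of_mul_reflect (N := f.denom.natDegree + g.denom.natDegree)
    (mul_ne_zero f.denom_ne_zero g.denom_ne_zero) (mul_eq_div f g)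
    (hf.mul hg) (Polynomial.natDegree_mul_le.trans (add_le_add hf' hg'))
    Polynomial.natDegree_mul_le ?_
  rw [Polynomial.reflect_mul _ _ le_rfl le_rfl, Polynomial.reflect_mul _ _ hf' hg',
    Polynomial.coe_mul, Polynomial.coe_mul, ← imp_mul_reflect_denom, ← imp_mul_reflect_denom]
  ring

theorem imp_add {f g : RatFunc ℝ} (hf : IsProper f) (hg : IsProper g) :
    imp (f + g) = imp f + imp g := by
  have hf' := isProper_iff_natDegree.1 hf
  have hg' := isProper_iff_natDegree.1 hg
  refine imp_eq_of_mul_reflect (N := f.denom.natDegree + g.denom.natDegree)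
    (mul_ne_zero f.denom_ne_zero g.denom_ne_zero) (add_eq_div f g)
    (hf.add hg) (natDegree_add_num_le hf hg) Polynomial.natDegree_mul_le ?_
  rw [Polynomial.reflect_add, Polynomial.reflect_mul _ _ le_rfl le_rfl,
    Polynomial.reflect_mul _ _ hf' le_rfl, Polynomial.reflect_mul _ _ le_rfl hg',
    Polynomial.coe_add, Polynomial.coe_mul, Polynomial.coe_mul, Polynomial.coe_mul,
    ← imp_mul_reflect_denom, ← imp_mul_reflect_denom]
  ring

@[simp] theorem imp_C (c : ℝ) : imp (RatFunc.C c) = PowerSeries.C c := by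
  refine imp_eq_of_mul_reflect (a := Polynomial.C c) (b := 1) (N := 0) one_ne_zero
    (by simp) (isProper_C c) (by simp) (by simp) ?_
  simp

@[simp] theorem imp_zero : imp 0 = 0 := by simpa using imp_C 0

@[simp] theorem imp_one : imp 1 = 1 := by simpa using imp_C 1

@[simp] theorem imp_X_inv : imp (RatFunc.X : RatFunc ℝ)⁻¹ = PowerSeries.X := by
  refine imp_eq_of_mul_reflect (a := 1) (b := Polynomial.X) (N := 1) Polynomial.X_ne_zero
    (by rw [map_one, RatFunc.algebraMap_X, one_div]) isProper_X_inv (by simp) (by simp) ?_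
  rw [Polynomial.reflect_one_X, Polynomial.reflect_one]
  simp

theorem imp_neg {f : RatFunc ℝ} (hf : IsProper f) : imp (-f) = - imp f := by
  have h := imp_mul (isProper_C (-1)) hf
  rw [imp_C] at h
  simpa only [map_neg, map_one, neg_mul, one_mul] using h

/-- Expansion at infinity as a ring homomorphism. -/
def impHom : properRing →+* PowerSeries ℝ where
  toFun f := imp f.1
  map_one' := imp_one
  map_mul' f g := imp_mul f.2 g.2
  map_zero' := imp_zero
  map_add' f g := imp_add f.2 g.2

theorem imp_sub {f g : RatFunc ℝ} (hf : IsProper f) (hg : IsProper g) :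
    imp (f - g) = imp f - imp g := by
  rw [sub_eq_add_neg, imp_add hf hg.neg, imp_neg hg, sub_eq_add_neg]

theorem IsProper.sum {ι : Type*} (s : Finset ι) {f : ι → RatFunc ℝ}
    (hf : ∀ i ∈ s, IsProper (f i)) : IsProper (∑ i ∈ s, f i) :=
  properRing.sum_mem hf

theorem imp_sum {ι : Type*} (s : Finset ι) {f : ι → RatFunc ℝ}
    (hf : ∀ i, IsProper (f i)) : imp (∑ i ∈ s, f i) = ∑ i ∈ s, imp (f i) := by
  classical
  induction s using Finset.induction_on with
  | empty => simp
  | insert a s ha ih =>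
    rw [Finset.sum_insert ha, Finset.sum_insert ha,
      imp_add (hf a) (IsProper.sum s fun i _ => hf i), ih]

theorem IsProper.pow {f : RatFunc ℝ} (hf : IsProper f) (n : ℕ) : IsProper (f ^ n) :=
  properRing.pow_mem hf n

theorem imp_pow {f : RatFunc ℝ} (hf : IsProper f) (n : ℕ) : imp (f ^ n) = imp f ^ n := by
  induction n with
  | zero => simp
  | succ n ih => rw [pow_succ, pow_succ, imp_mul (hf.pow n) hf, ih]

theorem eq_zero_of_imp_eq_zero {f : RatFunc ℝ} (h : imp f = 0) : f = 0 := by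
  have h1 := imp_mul_reflect_denom f
  rw [h, zero_mul] at h1
  have h2 : f.num.reflect f.denom.natDegree = 0 := by exact_mod_cast h1.symm
  rw [Polynomial.reflect_eq_zero_iff] at h2
  exact RatFunc.num_eq_zero_iff.1 h2

theorem IsStrictlyProper.isProper {f : RatFunc ℝ} (hf : IsStrictlyProper f) : IsProper f :=
  le_of_lt hf

theorem impulseResponse_zero_of_isStrictlyProper {f : RatFunc ℝ} (hf : IsStrictlyProper f) :
    impulseResponse f 0 = 0 := by
  have h := congrArg (PowerSeries.coeff 0) (imp_mul_reflect_denom f)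
  rw [PowerSeries.coeff_mul, Finset.Nat.antidiagonal_zero, Finset.sum_singleton] at h
  simp only [Polynomial.coeff_coe, Polynomial.coeff_reflect,
    Polynomial.revAt_zero, coeff_imp] at h
  have h1 := f.monic_denom
  rw [Polynomial.Monic, Polynomial.leadingCoeff] at h1
  rw [h1, mul_one] at h
  rw [h]
  apply Polynomial.coeff_eq_zero_of_degree_lt
  rw [← Polynomial.degree_eq_natDegree f.denom_ne_zero]
  exact hf

/-- A nonzero value at infinity rules out a numerator of smaller degree than the denominator, so the
swapped fraction is again proper. -/
theorem isProper_inv {f : RatFunc ℝ} (hf : IsProper f) (h0 : impulseResponse f 0 ≠ 0) :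
    IsProper f⁻¹ := by
  have hf0 : f ≠ 0 := by
    rintro rfl
    apply h0; rw [← coeff_imp]; simp
  have h1 : ¬ f.num.degree < f.denom.degree := fun h =>
    h0 (impulseResponse_zero_of_isStrictlyProper h)
  refine isProper_of_eq_div (a := f.denom) (b := f.num) (RatFunc.num_ne_zero hf0) ?_ ?_
  · conv_lhs => rw [← f.num_div_denom, inv_div]
  · exact Polynomial.natDegree_le_natDegree (not_lt.1 h1)

/-! ### Polynomials in `z⁻¹` -/

theorem isProper_inZInv (q : ℝ[X]) : IsProper (inZInv q) := by
  unfold inZInv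
  induction q using Polynomial.induction_on' with
  | add p q hp hq => rw [map_add]; exact hp.add hq
  | monomial n a =>
    rw [Polynomial.aeval_monomial]
    exact (isProper_C a).mul (isProper_X_inv.pow n)

theorem imp_inZInv (q : ℝ[X]) : imp (inZInv q) = (q : PowerSeries ℝ) := by
  induction q using Polynomial.induction_on' with
  | add p q hp hq =>
    have : inZInv (p + q) = inZInv p + inZInv q := by simp [inZInv]
    rw [this, imp_add (isProper_inZInv p) (isProper_inZInv q), hp, hq, Polynomial.coe_add]
  | monomial n a =>
    have : inZInv (Polynomial.monomial n a) = RatFunc.C a * (RatFunc.X⁻¹) ^ n := by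
      rw [inZInv, Polynomial.aeval_monomial]; rfl
    rw [this, imp_mul (isProper_C a) (isProper_X_inv.pow n), imp_pow isProper_X_inv,
      imp_C, imp_X_inv, ← Polynomial.C_mul_X_pow_eq_monomial]
    simp

theorem impulseResponse_inZInv (q : ℝ[X]) (k : ℕ) :
    impulseResponse (inZInv q) k = q.coeff k := by
  rw [← coeff_imp, imp_inZInv, Polynomial.coeff_coe]

theorem inZInv_reflect (q : ℝ[X]) {N : ℕ} (hN : q.natDegree ≤ N) :
    inZInv (q.reflect N) = algebraMap _ _ q / RatFunc.X ^ N := by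
  have hX : (RatFunc.X : RatFunc ℝ) ≠ 0 := RatFunc.X_ne_zero
  let _ := invertibleOfNonzero (inv_ne_zero hX)
  have h := Polynomial.eval₂_reflect_mul_pow (algebraMap ℝ (RatFunc ℝ)) (RatFunc.X⁻¹) N
    (q.reflect N) (Polynomial.natDegree_reflect_le.trans (max_le le_rfl hN))
  rw [Polynomial.reflect_reflect, invOf_eq_inv, inv_inv] at h
  rw [inZInv, Polynomial.aeval_def, ← h, div_eq_mul_inv, inv_pow, ← Polynomial.aeval_def,
    RatFunc.aeval_X_left_eq_algebraMap]

theorem eq_inZInv_div {f : RatFunc ℝ} (hf : IsProper f) : f =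
    inZInv (f.num.reflect f.denom.natDegree) / inZInv (f.denom.reflect f.denom.natDegree) := by
  have hX : (RatFunc.X : RatFunc ℝ) ^ f.denom.natDegree ≠ 0 := pow_ne_zero _ RatFunc.X_ne_zero
  rw [inZInv_reflect _ (isProper_iff_natDegree.1 hf), inZInv_reflect _ le_rfl,
    div_div_div_cancel_right₀ hX, RatFunc.num_div_denom]

/-! ### `RH∞` -/

theorem isRHInf_of_eq_div {f : RatFunc ℝ} {a b : ℝ[X]} (hb : b ≠ 0)
    (hf : f = algebraMap _ _ a / algebraMap _ _ b) (hp : IsProper f)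
    (hz : ∀ z : ℂ, aeval z b = 0 → ‖z‖ < 1) : IsRHInf f := by
  refine ⟨hp, fun z h => hz z ?_⟩
  have hd : f.denom ∣ b := (RatFunc.denom_dvd hb).2 ⟨a, hf⟩
  obtain ⟨c, rfl⟩ := hd
  rw [map_mul, h, zero_mul]

theorem IsRHInf.mul {f g : RatFunc ℝ} (hf : IsRHInf f) (hg : IsRHInf g) : IsRHInf (f * g) := by
  refine isRHInf_of_eq_div (mul_ne_zero f.denom_ne_zero g.denom_ne_zero) (mul_eq_div f g)
    (hf.1.mul hg.1) fun z h => ?_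
  rw [map_mul, mul_eq_zero] at h
  exact h.elim (hf.2 z) (hg.2 z)

theorem IsRHInf.add {f g : RatFunc ℝ} (hf : IsRHInf f) (hg : IsRHInf g) : IsRHInf (f + g) := by
  refine isRHInf_of_eq_div (mul_ne_zero f.denom_ne_zero g.denom_ne_zero) (add_eq_div f g)
    (hf.1.add hg.1) fun z h => ?_
  rw [map_mul, mul_eq_zero] at h
  exact h.elim (hf.2 z) (hg.2 z)

theorem isRHInf_C (c : ℝ) : IsRHInf (RatFunc.C c) :=
  ⟨isProper_C c, fun z h => by simp at h⟩

theorem isRHInf_X_inv : IsRHInf (RatFunc.X : RatFunc ℝ)⁻¹ :=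
  isRHInf_of_eq_div (a := 1) (b := Polynomial.X) Polynomial.X_ne_zero
    (by rw [map_one, RatFunc.algebraMap_X, one_div]) isProper_X_inv
    (fun z h => by simp only [aeval_X] at h; simp [h])

theorem IsRHInf.neg {f : RatFunc ℝ} (hf : IsRHInf f) : IsRHInf (-f) := by
  have := (isRHInf_C (-1)).mul hf
  simpa using this

/-- The ring `RH∞`. -/
def rhInfRing : Subring (RatFunc ℝ) where
  carrier := {f | IsRHInf f}
  mul_mem' := IsRHInf.mul
  one_mem' := by simpa using isRHInf_C 1
  add_mem' := IsRHInf.add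
  zero_mem' := by simpa using isRHInf_C 0
  neg_mem' := IsRHInf.neg

theorem isRHInf_inZInv (q : ℝ[X]) : IsRHInf (inZInv q) := by
  unfold inZInv
  induction q using Polynomial.induction_on' with
  | add p q hp hq => rw [map_add]; exact hp.add hq
  | monomial n a =>
    rw [Polynomial.aeval_monomial]
    exact (isRHInf_C a).mul (rhInfRing.pow_mem isRHInf_X_inv n)

theorem aeval_reflect_eq_zero {q : ℝ[X]} {N : ℕ} (hN : q.natDegree ≤ N) {z : ℂ} (hz : z ≠ 0) :
    aeval z (q.reflect N) = 0 ↔ aeval z⁻¹ q = 0 := by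
  let _ := invertibleOfNonzero (inv_ne_zero hz)
  have h := Polynomial.eval₂_reflect_eq_zero_iff (algebraMap ℝ ℂ) z⁻¹ N q hN
  rw [invOf_eq_inv, inv_inv] at h
  exact h

/-- A polynomial in `z⁻¹` without zeros in `|z| ≥ 1` is a unit of `RH∞`. -/
theorem isRHInf_inv_inZInv {q : ℝ[X]} (hq : ∀ w : ℂ, ‖w‖ ≤ 1 → aeval w q ≠ 0) :
    IsRHInf (inZInv q)⁻¹ := by
  have hq0 : q ≠ 0 := by rintro rfl; exact hq 0 (by simp) (by simp)
  set N := q.natDegree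
  have hb : q.reflect N ≠ 0 := fun h => hq0 (Polynomial.reflect_eq_zero_iff.1 h)
  have hc : q.coeff 0 ≠ 0 := by
    intro h
    refine hq 0 (by simp) ?_
    rw [← Polynomial.coeff_zero_eq_aeval_zero']
    simp [h]
  have hX : (RatFunc.X : RatFunc ℝ) ^ N ≠ 0 := pow_ne_zero _ RatFunc.X_ne_zero
  have hle : (q.reflect N).natDegree ≤ N :=
    Polynomial.natDegree_reflect_le.trans (max_le le_rfl le_rfl)
  have he : (inZInv q)⁻¹ = algebraMap _ _ (Polynomial.X ^ N : ℝ[X]) /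
      algebraMap _ _ (q.reflect N) := by
    have := inZInv_reflect (q.reflect N) hle
    rw [Polynomial.reflect_reflect] at this
    rw [this, inv_div, map_pow, RatFunc.algebraMap_X]
  refine isRHInf_of_eq_div hb he ?_ ?_
  · refine isProper_inv (isProper_inZInv q) ?_
    rwa [impulseResponse_inZInv]
  · intro z hz
    by_cases hz0 : z = 0
    · simp [hz0]
    · rw [aeval_reflect_eq_zero le_rfl hz0] at hz
      by_contra hlt
      refine hq z⁻¹ ?_ hz
      rw [norm_inv]
      exact inv_le_one_of_one_le₀ (not_lt.1 hlt)

/-! ### Point evaluation -/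

/-- `z` is not a pole of `f`. -/
def RegularAt (z : ℂ) (f : RatFunc ℝ) : Prop := aeval z f.denom ≠ 0

theorem regularAt_of_dvd {z : ℂ} {f : RatFunc ℝ} {b : ℝ[X]} (h : f.denom ∣ b)
    (hb : aeval z b ≠ 0) : RegularAt z f := by
  obtain ⟨c, rfl⟩ := h
  rw [map_mul] at hb
  exact left_ne_zero_of_mul hb

theorem IsRHInf.regularAt {f : RatFunc ℝ} (hf : IsRHInf f) {z : ℂ} (hz : 1 ≤ ‖z‖) :
    RegularAt z f := fun h => absurd (hf.2 z h) (not_lt.2 hz)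

theorem RegularAt.mul {z : ℂ} {f g : RatFunc ℝ} (hf : RegularAt z f) (hg : RegularAt z g) :
    RegularAt z (f * g) :=
  regularAt_of_dvd (RatFunc.denom_mul_dvd f g) (by rw [map_mul]; exact mul_ne_zero hf hg)

theorem RegularAt.add {z : ℂ} {f g : RatFunc ℝ} (hf : RegularAt z f) (hg : RegularAt z g) :
    RegularAt z (f + g) :=
  regularAt_of_dvd (RatFunc.denom_add_dvd f g) (by rw [map_mul]; exact mul_ne_zero hf hg)

theorem regularAt_C (z : ℂ) (c : ℝ) : RegularAt z (RatFunc.C c) := by simp [RegularAt]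

/-- The ring of rational functions without a pole at `z`. -/
def regularRing (z : ℂ) : Subring (RatFunc ℝ) where
  carrier := {f | RegularAt z f}
  mul_mem' := RegularAt.mul
  one_mem' := by simpa using regularAt_C z 1
  add_mem' := RegularAt.add
  zero_mem' := by simpa using regularAt_C z 0
  neg_mem' {f} hf := by simpa using (regularAt_C z (-1)).mul hf

/-- At a pole the evaluation is a division by zero with a default value, so evaluation respects the
ring operations only away from poles. This is why it is packaged on `regularRing`. -/
theorem evalC_mul {z : ℂ} {f g : RatFunc ℝ} (hf : RegularAt z f) (hg : RegularAt z g) :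
    evalC (f * g) z = evalC f z * evalC g z := RatFunc.eval_mul _ _ hf hg

theorem evalC_add {z : ℂ} {f g : RatFunc ℝ} (hf : RegularAt z f) (hg : RegularAt z g) :
    evalC (f + g) z = evalC f z + evalC g z := RatFunc.eval_add _ _ hf hg

@[simp] theorem evalC_C (z : ℂ) (c : ℝ) : evalC (RatFunc.C c) z = c := RatFunc.eval_C _ _

@[simp] theorem evalC_one (z : ℂ) : evalC 1 z = 1 := RatFunc.eval_one _ _

@[simp] theorem evalC_zero (z : ℂ) : evalC 0 z = 0 := RatFunc.eval_zero _ _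

/-- Evaluation at `z` as a ring homomorphism. -/
def evalHom (z : ℂ) : regularRing z →+* ℂ where
  toFun f := evalC f.1 z
  map_one' := evalC_one z
  map_mul' f g := evalC_mul f.2 g.2
  map_zero' := evalC_zero z
  map_add' f g := evalC_add f.2 g.2

theorem evalC_sum {z : ℂ} {ι : Type*} (s : Finset ι) {f : ι → RatFunc ℝ}
    (hf : ∀ i, RegularAt z (f i)) : evalC (∑ i ∈ s, f i) z = ∑ i ∈ s, evalC (f i) z := by
  classical
  induction s using Finset.induction_on with
  | empty => simp
  | insert a s ha ih =>
    rw [Finset.sum_insert ha, Finset.sum_insert ha,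
      evalC_add (hf a) ((regularRing z).sum_mem fun i _ => hf i), ih]

theorem regularAt_X (z : ℂ) : RegularAt z RatFunc.X := by simp [RegularAt]

theorem regularAt_X_inv {z : ℂ} (hz : z ≠ 0) : RegularAt z (RatFunc.X : RatFunc ℝ)⁻¹ := by
  refine regularAt_of_dvd (b := Polynomial.X) ?_ (by simpa using hz)
  have := RatFunc.denom_inv_dvd (K := ℝ) RatFunc.X_ne_zero
  simpa using this

@[simp] theorem evalC_X (z : ℂ) : evalC RatFunc.X z = z := RatFunc.eval_X _ _

theorem evalC_X_inv {z : ℂ} (hz : z ≠ 0) : evalC (RatFunc.X : RatFunc ℝ)⁻¹ z = z⁻¹ := by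
  have h := evalC_mul (regularAt_X z) (regularAt_X_inv hz)
  rw [mul_inv_cancel₀ RatFunc.X_ne_zero, evalC_one, evalC_X] at h
  exact eq_inv_of_mul_eq_one_right h.symm

theorem evalC_pow {z : ℂ} {f : RatFunc ℝ} (hf : RegularAt z f) (n : ℕ) :
    evalC (f ^ n) z = evalC f z ^ n :=
  map_pow (evalHom z) ⟨f, hf⟩ n

theorem RegularAt.pow {z : ℂ} {f : RatFunc ℝ} (hf : RegularAt z f) (n : ℕ) :
    RegularAt z (f ^ n) := (regularRing z).pow_mem hf n

theorem evalC_inZInv (q : ℝ[X]) {z : ℂ} (hz : z ≠ 0) : evalC (inZInv q) z = aeval z⁻¹ q := by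
  have h : RegularAt z (inZInv q) ∧ evalC (inZInv q) z = aeval z⁻¹ q := by
    unfold inZInv
    induction q using Polynomial.induction_on' with
    | add p q hp hq =>
      rw [map_add, map_add, evalC_add hp.1 hq.1, hp.2, hq.2]
      exact ⟨hp.1.add hq.1, rfl⟩
    | monomial n a =>
      rw [Polynomial.aeval_monomial, Polynomial.aeval_monomial]
      have h1 := regularAt_C z a
      have h2 := (regularAt_X_inv hz).pow n
      refine ⟨h1.mul h2, ?_⟩
      refine (evalC_mul h1 h2).trans ?_
      rw [evalC_pow (regularAt_X_inv hz), evalC_X_inv hz, evalC_C]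
      rfl
  exact h.2

end MSStab

end

noncomputable section

namespace MSStab

/-! ### Absolutely summable power series -/

/-- The coefficients are absolutely summable. -/
def IsL1 {R : Type*} [NormedRing R] (a : PowerSeries R) : Prop :=
  Summable fun k => ‖PowerSeries.coeff k a‖

theorem IsL1.mul {R : Type*} [NormedRing R] [CompleteSpace R] {a b : PowerSeries R}
    (ha : IsL1 a) (hb : IsL1 b) : IsL1 (a * b) := by
  have := summable_norm_sum_mul_antidiagonal_of_summable_norm ha hb
  simpa only [IsL1, PowerSeries.coeff_mul] using this

theorem isL1_coe {R : Type*} [NormedCommRing R] (q : R[X]) : IsL1 (q : PowerSeries R) := by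
  refine summable_of_ne_finset_zero (s := Finset.range (q.natDegree + 1)) fun k hk => ?_
  rw [Polynomial.coeff_coe, Polynomial.coeff_eq_zero_of_natDegree_lt, norm_zero]
  simpa [Nat.lt_succ_iff] using hk

/-- The value `∑ aₖ Sᵏ`. -/
def evalSeries {𝔸 : Type*} [NormedRing 𝔸] [NormedAlgebra ℝ 𝔸] (S : 𝔸) (a : PowerSeries ℝ) : 𝔸 :=
  ∑' k, PowerSeries.coeff k a • S ^ k

section EvalSeries

variable {𝔸 : Type*} [NormedRing 𝔸] [NormedAlgebra ℝ 𝔸] {S : 𝔸}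

theorem summable_norm_coeff_smul_pow {c : ℝ} (hS : ∀ k, ‖S ^ k‖ ≤ c) {a : PowerSeries ℝ}
    (ha : IsL1 a) : Summable fun k => ‖PowerSeries.coeff k a • S ^ k‖ := by
  refine Summable.of_nonneg_of_le (fun _ => norm_nonneg _) (fun k => ?_) (ha.mul_right c)
  rw [norm_smul]
  exact mul_le_mul_of_nonneg_left (hS k) (norm_nonneg _)

/-- A Cauchy product; bounded powers of S are enough because the coefficients are absolutely
summable. The algebra is general because S is a point of the closed disc in some uses and the matrix
Â⁻¹ in others. -/
theorem evalSeries_mul [CompleteSpace 𝔸] {c : ℝ} (hS : ∀ k, ‖S ^ k‖ ≤ c) {a b : PowerSeries ℝ}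
    (ha : IsL1 a) (hb : IsL1 b) :
    evalSeries S (a * b) = evalSeries S a * evalSeries S b := by
  unfold evalSeries
  rw [tsum_mul_tsum_eq_tsum_sum_antidiagonal_of_summable_norm
    (summable_norm_coeff_smul_pow hS ha) (summable_norm_coeff_smul_pow hS hb)]
  congr 1; ext k
  rw [PowerSeries.coeff_mul, Finset.sum_smul]
  refine Finset.sum_congr rfl fun p hp => ?_
  rw [smul_mul_smul_comm, ← pow_add, Finset.HasAntidiagonal.mem_antidiagonal.1 hp]

theorem evalSeries_coe (S : 𝔸) (q : ℝ[X]) : evalSeries S (q : PowerSeries ℝ) = aeval S q := by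
  unfold evalSeries
  rw [Polynomial.aeval_eq_sum_range, tsum_eq_sum (s := Finset.range (q.natDegree + 1))]
  · simp
  · intro k hk
    rw [Polynomial.coeff_coe, Polynomial.coeff_eq_zero_of_natDegree_lt, zero_smul]
    simpa [Nat.lt_succ_iff] using hk

end EvalSeries

theorem isL1_geom {ζ : ℂ} (h : ‖ζ‖ < 1) : IsL1 (PowerSeries.mk fun k => ζ ^ k) := by
  simpa [IsL1, norm_pow] using summable_geometric_of_lt_one (norm_nonneg ζ) h

/-- Reflection turns X - ζ into 1 - ζX, which is inverted by the geometric series of ζ; absolutely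
summable series are closed under products. -/
theorem exists_isL1_inv_reflect_prod (s : Multiset ℂ) (hs : ∀ ζ ∈ s, ‖ζ‖ < 1) :
    ∃ a : PowerSeries ℂ, IsL1 a ∧
      a * (((s.map fun ζ => Polynomial.X - Polynomial.C ζ).prod.reflect (Multiset.card s) : ℂ[X]) :
        PowerSeries ℂ) = 1 := by
  induction s using Multiset.induction_on with
  | empty =>
    refine ⟨1, ?_, by simp [Polynomial.reflect_one]⟩
    simpa using isL1_coe (1 : ℂ[X])
  | cons ζ s ih =>
    obtain ⟨a, ha, h⟩ := ih fun x hx => hs x (Multiset.mem_cons_of_mem hx)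
    have hζ := hs ζ (Multiset.mem_cons_self _ _)
    refine ⟨a * PowerSeries.mk fun k => ζ ^ k, ha.mul (isL1_geom hζ), ?_⟩
    have hdeg : ((s.map fun ζ => Polynomial.X - Polynomial.C ζ).prod).natDegree ≤
        Multiset.card s := by
      rw [Polynomial.natDegree_multiset_prod_X_sub_C_eq_card]
    rw [Multiset.map_cons, Multiset.prod_cons, Multiset.card_cons, add_comm,
      Polynomial.reflect_mul _ _ (Polynomial.natDegree_X_sub_C_le ζ) hdeg,
      Polynomial.coe_mul]
    have h1 : (PowerSeries.mk fun k => ζ ^ k) *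
        (((Polynomial.X - Polynomial.C ζ : ℂ[X]).reflect 1 : ℂ[X]) : PowerSeries ℂ) = 1 := by
      rw [Polynomial.reflect_sub, Polynomial.reflect_one_X, Polynomial.reflect_C, pow_one]
      ext k
      rw [Polynomial.coe_sub, Polynomial.coe_mul, Polynomial.coe_one, Polynomial.coe_X,
        Polynomial.coe_C, mul_sub, mul_one, map_sub, ← mul_assoc]
      cases k with
      | zero => simp
      | succ k =>
        rw [PowerSeries.coeff_succ_mul_X, PowerSeries.coeff_mul_C]
        simp [PowerSeries.coeff_one, pow_succ]
    rw [mul_mul_mul_comm, mul_comm a, mul_mul_mul_comm, h, mul_one, mul_comm, h1]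

/-- The poles may be nonreal, so the denominator is split over ℂ and the expansion is written there
as a polynomial times a product of geometric series. -/
theorem IsRHInf.isL1 {f : RatFunc ℝ} (hf : IsRHInf f) : IsL1 (imp f) := by
  set d : ℂ[X] := f.denom.map (algebraMap ℝ ℂ) with hd
  have hmon : d.Monic := f.monic_denom.map _
  have hsplit := IsAlgClosed.splits d
  have hprod : d = (d.roots.map fun ζ => Polynomial.X - Polynomial.C ζ).prod :=
    hsplit.eq_prod_roots_of_monic hmon
  have hcard : Multiset.card d.roots = f.denom.natDegree := by
    rw [← hsplit.natDegree_eq_card_roots, hd, Polynomial.natDegree_map]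
  obtain ⟨a, ha, h⟩ := exists_isL1_inv_reflect_prod d.roots fun ζ hζ => by
    refine hf.2 ζ ?_
    have := (Polynomial.mem_roots'.1 hζ).2
    rwa [Polynomial.IsRoot, hd, Polynomial.eval_map, ← Polynomial.aeval_def] at this
  rw [← hprod, hcard] at h
  have h1 := congrArg (PowerSeries.map (algebraMap ℝ ℂ)) (imp_mul_reflect_denom f)
  rw [map_mul, ← Polynomial.polynomial_map_coe, ← Polynomial.polynomial_map_coe,
    ← Polynomial.reflect_map, ← Polynomial.reflect_map] at h1
  have h2 : PowerSeries.map (algebraMap ℝ ℂ) (imp f) =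
      (((f.num.map (algebraMap ℝ ℂ)).reflect f.denom.natDegree : ℂ[X]) : PowerSeries ℂ) * a := by
    rw [← h1, mul_assoc, mul_comm _ a, h, mul_one]
  have h3 : IsL1 (PowerSeries.map (algebraMap ℝ ℂ) (imp f)) := by
    rw [h2]; exact (isL1_coe _).mul ha
  simpa [IsL1] using h3

theorem norm_pow_le_one {z : ℂ} (hz : ‖z‖ ≤ 1) (k : ℕ) : ‖z ^ k‖ ≤ 1 := by
  rw [norm_pow]; exact pow_le_one₀ (norm_nonneg _) hz

/-- At a pole z with |z| ≥ 1 the summable series has a finite value at z⁻¹, so the relation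
expansion times denominator equals numerator makes the numerator vanish at z as well. This
contradicts coprimality. -/
theorem isRHInf_of_isL1 {f : RatFunc ℝ} (hp : IsProper f) (h : IsL1 (imp f)) : IsRHInf f := by
  refine ⟨hp, fun z hz => ?_⟩
  by_contra hlt
  rw [not_lt] at hlt
  have hz0 : z ≠ 0 := fun h => by rw [h, norm_zero] at hlt; linarith
  have hzi : ‖z⁻¹‖ ≤ 1 := by rw [norm_inv]; exact inv_le_one_of_one_le₀ hlt
  have h1 := congrArg (evalSeries z⁻¹) (imp_mul_reflect_denom f)
  rw [evalSeries_mul (norm_pow_le_one hzi) h (isL1_coe _), evalSeries_coe, evalSeries_coe,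
    (aeval_reflect_eq_zero le_rfl (inv_ne_zero hz0)).2 (by rwa [inv_inv]), mul_zero] at h1
  have h2 := (aeval_reflect_eq_zero (isProper_iff_natDegree.1 hp) (inv_ne_zero hz0)).1 h1.symm
  rw [inv_inv] at h2
  obtain ⟨a, b, hab⟩ := f.isCoprime_num_denom
  have h3 := congrArg (aeval z) hab
  rw [map_add, map_mul, map_mul, h2, hz, map_one] at h3
  simp at h3

theorem evalC_eq_evalSeries {f : RatFunc ℝ} (hf : IsRHInf f) {z : ℂ} (hz : 1 ≤ ‖z‖) :
    evalC f z = evalSeries z⁻¹ (imp f) := by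
  have hz0 : z ≠ 0 := fun h => by rw [h, norm_zero] at hz; linarith
  have hzi : ‖z⁻¹‖ ≤ 1 := by rw [norm_inv]; exact inv_le_one_of_one_le₀ hz
  have h1 := congrArg (evalSeries z⁻¹) (imp_mul_reflect_denom f)
  rw [evalSeries_mul (norm_pow_le_one hzi) hf.isL1 (isL1_coe _), evalSeries_coe,
    evalSeries_coe] at h1
  have hd : aeval z⁻¹ (f.denom.reflect f.denom.natDegree) ≠ 0 := by
    rw [Ne, aeval_reflect_eq_zero le_rfl (inv_ne_zero hz0), inv_inv]
    exact hf.regularAt hz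
  set rd := f.denom.reflect f.denom.natDegree with hrd
  have hrd0 : inZInv rd ≠ 0 := by
    intro h
    have := evalC_inZInv rd hz0
    rw [h, evalC_zero] at this
    exact hd this.symm
  have h2 : f * inZInv rd = inZInv (f.num.reflect f.denom.natDegree) := by
    conv_lhs => rw [eq_inZInv_div hf.1]
    exact div_mul_cancel₀ _ hrd0
  have h3 := congrArg (fun g => evalC g z) h2
  rw [evalC_mul (hf.regularAt hz) ((isRHInf_inZInv rd).regularAt hz), evalC_inZInv _ hz0,
    evalC_inZInv _ hz0, ← h1] at h3
  exact mul_right_cancel₀ hd h3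

/-! ### Parseval's identity -/

/-- The point `e^{iθ}`. -/
def circ (θ : ℝ) : ℂ := Complex.exp (θ * Complex.I)

theorem norm_circ (θ : ℝ) : ‖circ θ‖ = 1 := Complex.norm_exp_ofReal_mul_I θ

theorem circ_ne_zero (θ : ℝ) : circ θ ≠ 0 := Complex.exp_ne_zero _

theorem continuous_circ : Continuous circ := by unfold circ; fun_prop

theorem continuous_evalC_circ {f : RatFunc ℝ} (hf : IsRHInf f) :
    Continuous fun θ => evalC f (circ θ) := by
  simp_rw [fun θ => evalC_eq_evalSeries hf (norm_circ θ).ge]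
  unfold evalSeries
  refine continuous_tsum (u := fun k => ‖PowerSeries.coeff k (imp f)‖) (fun k => ?_) hf.isL1 ?_
  · have := (continuous_circ.inv₀ circ_ne_zero).pow k
    exact this.const_smul (PowerSeries.coeff k (imp f))
  · intro k θ
    rw [norm_smul]
    exact mul_le_of_le_one_right (norm_nonneg _)
      (norm_pow_le_one (by rw [norm_inv, norm_circ, inv_one]) k)

theorem integral_circ_zpow (k l : ℕ) :
    ∫ θ in (-Real.pi)..Real.pi, (starRingEnd ℂ) ((circ θ)⁻¹ ^ k) * (circ θ)⁻¹ ^ l =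
      if k = l then (2 * Real.pi : ℂ) else 0 := by
  have h : ∀ θ : ℝ, (starRingEnd ℂ) ((circ θ)⁻¹ ^ k) * (circ θ)⁻¹ ^ l =
      Complex.exp ((((k : ℂ) - l) * Complex.I) * θ) := by
    intro θ
    rw [map_pow, circ, ← Complex.exp_neg, ← Complex.exp_conj, ← Complex.exp_nat_mul,
      ← Complex.exp_nat_mul, ← Complex.exp_add]
    congr 1
    simp only [map_neg, map_mul, Complex.conj_ofReal, Complex.conj_I]
    ring
  simp_rw [h]
  split_ifs with hkl
  · subst hkl
    simp only [sub_self, zero_mul, Complex.exp_zero, intervalIntegral.integral_const,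
      sub_neg_eq_add, Complex.real_smul, mul_one]
    push_cast; ring
  · have hc : ((k : ℂ) - l) * Complex.I ≠ 0 :=
      mul_ne_zero (sub_ne_zero.2 (by exact_mod_cast hkl)) Complex.I_ne_zero
    rw [integral_exp_mul_complex hc]
    have : Complex.exp (((k : ℂ) - l) * Complex.I * (Real.pi : ℝ)) =
        Complex.exp (((k : ℂ) - l) * Complex.I * ((-Real.pi : ℝ) : ℂ)) := by
      rw [Complex.exp_eq_exp_iff_exists_int]
      refine ⟨(k : ℤ) - l, ?_⟩
      push_cast; ring
    rw [this, sub_self, zero_div]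

theorem tsum_prod_diag (f : ℕ × ℕ → ℂ) (hf : ∀ p : ℕ × ℕ, p.1 ≠ p.2 → f p = 0) :
    ∑' p, f p = ∑' k, f (k, k) := by
  have hinj : Function.Injective fun k : ℕ => (k, k) := fun a b h => (Prod.ext_iff.1 h).1
  refine (hinj.tsum_eq fun p hp => ?_).symm
  by_contra hne
  exact Function.mem_support.1 hp (hf p fun h => hne ⟨p.1, Prod.ext rfl h⟩)

theorem summable_mul_nonneg {a b : ℕ → ℝ} (ha0 : ∀ k, 0 ≤ a k) (hb0 : ∀ k, 0 ≤ b k)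
    (ha : Summable a) (hb : Summable b) : Summable fun p : ℕ × ℕ => a p.1 * b p.2 :=
  ha.mul_of_nonneg hb ha0 hb0

theorem integral_conj_tsum_mul_tsum {a b : ℕ → ℝ} (ha : Summable fun k => ‖a k‖)
    (hb : Summable fun k => ‖b k‖) :
    ∫ θ in (-Real.pi)..Real.pi,
      (starRingEnd ℂ) (∑' k, a k • (circ θ)⁻¹ ^ k) * ∑' k, b k • (circ θ)⁻¹ ^ k =
      2 * Real.pi * ((∑' k, a k * b k : ℝ) : ℂ) := by
  have h1 : Continuous fun θ => (circ θ)⁻¹ := continuous_circ.inv₀ circ_ne_zero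
  have h2 : ∀ p : ℕ × ℕ, Continuous fun θ => ((a p.1 : ℂ) * b p.2) *
      ((starRingEnd ℂ) ((circ θ)⁻¹ ^ p.1) * (circ θ)⁻¹ ^ p.2) :=
    fun p => (((h1.pow p.1).star).mul (h1.pow p.2)).const_mul _
  obtain ⟨F, hF⟩ : ∃ F : ℕ × ℕ → C(ℝ, ℂ), ∀ p θ, F p θ = ((a p.1 : ℂ) * b p.2) *
        ((starRingEnd ℂ) ((circ θ)⁻¹ ^ p.1) * (circ θ)⁻¹ ^ p.2) :=
    ⟨fun p => ⟨_, h2 p⟩, fun p θ => rfl⟩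
  have hn : ∀ (θ : ℝ) (k : ℕ), ‖(circ θ)⁻¹ ^ k‖ = 1 := fun θ k => by
    rw [norm_pow, norm_inv, norm_circ, inv_one, one_pow]
  have hbound : ∀ p θ, ‖F p θ‖ = ‖a p.1‖ * ‖b p.2‖ := by
    intro p θ
    simp only [hF, norm_mul, RCLike.norm_conj, hn, Complex.norm_real, mul_one]
  have hprod : Summable fun p : ℕ × ℕ => ‖a p.1‖ * ‖b p.2‖ :=
    summable_mul_nonneg (a := fun k => ‖a k‖) (b := fun k => ‖b k‖)
      (fun _ => norm_nonneg _) (fun _ => norm_nonneg _) ha hb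
  have hval : ∀ θ, (starRingEnd ℂ) (∑' k, a k • (circ θ)⁻¹ ^ k) * ∑' k, b k • (circ θ)⁻¹ ^ k =
      ∑' p, F p θ := by
    intro θ
    rw [Complex.conj_tsum, tsum_mul_tsum_of_summable_norm]
    · congr 1; ext p
      simp only [hF, Complex.real_smul, map_mul, Complex.conj_ofReal]
      ring
    · simpa only [RCLike.norm_conj, norm_smul, hn, mul_one] using ha
    · simpa only [norm_smul, hn, mul_one] using hb
  have hsum := intervalIntegral.hasSum_intervalIntegral_of_summable_norm (a := -Real.pi)
    (b := Real.pi) (f := F) (hprod.of_nonneg_of_le (fun p => norm_nonneg _) fun p =>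
      (ContinuousMap.norm_le _ (mul_nonneg (norm_nonneg _) (norm_nonneg _))).2
        fun x => (hbound p x).le)
  have hint : ∀ p : ℕ × ℕ, ∫ θ in (-Real.pi)..Real.pi, F p θ =
      ((a p.1 : ℂ) * b p.2) * if p.1 = p.2 then (2 * Real.pi : ℂ) else 0 := by
    intro p
    rw [← integral_circ_zpow, ← intervalIntegral.integral_const_mul]
    simp only [hF]
  simp_rw [hval]
  rw [← hsum.tsum_eq]
  simp_rw [hint]
  rw [Complex.ofReal_tsum, tsum_prod_diag _ fun p hp => by rw [if_neg hp, mul_zero],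
    ← tsum_mul_left]
  congr 1; ext k
  simp only [if_true]
  push_cast
  ring

theorem parseval {f g : RatFunc ℝ} (hf : IsRHInf f) (hg : IsRHInf g) :
    ∫ θ in (-Real.pi)..Real.pi,
      (starRingEnd ℂ) (evalC f (circ θ)) * evalC g (circ θ) =
      2 * Real.pi * ((∑' k, impulseResponse f k * impulseResponse g k : ℝ) : ℂ) := by
  simp_rw [fun θ => evalC_eq_evalSeries hf (norm_circ θ).ge,
    fun θ => evalC_eq_evalSeries hg (norm_circ θ).ge, evalSeries, coeff_imp]
  have ha : Summable fun k => ‖impulseResponse f k‖ := by simpa [IsL1] using hf.isL1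
  have hb : Summable fun k => ‖impulseResponse g k‖ := by simpa [IsL1] using hg.isL1
  exact integral_conj_tsum_mul_tsum ha hb

theorem summable_sq_impulseResponse {f : RatFunc ℝ} (hf : IsRHInf f) :
    Summable fun k => impulseResponse f k ^ 2 := by
  have h : Summable fun k => |impulseResponse f k| := by simpa [IsL1] using hf.isL1
  have h2 := summable_mul_nonneg (fun _ => abs_nonneg _) (fun _ => abs_nonneg _) h h
  have hinj : Function.Injective fun k : ℕ => (k, k) := fun a b h => (Prod.ext_iff.1 h).1
  refine (h2.comp_injective hinj).congr fun k => ?_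
  simp [← sq]

theorem h2NormSq_eq_tsum {f : RatFunc ℝ} (hf : IsRHInf f) :
    h2NormSq f = ∑' k, impulseResponse f k ^ 2 := by
  have h := parseval hf hf
  have h1 : ∀ θ, (starRingEnd ℂ) (evalC f (circ θ)) * evalC f (circ θ) =
      ((‖evalC f (circ θ)‖ ^ 2 : ℝ) : ℂ) := fun θ => by
    rw [mul_comm, Complex.mul_conj, Complex.normSq_eq_norm_sq]
  simp_rw [h1] at h
  rw [intervalIntegral.integral_ofReal] at h
  have h2 : h2NormSq f = ∑' k, impulseResponse f k * impulseResponse f k := by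
    have hpi := Real.pi_pos
    have h3 : ∫ θ in (-Real.pi)..Real.pi, ‖evalC f (circ θ)‖ ^ 2 =
        2 * Real.pi * ∑' k, impulseResponse f k * impulseResponse f k := by exact_mod_cast h
    have h4 : h2NormSq f = (2 * Real.pi)⁻¹ *
        ∫ θ in (-Real.pi)..Real.pi, ‖evalC f (circ θ)‖ ^ 2 := rfl
    rw [h4, h3, inv_mul_cancel_left₀ (by positivity)]
  simpa only [sq] using h2

theorem h2NormSq_nonneg (f : RatFunc ℝ) : 0 ≤ h2NormSq f := by
  unfold h2NormSq
  refine mul_nonneg (by positivity) (intervalIntegral.integral_nonneg ?_ fun _ _ => by positivity)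
  linarith [Real.pi_pos]

end MSStab

end

noncomputable section

namespace MSStab

/-! ### Density of the range of multiplication by an outer function -/

/-- Factor by factor: |w - ω| ≤ |rw - ω| + (1 - r), and 1 - r ≤ |ω| - |rw| ≤ |rw - ω|. The constant
does not depend on r, which gives the domination needed as r tends to 1. -/
theorem norm_multiset_prod_sub_le (s : Multiset ℂ) (hs : ∀ ω ∈ s, 1 ≤ ‖ω‖) {w : ℂ}
    (hw : ‖w‖ = 1) {r : ℝ} (hr0 : 0 ≤ r) (hr1 : r ≤ 1) :
    ‖(s.map fun ω => w - ω).prod‖ ≤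
      2 ^ Multiset.card s * ‖(s.map fun ω => (r : ℂ) * w - ω).prod‖ := by
  induction s using Multiset.induction_on with
  | empty => simp
  | cons ω s ih =>
    have ih' := ih fun x hx => hs x (Multiset.mem_cons_of_mem hx)
    have hω := hs ω (Multiset.mem_cons_self _ _)
    have h1 : ‖w - ω‖ ≤ 2 * ‖(r : ℂ) * w - ω‖ := by
      have e1 : w - ω = ((r : ℂ) * w - ω) + ((1 - r : ℝ) : ℂ) * w := by push_cast; ring
      have e2 : ‖((1 - r : ℝ) : ℂ) * w‖ = 1 - r := by
        rw [norm_mul, hw, mul_one, Complex.norm_real, Real.norm_of_nonneg (by linarith)]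
      have e3 : 1 - r ≤ ‖(r : ℂ) * w - ω‖ := by
        have := norm_sub_norm_le ω ((r : ℂ) * w)
        rw [norm_mul, hw, mul_one, Complex.norm_real, Real.norm_of_nonneg hr0,
          norm_sub_rev] at this
        linarith
      calc ‖w - ω‖ ≤ ‖(r : ℂ) * w - ω‖ + ‖((1 - r : ℝ) : ℂ) * w‖ := by
            rw [e1]; exact norm_add_le _ _
        _ ≤ _ := by rw [e2]; linarith
    simp only [Multiset.map_cons, Multiset.prod_cons, norm_mul, Multiset.card_cons]
    calc _ ≤ (2 * ‖(r : ℂ) * w - ω‖) * (2 ^ Multiset.card s *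
            ‖(s.map fun ω => (r : ℂ) * w - ω).prod‖) :=
          mul_le_mul h1 ih' (norm_nonneg _) (by positivity)
      _ = _ := by ring

theorem norm_aeval_le_of_no_zeros {n : ℝ[X]} (hn : ∀ w : ℂ, ‖w‖ < 1 → aeval w n ≠ 0) {w : ℂ}
    (hw : ‖w‖ = 1) {r : ℝ} (hr0 : 0 ≤ r) (hr1 : r ≤ 1) :
    ‖aeval w n‖ ≤ 2 ^ n.natDegree * ‖aeval ((r : ℂ) * w) n‖ := by
  have hsplit := IsAlgClosed.splits (n.map (algebraMap ℝ ℂ))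
  have hev : ∀ x : ℂ, aeval x n = (n.map (algebraMap ℝ ℂ)).leadingCoeff *
      (((n.map (algebraMap ℝ ℂ)).roots.map fun ω => x - ω).prod) := by
    intro x
    rw [Polynomial.aeval_def, ← Polynomial.eval_map]
    conv_lhs => rw [hsplit.eq_prod_roots]
    rw [Polynomial.eval_mul, Polynomial.eval_C, Polynomial.eval_multiset_prod, Multiset.map_map]
    simp
  have hcard : Multiset.card (n.map (algebraMap ℝ ℂ)).roots = n.natDegree := by
    rw [← hsplit.natDegree_eq_card_roots, Polynomial.natDegree_map]
  have h := norm_multiset_prod_sub_le (n.map (algebraMap ℝ ℂ)).roots (fun ω hω => by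
    by_contra hlt
    refine hn ω (not_le.1 hlt) ?_
    have := (Polynomial.mem_roots'.1 hω).2
    rwa [Polynomial.IsRoot, Polynomial.eval_map, ← Polynomial.aeval_def] at this) hw hr0 hr1
  rw [hev, hev, norm_mul, norm_mul, ← hcard, mul_left_comm]
  exact mul_le_mul_of_nonneg_left h (norm_nonneg _)

theorem countable_circ_fiber (ζ : ℂ) : {θ : ℝ | circ θ = ζ}.Countable := by
  rcases Set.eq_empty_or_nonempty {θ : ℝ | circ θ = ζ} with h | ⟨θ₀, h₀⟩
  · rw [h]; exact Set.countable_empty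
  · refine (Set.countable_range fun k : ℤ => θ₀ + k * (2 * Real.pi)).mono fun θ hθ => ?_
    have h : Complex.exp (θ * Complex.I) = Complex.exp (θ₀ * Complex.I) :=
      Eq.trans hθ (Eq.symm h₀)
    obtain ⟨k, hk⟩ := Complex.exp_eq_exp_iff_exists_int.1 h
    refine ⟨k, ?_⟩
    have h1 : (θ : ℂ) * Complex.I = ((θ₀ + k * (2 * Real.pi) : ℝ) : ℂ) * Complex.I := by
      rw [hk]; push_cast; ring
    have h2 := mul_right_cancel₀ Complex.I_ne_zero h1
    exact_mod_cast h2.symm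

theorem ae_aeval_circ_inv_ne_zero {n : ℝ[X]} (hn : n ≠ 0) :
    ∀ᵐ θ : ℝ, aeval (circ θ)⁻¹ n ≠ 0 := by
  have hfin : {w : ℂ | aeval w n = 0}.Finite := by
    have h := (n.map (algebraMap ℝ ℂ)).finite_setOfPred_isRoot
      ((Polynomial.map_ne_zero_iff (algebraMap ℝ ℂ).injective).2 hn)
    refine h.subset fun w hw => ?_
    rw [Set.mem_ofPred_eq, Polynomial.IsRoot, Polynomial.eval_map, ← Polynomial.aeval_def]
    exact hw
  have hc : {θ : ℝ | aeval (circ θ)⁻¹ n = 0}.Countable := by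
    refine (hfin.countable.biUnion fun w _ => countable_circ_fiber w⁻¹).mono fun θ hθ => ?_
    simp only [Set.mem_iUnion]
    exact ⟨(circ θ)⁻¹, hθ, by simp⟩
  filter_upwards [hc.ae_notMem volume] with θ hθ
  exact hθ

theorem regularAt_inv_of_isRHInf {f : RatFunc ℝ} (hf : IsRHInf f⁻¹) (hf' : IsRHInf f)
    (h0 : f ≠ 0) {z : ℂ} (hz : 1 ≤ ‖z‖) : evalC f⁻¹ z = (evalC f z)⁻¹ := by
  have h := evalC_mul (hf'.regularAt hz) (hf.regularAt hz)
  rw [mul_inv_cancel₀ h0, evalC_one] at h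
  exact eq_inv_of_mul_eq_one_right h.symm

theorem evalC_sub {z : ℂ} {f g : RatFunc ℝ} (hf : RegularAt z f) (hg : RegularAt z g) :
    evalC (f - g) z = evalC f z - evalC g z :=
  map_sub (evalHom z) ⟨f, hf⟩ ⟨g, hg⟩

/-- Dividing p by n is impossible when n has zeros on the circle. Dividing by the dilation n(r·)
with r < 1 is allowed, and n / n(r·) tends to 1 off finitely many points of the circle while bounded
by 2 to the degree of n, so dominated convergence applies. -/
theorem exists_h2NormSq_sub_inZInv_mul_lt {n : ℝ[X]}
    (hn : ∀ w : ℂ, ‖w‖ < 1 → aeval w n ≠ 0) {p : RatFunc ℝ} (hp : IsRHInf p) {ε : ℝ}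
    (hε : 0 < ε) : ∃ s, IsRHInf s ∧ h2NormSq (p - inZInv n * s) < ε := by
  have hn0 : n ≠ 0 := by rintro rfl; exact hn 0 (by simp) (by simp)
  -- Radii in [0, 1) increasing to 1; strict inequality makes each dilation zero-free on the closed
  -- disc, hence a unit of RH∞.
  set r : ℕ → ℝ := fun k => 1 - 1 / ((k : ℝ) + 1) with hr
  have hr0 : ∀ k, 0 ≤ r k := fun k => by
    have : 1 / ((k : ℝ) + 1) ≤ 1 := by
      rw [div_le_one (by positivity)]; linarith [(Nat.cast_nonneg k : (0 : ℝ) ≤ k)]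
    simp only [hr]; linarith
  have hr1 : ∀ k, r k < 1 := fun k => by
    have : 0 < 1 / ((k : ℝ) + 1) := by positivity
    simp only [hr]; linarith
  have hrt : Filter.Tendsto r Filter.atTop (nhds 1) := by
    have := (tendsto_one_div_add_atTop_nhds_zero_nat (𝕜 := ℝ)).const_sub 1
    rwa [sub_zero] at this
  set q : ℕ → ℝ[X] := fun k => n.comp (Polynomial.C (r k) * Polynomial.X) with hq
  have hqe : ∀ k (w : ℂ), aeval w (q k) = aeval ((r k : ℂ) * w) n := fun k w => by
    simp [hq, Polynomial.aeval_comp]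
  have hqz : ∀ k (w : ℂ), ‖w‖ ≤ 1 → aeval w (q k) ≠ 0 := fun k w hw => by
    rw [hqe]
    refine hn _ ?_
    rw [norm_mul, Complex.norm_real, Real.norm_of_nonneg (hr0 k)]
    nlinarith [hr0 k, hr1 k, norm_nonneg w]
  have hqinv : ∀ k, IsRHInf (inZInv (q k))⁻¹ := fun k => isRHInf_inv_inZInv (hqz k)
  have hwn : ∀ θ, ‖(circ θ)⁻¹‖ = 1 := fun θ => by rw [norm_inv, norm_circ, inv_one]
  have hqne : ∀ k, inZInv (q k) ≠ 0 := fun k h => by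
    have := evalC_inZInv (q k) (circ_ne_zero 0)
    rw [h, evalC_zero] at this
    exact hqz k _ (hwn 0).le this.symm
  set s : ℕ → RatFunc ℝ := fun k => p * (inZInv (q k))⁻¹ with hs
  have hsR : ∀ k, IsRHInf (s k) := fun k => hp.mul (hqinv k)
  have hev : ∀ k θ, evalC (p - inZInv n * s k) (circ θ) = evalC p (circ θ) *
      (1 - aeval (circ θ)⁻¹ n * (aeval ((r k : ℂ) * (circ θ)⁻¹) n)⁻¹) := by
    intro k θ
    have h1 := (norm_circ θ).ge
    have e1 := hp.regularAt h1
    have e2 := (isRHInf_inZInv n).regularAt h1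
    have e3 := (hqinv k).regularAt h1
    simp only [hs]
    rw [evalC_sub e1 (e2.mul (e1.mul e3)), evalC_mul e2 (e1.mul e3), evalC_mul e1 e3,
      regularAt_inv_of_isRHInf (hqinv k) (isRHInf_inZInv _) (hqne k) h1,
      evalC_inZInv _ (circ_ne_zero θ), evalC_inZInv _ (circ_ne_zero θ), hqe]
    ring
  have hlim : Filter.Tendsto (fun k => ∫ θ in (-Real.pi)..Real.pi,
      ‖evalC (p - inZInv n * s k) (circ θ)‖ ^ 2) Filter.atTop
      (nhds (∫ _ in (-Real.pi)..Real.pi, (0 : ℝ))) := by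
    refine intervalIntegral.tendsto_integral_filter_of_dominated_convergence
      (fun θ => (‖evalC p (circ θ)‖ * (1 + 2 ^ n.natDegree)) ^ 2) ?_ ?_ ?_ ?_
    · refine Filter.Eventually.of_forall fun k => ?_
      have hc := continuous_evalC_circ ((hp.add ((isRHInf_inZInv n).mul (hsR k)).neg))
      rw [← sub_eq_add_neg] at hc
      exact (hc.norm.pow 2).aestronglyMeasurable
    · refine Filter.Eventually.of_forall fun k => Filter.Eventually.of_forall fun θ _ => ?_
      rw [Real.norm_of_nonneg (by positivity), hev, norm_mul]
      gcongr
      refine (norm_sub_le _ _).trans ?_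
      rw [norm_one, norm_mul, norm_inv]
      gcongr
      have h1 := norm_aeval_le_of_no_zeros hn (hwn θ) (hr0 k) (hr1 k).le
      have h2 : 0 < ‖aeval ((r k : ℂ) * (circ θ)⁻¹) n‖ := by
        rw [← hqe]; exact norm_pos_iff.2 (hqz k _ (hwn θ).le)
      rw [← div_eq_mul_inv, div_le_iff₀ h2]
      exact h1
    · exact (((continuous_evalC_circ hp).norm.mul continuous_const).pow 2).intervalIntegrable _ _
    -- Zeros of n on the circle form a null set of angles; elsewhere the quotient tends to 1.
    · filter_upwards [ae_aeval_circ_inv_ne_zero hn0] with θ hθ _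
      simp_rw [hev]
      have h1 : Filter.Tendsto (fun k => aeval ((r k : ℂ) * (circ θ)⁻¹) n) Filter.atTop
          (nhds (aeval (circ θ)⁻¹ n)) := by
        have hc : Continuous fun x : ℝ => aeval ((x : ℂ) * (circ θ)⁻¹) n := by
          have := n.continuous_aeval (A := ℂ)
          exact this.comp (by fun_prop)
        have := (hc.tendsto 1).comp hrt
        simpa [Function.comp_def] using this
      have h2 := ((((h1.inv₀ hθ).const_mul (aeval (circ θ)⁻¹ n)).const_sub 1).const_mul
        (evalC p (circ θ))).norm.pow 2
      rw [mul_inv_cancel₀ hθ, sub_self, mul_zero, norm_zero] at h2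
      simpa using h2
  rw [intervalIntegral.integral_zero] at hlim
  have hlim' : Filter.Tendsto (fun k => h2NormSq (p - inZInv n * s k)) Filter.atTop (nhds 0) := by
    have := hlim.const_mul (2 * Real.pi)⁻¹
    rw [mul_zero] at this
    exact this
  obtain ⟨k, hk⟩ := (hlim'.eventually (gt_mem_nhds hε)).exists
  exact ⟨s k, hsR k, hk⟩

/-- Multiplying d by its denominator written in z⁻¹ leaves the numerator in z⁻¹, which has no zeros
in the open disc; the extra factor is absorbed in s. The condition on the zeroth coefficient covers
the point z = ∞, that is w = 0, which evaluation at finite z does not see. -/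
theorem exists_h2NormSq_sub_mul_lt {d : RatFunc ℝ} (hd : IsRHInf d)
    (h0 : impulseResponse d 0 ≠ 0) (hz : ∀ z : ℂ, 1 < ‖z‖ → evalC d z ≠ 0)
    {p : RatFunc ℝ} (hp : IsRHInf p) {ε : ℝ} (hε : 0 < ε) :
    ∃ s, IsRHInf s ∧ h2NormSq (p - d * s) < ε := by
  set N := d.denom.natDegree with hN
  have hrd : d * inZInv (d.denom.reflect N) = inZInv (d.num.reflect N) := by
    refine (eq_div_iff fun h => ?_).1 (eq_inZInv_div hd.1)
    have h1 := imp_inZInv (d.denom.reflect N)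
    rw [h, imp_zero] at h1
    exact coe_reflect_ne_zero d.denom_ne_zero N h1.symm
  have hn : ∀ w : ℂ, ‖w‖ < 1 → aeval w (d.num.reflect N) ≠ 0 := by
    intro w hw h
    by_cases hw0 : w = 0
    · subst hw0
      rw [← Polynomial.coeff_zero_eq_aeval_zero'] at h
      have h1 : (d.num.reflect N).coeff 0 = 0 := by simpa using h
      have h2 := congrArg (PowerSeries.coeff 0) (imp_mul_reflect_denom d)
      rw [PowerSeries.coeff_mul, Finset.Nat.antidiagonal_zero, Finset.sum_singleton] at h2
      simp only [Polynomial.coeff_coe, coeff_imp] at h2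
      rw [h1, Polynomial.coeff_reflect, Polynomial.revAt_zero] at h2
      have h3 := d.monic_denom
      rw [Polynomial.Monic, Polynomial.leadingCoeff] at h3
      rw [h3, mul_one] at h2
      exact h0 h2
    · rw [aeval_reflect_eq_zero (isProper_iff_natDegree.1 hd.1) hw0] at h
      refine hz w⁻¹ ?_ ?_
      · rw [norm_inv]
        exact (one_lt_inv₀ (norm_pos_iff.2 hw0)).2 hw
      · unfold evalC RatFunc.eval
        rw [← Polynomial.aeval_def, h, zero_div]
  obtain ⟨s, hs, h⟩ := exists_h2NormSq_sub_inZInv_mul_lt hn hp hε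
  refine ⟨inZInv (d.denom.reflect N) * s, (isRHInf_inZInv _).mul hs, ?_⟩
  rwa [← mul_assoc, hrd]

end MSStab

end

noncomputable section

namespace MSStab

open Matrix

set_option linter.unusedSectionVars false

/-! ### Matrices of proper functions -/

section Proper

variable {ι κ ν : Type*}

/-- The `k`-th coefficient of a transfer matrix. -/
def coefM (T : Matrix ι κ (RatFunc ℝ)) (k : ℕ) : Matrix ι κ ℝ :=
  T.map fun f => impulseResponse f k

/-- The `k`-th coefficient of a vector of transfer functions. -/
def coefV (v : ι → RatFunc ℝ) (k : ℕ) : ι → ℝ := fun i => impulseResponse (v i) k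

theorem impulseResponse_mul {f g : RatFunc ℝ} (hf : IsProper f) (hg : IsProper g) (k : ℕ) :
    impulseResponse (f * g) k = ∑ p ∈ Finset.HasAntidiagonal.antidiagonal k,
      impulseResponse f p.1 * impulseResponse g p.2 := by
  rw [← coeff_imp, imp_mul hf hg, PowerSeries.coeff_mul]
  simp only [coeff_imp]

theorem impulseResponse_add {f g : RatFunc ℝ} (hf : IsProper f) (hg : IsProper g) (k : ℕ) :
    impulseResponse (f + g) k = impulseResponse f k + impulseResponse g k := by
  rw [← coeff_imp, imp_add hf hg, map_add, coeff_imp, coeff_imp]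

theorem impulseResponse_sub {f g : RatFunc ℝ} (hf : IsProper f) (hg : IsProper g) (k : ℕ) :
    impulseResponse (f - g) k = impulseResponse f k - impulseResponse g k := by
  rw [← coeff_imp, imp_sub hf hg, map_sub, coeff_imp, coeff_imp]

theorem impulseResponse_sum (s : Finset ι) {f : ι → RatFunc ℝ}
    (hf : ∀ i, IsProper (f i)) (k : ℕ) :
    impulseResponse (∑ i ∈ s, f i) k = ∑ i ∈ s, impulseResponse (f i) k := by
  rw [← coeff_imp, imp_sum s hf, map_sum]
  simp only [coeff_imp]

theorem impulseResponse_C (c : ℝ) (k : ℕ) :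
    impulseResponse (RatFunc.C c) k = if k = 0 then c else 0 := by
  rw [← coeff_imp, imp_C, PowerSeries.coeff_C]

@[simp] theorem impulseResponse_zero (k : ℕ) : impulseResponse 0 k = 0 := by
  rw [← coeff_imp, imp_zero, map_zero]

theorem impulseResponse_one (k : ℕ) : impulseResponse 1 k = if k = 0 then 1 else 0 := by
  rw [← coeff_imp, imp_one, PowerSeries.coeff_one]

theorem impulseResponse_C_mul {f : RatFunc ℝ} (hf : IsProper f) (c : ℝ) (k : ℕ) :
    impulseResponse (RatFunc.C c * f) k = c * impulseResponse f k := by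
  rw [← coeff_imp, imp_mul (isProper_C c) hf, imp_C, PowerSeries.coeff_C_mul, coeff_imp]

theorem impulseResponse_X_inv_pow_mul {f : RatFunc ℝ} (hf : IsProper f) (l k : ℕ) :
    impulseResponse (RatFunc.X⁻¹ ^ l * f) (k + l) = impulseResponse f k := by
  rw [← coeff_imp, imp_mul (isProper_X_inv.pow l) hf, imp_pow isProper_X_inv, imp_X_inv,
    PowerSeries.coeff_X_pow_mul, coeff_imp]

theorem impulseResponse_X_inv_pow_mul_of_lt {f : RatFunc ℝ} (hf : IsProper f) {l k : ℕ}
    (h : k < l) : impulseResponse (RatFunc.X⁻¹ ^ l * f) k = 0 := by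
  rw [← coeff_imp, imp_mul (isProper_X_inv.pow l) hf, imp_pow isProper_X_inv, imp_X_inv,
    PowerSeries.coeff_X_pow_mul', if_neg (not_le.2 h)]

theorem isProper_mul_apply [Fintype κ] {S : Matrix ι κ (RatFunc ℝ)} {T : Matrix κ ν (RatFunc ℝ)}
    (hS : ∀ i j, IsProper (S i j)) (hT : ∀ i j, IsProper (T i j)) (i j) :
    IsProper ((S * T) i j) := by
  rw [Matrix.mul_apply]
  exact IsProper.sum _ fun l _ => (hS i l).mul (hT l j)

theorem coefM_mul [Fintype κ] {S : Matrix ι κ (RatFunc ℝ)} {T : Matrix κ ν (RatFunc ℝ)}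
    (hS : ∀ i j, IsProper (S i j)) (hT : ∀ i j, IsProper (T i j)) (k : ℕ) :
    coefM (S * T) k = ∑ p ∈ Finset.HasAntidiagonal.antidiagonal k, coefM S p.1 * coefM T p.2 := by
  ext i j
  rw [coefM, Matrix.map_apply, Matrix.mul_apply,
    impulseResponse_sum _ fun l => (hS i l).mul (hT l j), Matrix.sum_apply]
  simp_rw [Matrix.mul_apply, fun l => impulseResponse_mul (hS i l) (hT l j) k]
  rw [Finset.sum_comm]
  rfl

theorem coefV_mulVec [Fintype κ] {S : Matrix ι κ (RatFunc ℝ)} {v : κ → RatFunc ℝ}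
    (hS : ∀ i j, IsProper (S i j)) (hv : ∀ i, IsProper (v i)) (k : ℕ) :
    coefV (S *ᵥ v) k = ∑ p ∈ Finset.HasAntidiagonal.antidiagonal k, coefM S p.1 *ᵥ coefV v p.2 := by
  ext i
  rw [coefV, Matrix.mulVec, dotProduct,
    impulseResponse_sum _ fun l => (hS i l).mul (hv l), Finset.sum_apply]
  simp_rw [Matrix.mulVec, dotProduct, fun l => impulseResponse_mul (hS i l) (hv l) k]
  rw [Finset.sum_comm]
  rfl

variable [Fintype ι] [DecidableEq ι]

theorem coefM_zero_mul {S T : Matrix ι ι (RatFunc ℝ)}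
    (hS : ∀ i j, IsProper (S i j)) (hT : ∀ i j, IsProper (T i j)) :
    coefM (S * T) 0 = coefM S 0 * coefM T 0 := by
  rw [coefM_mul hS hT, Finset.Nat.antidiagonal_zero, Finset.sum_singleton]

@[simp] theorem coefM_one_zero : coefM (1 : Matrix ι ι (RatFunc ℝ)) 0 = 1 := by
  ext i j
  rw [coefM, Matrix.map_apply, Matrix.one_apply, Matrix.one_apply]
  split_ifs
  · simp [impulseResponse_one]
  · simp

/-- Determinant and adjugate commute with ring homomorphisms. Lifting the entries to `properRing`
gives properness, and the value at infinity is a homomorphism from that ring to ℝ. -/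
theorem isProper_det_and_adjugate {T : Matrix ι ι (RatFunc ℝ)} (hT : ∀ i j, IsProper (T i j)) :
    IsProper T.det ∧ (impulseResponse T.det 0 = (coefM T 0).det) ∧
      ∀ i j, IsProper (T.adjugate i j) := by
  set T' : Matrix ι ι properRing := fun i j => ⟨T i j, hT i j⟩ with hT'
  have h1 : T = properRing.subtype.mapMatrix T' := by ext i j; rfl
  have h2 : T.det = (T'.det : properRing).1 := by
    rw [h1, ← RingHom.map_det]; rfl
  refine ⟨by rw [h2]; exact T'.det.2, ?_, fun i j => ?_⟩
  · let c0 : properRing →+* ℝ := (PowerSeries.constantCoeff (R := ℝ)).comp impHom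
    have h3 : ∀ f : properRing, c0 f = impulseResponse f.1 0 := fun f => by
      rw [← coeff_imp, PowerSeries.coeff_zero_eq_constantCoeff_apply]; rfl
    rw [h2, ← h3, RingHom.map_det]
    rfl
  · have h3 : T.adjugate = properRing.subtype.mapMatrix T'.adjugate := by
      rw [h1, RingHom.map_adjugate]
    rw [h3]
    exact (T'.adjugate i j).2

theorem isProper_inv_apply {T : Matrix ι ι (RatFunc ℝ)} (hT : ∀ i j, IsProper (T i j))
    (h0 : (coefM T 0).det ≠ 0) : T.det ≠ 0 ∧ ∀ i j, IsProper (T⁻¹ i j) := by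
  obtain ⟨h1, h2, h3⟩ := isProper_det_and_adjugate hT
  rw [← h2] at h0
  refine ⟨fun h => h0 (by rw [h]; simp), fun i j => ?_⟩
  rw [Matrix.inv_def, Matrix.smul_apply, smul_eq_mul, Ring.inverse_eq_inv']
  exact (isProper_inv h1 h0).mul (h3 i j)

end Proper

/-! ### State-space realizations -/

section Realization

variable {ι κ ν : Type*} [Fintype ν] [DecidableEq ν]

/-- `(zI - A)⁻¹`. -/
def resolventM (A : Matrix ν ν ℝ) : Matrix ν ν (RatFunc ℝ) :=
  ((RatFunc.X : RatFunc ℝ) • (1 : Matrix ν ν (RatFunc ℝ)) - A.map RatFunc.C)⁻¹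

/-- `1 - z⁻¹ A`. -/
def oneSubM (A : Matrix ν ν ℝ) : Matrix ν ν (RatFunc ℝ) :=
  1 - (RatFunc.X : RatFunc ℝ)⁻¹ • A.map RatFunc.C

theorem isProper_one_apply (i j : ν) : IsProper ((1 : Matrix ν ν (RatFunc ℝ)) i j) := by
  rw [Matrix.one_apply]
  split_ifs
  · simpa using isProper_C 1
  · simpa using isProper_C 0

theorem isProper_oneSubM (A : Matrix ν ν ℝ) (i j) : IsProper (oneSubM A i j) := by
  rw [oneSubM, Matrix.sub_apply, sub_eq_add_neg]
  exact (isProper_one_apply i j).add (isProper_X_inv.mul (isProper_C _)).neg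

theorem coefM_oneSubM_zero (A : Matrix ν ν ℝ) : coefM (oneSubM A) 0 = 1 := by
  ext i j
  rw [coefM, Matrix.map_apply, oneSubM, Matrix.sub_apply, Matrix.smul_apply, smul_eq_mul,
    Matrix.map_apply, impulseResponse_sub (isProper_one_apply i j) (isProper_X_inv.mul (isProper_C _))]
  have h1 : impulseResponse ((1 : Matrix ν ν (RatFunc ℝ)) i j) 0 = (1 : Matrix ν ν ℝ) i j := by
    rw [← coefM_one_zero (ι := ν)]; rfl
  have h2 := impulseResponse_X_inv_pow_mul_of_lt (isProper_C (A i j)) zero_lt_one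
  rw [pow_one] at h2
  rw [h1, h2, sub_zero]

theorem isProper_oneSubM_inv (A : Matrix ν ν ℝ) :
    (oneSubM A).det ≠ 0 ∧ ∀ i j, IsProper ((oneSubM A)⁻¹ i j) :=
  isProper_inv_apply (isProper_oneSubM A) (by rw [coefM_oneSubM_zero]; simp)

theorem resolventM_eq (A : Matrix ν ν ℝ) :
    resolventM A = (RatFunc.X : RatFunc ℝ)⁻¹ • (oneSubM A)⁻¹ := by
  have hX : (RatFunc.X : RatFunc ℝ) ≠ 0 := RatFunc.X_ne_zero
  have h1 : (RatFunc.X : RatFunc ℝ) • (1 : Matrix ν ν (RatFunc ℝ)) - A.map RatFunc.C =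
      (RatFunc.X : RatFunc ℝ) • oneSubM A := by
    rw [oneSubM, smul_sub, smul_smul, mul_inv_cancel₀ hX, one_smul]
  rw [resolventM, h1]
  refine Matrix.inv_eq_right_inv ?_
  rw [smul_mul_smul_comm, mul_inv_cancel₀ hX, one_smul,
    Matrix.mul_nonsing_inv _ (isProper_oneSubM_inv A).1.isUnit]

/-- The Neumann series, obtained from the fixed point relation R = 1 + z⁻¹AR, which yields a
one-step recursion for the coefficients. -/
theorem coefM_oneSubM_inv (A : Matrix ν ν ℝ) (k : ℕ) : coefM (oneSubM A)⁻¹ k = A ^ k := by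
  obtain ⟨hdet, hprop⟩ := isProper_oneSubM_inv A
  have h1 : (oneSubM A)⁻¹ = 1 + (RatFunc.X : RatFunc ℝ)⁻¹ • (A.map RatFunc.C * (oneSubM A)⁻¹) := by
    have h := Matrix.mul_nonsing_inv _ hdet.isUnit
    conv_lhs at h => rw [oneSubM]
    rw [sub_mul, one_mul, smul_mul_assoc, sub_eq_iff_eq_add] at h
    exact h
  have hAC : ∀ i j, IsProper ((A.map RatFunc.C) i j) := fun i j => isProper_C _
  have h2 := isProper_mul_apply hAC hprop
  have hcA : ∀ k, coefM (A.map RatFunc.C * (oneSubM A)⁻¹) k = A * coefM (oneSubM A)⁻¹ k := by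
    intro k
    ext i j
    rw [coefM, Matrix.map_apply, Matrix.mul_apply,
      impulseResponse_sum _ fun l => (hAC i l).mul (hprop l j), Matrix.mul_apply]
    refine Finset.sum_congr rfl fun l _ => ?_
    exact impulseResponse_C_mul (hprop l j) (A i l) k
  have hadd : ∀ k i j, coefM (oneSubM A)⁻¹ k i j =
      impulseResponse ((1 : Matrix ν ν (RatFunc ℝ)) i j) k + impulseResponse
        ((RatFunc.X : RatFunc ℝ)⁻¹ ^ 1 * (A.map RatFunc.C * (oneSubM A)⁻¹) i j) k := by
    intro k i j
    rw [coefM, Matrix.map_apply]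
    conv_lhs => rw [h1]
    rw [Matrix.add_apply, Matrix.smul_apply, smul_eq_mul,
      impulseResponse_add (isProper_one_apply i j) (isProper_X_inv.mul (h2 i j)), pow_one]
  induction k with
  | zero =>
    ext i j
    rw [hadd, impulseResponse_X_inv_pow_mul_of_lt (h2 i j) zero_lt_one, add_zero, pow_zero,
      ← coefM_one_zero (ι := ν)]
    rfl
  | succ k ih =>
    ext i j
    rw [hadd, impulseResponse_X_inv_pow_mul (h2 i j), pow_succ', ← ih, ← hcA]
    have : impulseResponse ((1 : Matrix ν ν (RatFunc ℝ)) i j) (k + 1) = 0 := by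
      rw [Matrix.one_apply]
      split_ifs
      · simp [impulseResponse_one]
      · simp
    rw [this, zero_add]
    rfl

theorem isProper_resolventM (A : Matrix ν ν ℝ) (i j) : IsProper (resolventM A i j) := by
  rw [resolventM_eq]
  exact isProper_X_inv.mul ((isProper_oneSubM_inv A).2 i j)

theorem coefM_resolventM_zero (A : Matrix ν ν ℝ) : coefM (resolventM A) 0 = 0 := by
  ext i j
  rw [coefM, Matrix.map_apply, resolventM_eq, Matrix.smul_apply, smul_eq_mul,
    ← pow_one (RatFunc.X : RatFunc ℝ)⁻¹]
  exact impulseResponse_X_inv_pow_mul_of_lt ((isProper_oneSubM_inv A).2 i j) zero_lt_one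

theorem coefM_resolventM_succ (A : Matrix ν ν ℝ) (k : ℕ) :
    coefM (resolventM A) (k + 1) = A ^ k := by
  rw [← coefM_oneSubM_inv]
  ext i j
  rw [coefM, Matrix.map_apply, resolventM_eq, Matrix.smul_apply, smul_eq_mul,
    ← pow_one (RatFunc.X : RatFunc ℝ)⁻¹]
  exact impulseResponse_X_inv_pow_mul ((isProper_oneSubM_inv A).2 i j) 1 k

/-- The transfer matrix `D + C (zI - A)⁻¹ B`. -/
def tf (A : Matrix ν ν ℝ) (B : Matrix ν κ ℝ) (C : Matrix ι ν ℝ) (D : Matrix ι κ ℝ) :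
    Matrix ι κ (RatFunc ℝ) :=
  D.map RatFunc.C + C.map RatFunc.C * resolventM A * B.map RatFunc.C

theorem isProper_map_C (D : Matrix ι κ ℝ) (i j) : IsProper ((D.map RatFunc.C) i j) :=
  isProper_C _

theorem isProper_tf (A : Matrix ν ν ℝ) (B : Matrix ν κ ℝ) (C : Matrix ι ν ℝ)
    (D : Matrix ι κ ℝ) (i j) : IsProper (tf A B C D i j) :=
  (isProper_C _).add (isProper_mul_apply
    (isProper_mul_apply (isProper_map_C C) (isProper_resolventM A)) (isProper_map_C B) i j)

theorem coefM_map_C_mul (C : Matrix ι ν ℝ) {T : Matrix ν κ (RatFunc ℝ)}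
    (hT : ∀ i j, IsProper (T i j)) (k : ℕ) : coefM (C.map RatFunc.C * T) k = C * coefM T k := by
  ext i j
  rw [coefM, Matrix.map_apply, Matrix.mul_apply,
    impulseResponse_sum _ fun l => (isProper_map_C C i l).mul (hT l j), Matrix.mul_apply]
  exact Finset.sum_congr rfl fun l _ => impulseResponse_C_mul (hT l j) (C i l) k

theorem coefM_mul_map_C (B : Matrix ν κ ℝ) {T : Matrix ι ν (RatFunc ℝ)}
    (hT : ∀ i j, IsProper (T i j)) (k : ℕ) : coefM (T * B.map RatFunc.C) k = coefM T k * B := by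
  ext i j
  rw [coefM, Matrix.map_apply, Matrix.mul_apply,
    impulseResponse_sum _ fun l => (hT i l).mul (isProper_map_C B l j), Matrix.mul_apply]
  refine Finset.sum_congr rfl fun l _ => ?_
  rw [mul_comm]
  exact (impulseResponse_C_mul (hT i l) (B l j) k).trans (mul_comm _ _)

theorem coefM_tf (A : Matrix ν ν ℝ) (B : Matrix ν κ ℝ) (C : Matrix ι ν ℝ)
    (D : Matrix ι κ ℝ) (k : ℕ) :
    coefM (tf A B C D) k = (if k = 0 then D else 0) + C * coefM (resolventM A) k * B := by
  rw [← coefM_map_C_mul C (isProper_resolventM A), ← coefM_mul_map_C B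
    (isProper_mul_apply (isProper_map_C C) (isProper_resolventM A))]
  ext i j
  rw [coefM, Matrix.map_apply, tf, Matrix.add_apply, impulseResponse_add (isProper_map_C D i j)
    (isProper_mul_apply (isProper_mul_apply (isProper_map_C C) (isProper_resolventM A))
      (isProper_map_C B) i j), Matrix.map_apply, impulseResponse_C, Matrix.add_apply]
  congr 1
  split_ifs <;> rfl

theorem coefM_tf_zero (A : Matrix ν ν ℝ) (B : Matrix ν κ ℝ) (C : Matrix ι ν ℝ)
    (D : Matrix ι κ ℝ) : coefM (tf A B C D) 0 = D := by
  rw [coefM_tf, coefM_resolventM_zero, if_pos rfl, Matrix.mul_zero, Matrix.zero_mul, add_zero]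

theorem coefM_tf_succ (A : Matrix ν ν ℝ) (B : Matrix ν κ ℝ) (C : Matrix ι ν ℝ)
    (D : Matrix ι κ ℝ) (k : ℕ) : coefM (tf A B C D) (k + 1) = C * A ^ k * B := by
  rw [coefM_tf, coefM_resolventM_succ, if_neg (Nat.succ_ne_zero k), zero_add]

theorem isRealization_iff {m n : ℕ} (T : TFMatrix m) (A : Matrix (Fin n) (Fin n) ℝ)
    (B : Matrix (Fin n) (Fin m) ℝ) (C : Matrix (Fin m) (Fin n) ℝ)
    (D : Matrix (Fin m) (Fin m) ℝ) : IsRealization T A B C D ↔ T = tf A B C D := Iff.rfl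

end Realization

end MSStab

end

noncomputable section

namespace MSStab

open Matrix

/-! ### Stable matrices and Gramians -/

/-- The powers of `A` are absolutely summable. -/
def PowSummable {n : ℕ} (A : Matrix (Fin n) (Fin n) ℝ) : Prop :=
  ∀ i j, Summable fun k => |(A ^ k) i j|

theorem hasSum_mul_left {ι κ ν : Type*} [Fintype κ] {f : ℕ → Matrix κ ν ℝ} {a : Matrix κ ν ℝ}
    (L : Matrix ι κ ℝ) (h : HasSum f a) : HasSum (fun k => L * f k) (L * a) :=
  h.map (Matrix.addMonoidHomMulLeft L) (continuous_const.matrix_mul continuous_id)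

theorem hasSum_mul_right {ι κ ν : Type*} [Fintype κ] {f : ℕ → Matrix ι κ ℝ} {a : Matrix ι κ ℝ}
    (R : Matrix κ ν ℝ) (h : HasSum f a) : HasSum (fun k => f k * R) (a * R) :=
  h.map (Matrix.addMonoidHomMulRight R) (continuous_id.matrix_mul continuous_const)

theorem hasSum_matrix_iff {ι κ : Type*} {f : ℕ → Matrix ι κ ℝ} {a : Matrix ι κ ℝ} :
    HasSum f a ↔ ∀ i j, HasSum (fun k => f k i j) (a i j) := by
  exact (Pi.hasSum (f := f) (g := a)).trans (forall_congr' fun i => Pi.hasSum)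

theorem summable_matrix_iff {ι κ : Type*} {f : ℕ → Matrix ι κ ℝ} :
    Summable f ↔ ∀ i j, Summable (fun k => f k i j) := by
  exact (Pi.summable (f := f)).trans (forall_congr' fun i => Pi.summable)

theorem PowSummable.bounded {n : ℕ} {A : Matrix (Fin n) (Fin n) ℝ} (hA : PowSummable A) :
    ∃ c : ℝ, 0 ≤ c ∧ ∀ k i j, |(A ^ k) i j| ≤ c := by
  refine ⟨∑ i, ∑ j, ∑' k, |(A ^ k) i j|,
    Finset.sum_nonneg fun i _ => Finset.sum_nonneg fun j _ => tsum_nonneg fun k => abs_nonneg _,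
    fun k i j => ?_⟩
  have h1 : |(A ^ k) i j| ≤ ∑' k, |(A ^ k) i j| :=
    (hA i j).le_tsum k fun _ _ => abs_nonneg _
  have h2 : ∑' k, |(A ^ k) i j| ≤ ∑ j, ∑' k, |(A ^ k) i j| :=
    Finset.single_le_sum (f := fun j => ∑' k, |(A ^ k) i j|)
      (fun j _ => tsum_nonneg fun k => abs_nonneg _) (Finset.mem_univ j)
  have h3 : ∑ j, ∑' k, |(A ^ k) i j| ≤ ∑ i, ∑ j, ∑' k, |(A ^ k) i j| :=
    Finset.single_le_sum (f := fun i => ∑ j, ∑' k, |(A ^ k) i j|)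
      (fun i _ => Finset.sum_nonneg fun j _ => tsum_nonneg fun k => abs_nonneg _)
      (Finset.mem_univ i)
  linarith

theorem PowSummable.transpose {n : ℕ} {A : Matrix (Fin n) (Fin n) ℝ} (hA : PowSummable A) :
    PowSummable Aᵀ := fun i j => by
  simpa only [← Matrix.transpose_pow, Matrix.transpose_apply] using hA j i

theorem PowSummable.tendsto {n : ℕ} {A : Matrix (Fin n) (Fin n) ℝ} (hA : PowSummable A) :
    Filter.Tendsto (fun k => A ^ k) Filter.atTop (nhds 0) :=
  (summable_matrix_iff.2 fun i j => (hA i j).of_abs).tendsto_atTop_zero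

theorem summable_mul_mul_pow {n : ℕ} {ι κ : Type*} {A : Matrix (Fin n) (Fin n) ℝ}
    (hA : PowSummable A) (L : Matrix ι (Fin n) ℝ) (R : Matrix (Fin n) κ ℝ) (i : ι) (j : κ) :
    Summable fun k : ℕ => |(L * A ^ k * R) i j| := by
  refine Summable.of_nonneg_of_le (fun _ => abs_nonneg _) (fun k => ?_)
    (summable_sum (s := Finset.univ) fun b _ => summable_sum (s := Finset.univ) fun a _ =>
      ((hA a b).mul_left |L i a|).mul_right |R b j|)
  rw [Matrix.mul_apply]
  refine (Finset.abs_sum_le_sum_abs _ _).trans ?_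
  refine Finset.sum_le_sum fun b _ => ?_
  rw [abs_mul, Matrix.mul_apply, ← Finset.sum_mul]
  refine mul_le_mul_of_nonneg_right ?_ (abs_nonneg _)
  refine (Finset.abs_sum_le_sum_abs _ _).trans_eq ?_
  simp only [abs_mul]

/-- The Gramian `∑ₖ (Aᵀ)ᵏ Q Aᵏ`. -/
def gram {n : ℕ} (A Q : Matrix (Fin n) (Fin n) ℝ) : Matrix (Fin n) (Fin n) ℝ :=
  ∑' k : ℕ, Aᵀ ^ k * Q * A ^ k

/-! ### Gramians as unique solutions of discrete Lyapunov equations -/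

section Gram

variable {n : ℕ} {A : Matrix (Fin n) (Fin n) ℝ}

theorem PowSummable.summable_gram (hA : PowSummable A) (Q : Matrix (Fin n) (Fin n) ℝ) :
    Summable fun k : ℕ => Aᵀ ^ k * Q * A ^ k := by
  rw [summable_matrix_iff]
  intro i j
  obtain ⟨c, hc0, hc⟩ := hA.bounded
  apply Summable.of_abs
  refine Summable.of_nonneg_of_le (fun _ => abs_nonneg _) (fun k => ?_)
    (summable_sum (s := Finset.univ) fun b _ =>
      (summable_mul_mul_pow hA.transpose 1 Q i b).mul_right c)
  rw [Matrix.mul_apply]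
  refine (Finset.abs_sum_le_sum_abs _ _).trans (Finset.sum_le_sum fun b _ => ?_)
  rw [abs_mul, one_mul]
  exact mul_le_mul_of_nonneg_left (hc k b j) (abs_nonneg _)

theorem PowSummable.hasSum_gram (hA : PowSummable A) (Q : Matrix (Fin n) (Fin n) ℝ) :
    HasSum (fun k : ℕ => Aᵀ ^ k * Q * A ^ k) (gram A Q) := (hA.summable_gram Q).hasSum

theorem PowSummable.gram_eq (hA : PowSummable A) (Q : Matrix (Fin n) (Fin n) ℝ) :
    gram A Q = Q + Aᵀ * gram A Q * A := by
  have h1 := hA.hasSum_gram Q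
  have h2 := hasSum_mul_right A (hasSum_mul_left Aᵀ h1)
  have h3 : HasSum (fun k : ℕ => Aᵀ ^ (k + 1) * Q * A ^ (k + 1)) (Aᵀ * gram A Q * A) := by
    have e : (fun k : ℕ => Aᵀ ^ (k + 1) * Q * A ^ (k + 1)) =
        fun k : ℕ => Aᵀ * (Aᵀ ^ k * Q * A ^ k) * A := by
      funext k
      rw [pow_succ', pow_succ]
      simp only [Matrix.mul_assoc]
    rw [e]
    exact h2
  have h4 := HasSum.zero_add (f := fun k : ℕ => Aᵀ ^ k * Q * A ^ k) h3
  simp only [pow_zero, Matrix.one_mul, Matrix.mul_one] at h4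
  exact h1.unique h4

/-- Iteration gives Z = (Aᵀ)ᵏ Z Aᵏ for every k, and the right side tends to zero. -/
theorem PowSummable.eq_zero_of_eq (hA : PowSummable A) {Z : Matrix (Fin n) (Fin n) ℝ}
    (hZ : Z = Aᵀ * Z * A) : Z = 0 := by
  have h : ∀ k : ℕ, Aᵀ ^ k * Z * A ^ k = Z := by
    intro k
    induction k with
    | zero => simp
    | succ k ih =>
      calc Aᵀ ^ (k + 1) * Z * A ^ (k + 1) = Aᵀ ^ k * (Aᵀ * Z * A) * A ^ k := by
            rw [pow_succ, pow_succ']; simp only [Matrix.mul_assoc]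
        _ = Z := by rw [← hZ, ih]
  have h1 := (hA.summable_gram Z).tendsto_atTop_zero
  simp_rw [h] at h1
  exact tendsto_nhds_unique tendsto_const_nhds h1

theorem PowSummable.eq_gram (hA : PowSummable A) {Q Z : Matrix (Fin n) (Fin n) ℝ}
    (hZ : Z = Q + Aᵀ * Z * A) : Z = gram A Q := by
  rw [← sub_eq_zero]
  refine hA.eq_zero_of_eq ?_
  conv_lhs => rw [hZ, hA.gram_eq Q]
  rw [Matrix.mul_sub, Matrix.sub_mul]
  abel

theorem PowSummable.hasSum_quad (hA : PowSummable A) {p : ℕ} (E : Matrix (Fin p) (Fin n) ℝ)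
    (x : Fin n → ℝ) :
    HasSum (fun k : ℕ => ((E * A ^ k) *ᵥ x) ⬝ᵥ ((E * A ^ k) *ᵥ x))
      (x ⬝ᵥ (gram A (Eᵀ * E)) *ᵥ x) := by
  -- The quadratic form is read as a 1 × 1 matrix product, so that the sum passes through left and
  -- right multiplication.
  have h : ∀ Z : Matrix (Fin n) (Fin n) ℝ, x ⬝ᵥ Z *ᵥ x =
      (Matrix.of (fun (_ : Fin 1) => x) * (Z * (Matrix.of fun (_ : Fin 1) => x)ᵀ)) 0 0 :=
    fun Z => rfl
  have h1 := hasSum_matrix_iff.1 (hasSum_mul_left (Matrix.of (fun (_ : Fin 1) => x))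
    (hasSum_mul_right (Matrix.of fun (_ : Fin 1) => x)ᵀ (hA.hasSum_gram (Eᵀ * E)))) 0 0
  simp_rw [← h] at h1
  refine h1.congr_fun fun k => ?_
  have e : Aᵀ ^ k * (Eᵀ * E) * A ^ k = (E * A ^ k)ᵀ * (E * A ^ k) := by
    rw [Matrix.transpose_mul, Matrix.transpose_pow]; simp only [Matrix.mul_assoc]
  rw [e, ← Matrix.mulVec_mulVec x (E * A ^ k)ᵀ, Matrix.dotProduct_mulVec x, Matrix.vecMul_transpose]

theorem isHermitian_iff_transpose {n : ℕ} {Z : Matrix (Fin n) (Fin n) ℝ} :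
    Z.IsHermitian ↔ Zᵀ = Z := by
  rw [Matrix.IsHermitian, Matrix.conjTranspose_eq_transpose_of_trivial]

theorem PowSummable.gram_transpose (hA : PowSummable A) {Q : Matrix (Fin n) (Fin n) ℝ}
    (hQ : Qᵀ = Q) : (gram A Q)ᵀ = gram A Q := by
  refine hA.eq_gram ?_
  conv_lhs => rw [hA.gram_eq Q]
  simp only [Matrix.transpose_add, Matrix.transpose_mul, Matrix.transpose_transpose, hQ,
    Matrix.mul_assoc]

theorem dotProduct_self_nonneg' {p : ℕ} (x : Fin p → ℝ) : 0 ≤ x ⬝ᵥ x :=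
  Finset.sum_nonneg fun i _ => mul_self_nonneg (x i)

theorem PowSummable.gram_posSemidef (hA : PowSummable A) {p : ℕ}
    (E : Matrix (Fin p) (Fin n) ℝ) : (gram A (Eᵀ * E)).PosSemidef := by
  refine Matrix.posSemidef_iff_dotProduct_mulVec.2 ⟨isHermitian_iff_transpose.2
    (hA.gram_transpose (by simp)), fun x => ?_⟩
  rw [star_trivial, ← (hA.hasSum_quad E x).tsum_eq]
  exact tsum_nonneg fun k => dotProduct_self_nonneg' _

theorem PowSummable.gram_posDef (hA : PowSummable A) {p : ℕ} {E : Matrix (Fin p) (Fin n) ℝ}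
    (hE : ∀ x : Fin n → ℝ, (∀ k : ℕ, (E * A ^ k) *ᵥ x = 0) → x = 0) :
    (gram A (Eᵀ * E)).PosDef := by
  refine Matrix.posDef_iff_dotProduct_mulVec.2 ⟨isHermitian_iff_transpose.2
    (hA.gram_transpose (by simp)), fun x hx => ?_⟩
  rw [star_trivial]
  have hs := hA.hasSum_quad E x
  by_contra hle
  refine hx (hE x fun k => ?_)
  have h0 : x ⬝ᵥ (gram A (Eᵀ * E)) *ᵥ x = 0 := by
    refine le_antisymm (not_lt.1 hle) ?_
    rw [← hs.tsum_eq]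
    exact tsum_nonneg fun k => dotProduct_self_nonneg' _
  rw [h0, hasSum_zero_iff_of_nonneg fun k => dotProduct_self_nonneg' _] at hs
  exact dotProduct_self_eq_zero.1 (congrFun hs k)

end Gram

end MSStab

end

noncomputable section

namespace MSStab

open Matrix

/-! ### Minimal realizations of inner functions -/

theorem span_eq_top_of_dotProduct {n : ℕ} (S : Set (Fin n → ℝ))
    (h : ∀ x : Fin n → ℝ, (∀ s ∈ S, s ⬝ᵥ x = 0) → x = 0) : Submodule.span ℝ S = ⊤ := by
  by_contra hne
  obtain ⟨f, hf, hle⟩ := Submodule.exists_le_ker_of_lt_top _ (lt_top_iff_ne_top.2 hne)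
  refine hf ?_
  have hrep : ∀ y, f y = y ⬝ᵥ fun i => f (Pi.single i 1) := fun y => by
    conv_lhs => rw [pi_eq_sum_univ' y]
    rw [map_sum]
    simp only [map_smul, smul_eq_mul, dotProduct]
  have hx := h (fun i => f (Pi.single i 1)) fun s hs => by
    rw [← hrep]; exact hle (Submodule.subset_span hs)
  ext i
  simpa using congrFun hx i

/-- Observability and controllability say that the rows of C Aᵃ and the columns of Aᵇ B span the
space. On such vectors xᵀ Aᵏ y is an entry of the shifted Markov parameter C Aᵏ⁺ᵃ⁺ᵇ B, which is
summable, and bilinearity extends this to all x and y. -/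
theorem powSummable_of_isMinimal {m n : ℕ} {A : Matrix (Fin n) (Fin n) ℝ}
    {B : Matrix (Fin n) (Fin m) ℝ} {C : Matrix (Fin m) (Fin n) ℝ} (hmin : IsMinimal A B C)
    (h : ∀ i j, Summable fun k : ℕ => |(C * A ^ k * B) i j|) : PowSummable A := by
  have hx : Submodule.span ℝ {x : Fin n → ℝ | ∃ (k : ℕ) (i : Fin m), x = (C * A ^ k) i} = ⊤ := by
    refine span_eq_top_of_dotProduct _ fun x hx => hmin.2 x fun k => ?_
    funext i
    exact hx _ ⟨k, i, rfl⟩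
  have hy : Submodule.span ℝ {x : Fin n → ℝ | ∃ (k : ℕ) (i : Fin m), x = (A ^ k * B)ᵀ i} = ⊤ := by
    refine span_eq_top_of_dotProduct _ fun x hx => hmin.1 x fun k => ?_
    funext i
    rw [Pi.zero_apply, ← hx _ ⟨k, i, rfl⟩, dotProduct_comm]
    rfl
  have key : ∀ x y : Fin n → ℝ, Summable fun k : ℕ => |x ⬝ᵥ (A ^ k) *ᵥ y| := by
    intro x y
    have hxm : x ∈ Submodule.span ℝ {x : Fin n → ℝ | ∃ (k : ℕ) (i : Fin m), x = (C * A ^ k) i} := by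
      rw [hx]; trivial
    have hym : y ∈ Submodule.span ℝ
        {x : Fin n → ℝ | ∃ (k : ℕ) (i : Fin m), x = (A ^ k * B)ᵀ i} := by
      rw [hy]; trivial
    induction hxm using Submodule.span_induction with
    | mem x hx =>
      obtain ⟨a, i, rfl⟩ := hx
      induction hym using Submodule.span_induction with
      | mem y hy =>
        obtain ⟨b, j, rfl⟩ := hy
        have e : ∀ k : ℕ, (C * A ^ a) i ⬝ᵥ (A ^ k) *ᵥ (A ^ b * B)ᵀ j =
            (C * A ^ (k + (a + b)) * B) i j := by
          intro k
          have e1 : C * A ^ (k + (a + b)) * B = (C * A ^ a) * ((A ^ k) * (A ^ b * B)) := by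
            rw [show k + (a + b) = a + k + b by ring, pow_add, pow_add]
            simp only [Matrix.mul_assoc]
          rw [e1]
          rfl
        simp_rw [e]
        exact (summable_nat_add_iff (f := fun k => |(C * A ^ k * B) i j|) (a + b)).2 (h i j)
      | zero => simp
      | add y z _ _ hy hz =>
        refine Summable.of_nonneg_of_le (fun _ => abs_nonneg _) (fun k => ?_) (hy.add hz)
        rw [Matrix.mulVec_add, dotProduct_add]
        exact abs_add_le _ _
      | smul c y _ hy =>
        simp_rw [Matrix.mulVec_smul, dotProduct_smul, smul_eq_mul, abs_mul]
        exact hy.mul_left _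
    | zero => simp
    | add y z _ _ hy hz =>
      refine Summable.of_nonneg_of_le (fun _ => abs_nonneg _) (fun k => ?_) (hy.add hz)
      rw [add_dotProduct]
      exact abs_add_le _ _
    | smul c y _ hy =>
      simp_rw [smul_dotProduct, smul_eq_mul, abs_mul]
      exact hy.mul_left _
  intro i j
  refine (key (Pi.single i 1) (Pi.single j 1)).congr fun k => ?_
  simp

/-- The time-domain form of unitarity on the circle: the columns of coefficients are orthonormal and
orthogonal to their own shifts. -/
theorem IsInner.tsum_eq {m : ℕ} {M : TFMatrix m} (hM : IsInner M) (a b : Fin m) (l : ℕ) :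
    ∑ i, ∑' k, impulseResponse (M i a) k * impulseResponse (M i b) (k + l) =
      if l = 0 then (1 : Matrix (Fin m) (Fin m) ℝ) a b else 0 := by
  -- Delaying column a by l steps produces the shifted correlation. By unitarity its pairing with
  -- column b is the pairing of z⁻ˡ with a constant, to which Parseval applies again.
  set f : RatFunc ℝ := RatFunc.X⁻¹ ^ l with hf
  have hfR : IsRHInf f := rhInfRing.pow_mem isRHInf_X_inv l
  set d : RatFunc ℝ := RatFunc.C ((1 : Matrix (Fin m) (Fin m) ℝ) a b) with hd
  have hdR : IsRHInf d := isRHInf_C _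
  have hshift : ∀ i, ∑' k, impulseResponse (f * M i a) k * impulseResponse (M i b) k =
      ∑' k, impulseResponse (M i a) k * impulseResponse (M i b) (k + l) := by
    intro i
    have hp := (hM.1 i a).1
    rw [← (add_left_injective l).tsum_eq
      (f := fun k => impulseResponse (f * M i a) k * impulseResponse (M i b) k)]
    · congr 1; ext k
      rw [hf, impulseResponse_X_inv_pow_mul hp]
    · intro k hk
      by_contra hne
      refine Function.mem_support.1 hk ?_
      have : k < l := by
        by_contra hlt
        exact hne ⟨k - l, by simp; omega⟩
      rw [hf, impulseResponse_X_inv_pow_mul_of_lt hp this, zero_mul]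
  have h1 : ∀ i, ∫ θ in (-Real.pi)..Real.pi, (starRingEnd ℂ) (evalC (f * M i a) (circ θ)) *
      evalC (M i b) (circ θ) = 2 * Real.pi * ((∑' k, impulseResponse (M i a) k *
        impulseResponse (M i b) (k + l) : ℝ) : ℂ) := fun i => by
    rw [parseval (hfR.mul (hM.1 i a)) (hM.1 i b), hshift]
  have h2 : ∑ i, ∫ θ in (-Real.pi)..Real.pi, (starRingEnd ℂ) (evalC (f * M i a) (circ θ)) *
      evalC (M i b) (circ θ) = ∫ θ in (-Real.pi)..Real.pi,
        (starRingEnd ℂ) (evalC f (circ θ)) * evalC d (circ θ) := by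
    rw [← intervalIntegral.integral_finsetSum]
    · congr 1; ext θ
      have hz := (norm_circ θ).ge
      have hu := congrFun (congrFun (hM.2 (circ θ) (norm_circ θ)) a) b
      rw [Matrix.mul_apply] at hu
      simp_rw [fun i => evalC_mul (hfR.regularAt hz) ((hM.1 i a).regularAt hz), map_mul, mul_assoc,
        ← Finset.mul_sum]
      congr 1
      rw [hd, evalC_C]
      refine Eq.trans hu ?_
      rw [Matrix.one_apply, Matrix.one_apply]
      split_ifs <;> simp
    · intro i _
      exact ((continuous_evalC_circ (hfR.mul (hM.1 i a))).star.mul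
        (continuous_evalC_circ (hM.1 i b))).intervalIntegrable _ _
  have h3 : ∑' k, impulseResponse f k * impulseResponse d k =
      if l = 0 then (1 : Matrix (Fin m) (Fin m) ℝ) a b else 0 := by
    rw [tsum_eq_single 0 fun k hk => by rw [hd, impulseResponse_C, if_neg hk, mul_zero],
      hd, impulseResponse_C, if_pos rfl]
    have hf0 : impulseResponse f 0 = if l = 0 then 1 else 0 := by
      rw [← coeff_imp, hf, imp_pow isProper_X_inv, imp_X_inv, PowerSeries.coeff_X_pow]
      simp only [eq_comm]
    rw [hf0]
    split_ifs <;> simp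
  rw [parseval hfR hdR, h3, Finset.sum_congr rfl fun i _ => h1 i, ← Finset.mul_sum,
    ← Complex.ofReal_sum] at h2
  have hpi : (2 * Real.pi : ℂ) ≠ 0 := mul_ne_zero two_ne_zero (by exact_mod_cast Real.pi_ne_zero)
  exact_mod_cast mul_left_cancel₀ hpi h2

/-- A realization of an inner function together with its observability Gramian `P`. -/
structure InnerRealization {m n : ℕ} (A : Matrix (Fin n) (Fin n) ℝ)
    (B : Matrix (Fin n) (Fin m) ℝ) (C : Matrix (Fin m) (Fin n) ℝ)
    (D : Matrix (Fin m) (Fin m) ℝ) (P : Matrix (Fin n) (Fin n) ℝ) : Prop where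
  pow : PowSummable A
  posDef : P.PosDef
  lyap : Aᵀ * P * A + Cᵀ * C = P
  cross : Aᵀ * P * B + Cᵀ * D = 0
  feed : Bᵀ * P * B + Dᵀ * D = 1
  isUnit : IsUnit D.det
  obs : ∀ x : Fin n → ℝ, (∀ k : ℕ, (C * A ^ k) *ᵥ x = 0) → x = 0

theorem summable_impulseResponse {f : RatFunc ℝ} (hf : IsRHInf f) :
    Summable fun k => |impulseResponse f k| := by simpa [IsL1] using hf.isL1

/-- The Lyapunov identity is the recursion of the Gramian. The other two identities are the shift
orthogonality relations in state-space form: lag zero gives `feed`, and the positive lags give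
`cross` multiplied by Aˡ B, which controllability cancels. -/
theorem innerRealization {m n : ℕ} {M : TFMatrix m} (hM : IsInner M)
    {A : Matrix (Fin n) (Fin n) ℝ} {B : Matrix (Fin n) (Fin m) ℝ} {C : Matrix (Fin m) (Fin n) ℝ}
    {D : Matrix (Fin m) (Fin m) ℝ} (hreal : M = tf A B C D) (hmin : IsMinimal A B C)
    (hD : IsUnit D.det) : InnerRealization A B C D (gram A (Cᵀ * C)) := by
  have hcoef : ∀ i j (k : ℕ), impulseResponse (M i j) (k + 1) = (C * A ^ k * B) i j :=
    fun i j k => by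
      rw [← coefM_tf_succ A B C D k, ← hreal]; rfl
  have hcoef0 : ∀ i j, impulseResponse (M i j) 0 = D i j := fun i j => by
    rw [← coefM_tf_zero A B C D, ← hreal]; rfl
  have hA : PowSummable A := powSummable_of_isMinimal hmin fun i j => by
    simp_rw [← hcoef]
    exact (summable_nat_add_iff (f := fun k => |impulseResponse (M i j) k|) 1).2
      (summable_impulseResponse (hM.1 i j))
  set P := gram A (Cᵀ * C) with hP
  have hsum := hA.hasSum_gram (Cᵀ * C)
  -- The term k = 0 of the first factor is split off because it is D instead of a product C Aᵏ B.
  have hcorr : ∀ a b l, (Dᵀ * coefM M l) a b + (∑ i, ∑' k : ℕ, (C * A ^ k * B) i a *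
      impulseResponse (M i b) (k + 1 + l)) = if l = 0 then (1 : Matrix (Fin m) (Fin m) ℝ) a b
        else 0 := by
    intro a b l
    rw [← hM.tsum_eq a b l, Matrix.mul_apply, ← Finset.sum_add_distrib]
    refine Finset.sum_congr rfl fun i _ => ?_
    have hs : Summable fun k => impulseResponse (M i a) k * impulseResponse (M i b) (k + l) := by
      have h1 := (summable_sq_impulseResponse (hM.1 i a)).add
        ((summable_nat_add_iff (f := fun k => impulseResponse (M i b) k ^ 2) l).2
          (summable_sq_impulseResponse (hM.1 i b)))
      refine Summable.of_abs (Summable.of_nonneg_of_le (fun _ => abs_nonneg _) (fun k => ?_) h1)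
      rw [abs_le]
      constructor <;> nlinarith [sq_nonneg (impulseResponse (M i a) k +
        impulseResponse (M i b) (k + l)), sq_nonneg (impulseResponse (M i a) k -
        impulseResponse (M i b) (k + l)), sq_nonneg (impulseResponse (M i a) k),
        sq_nonneg (impulseResponse (M i b) (k + l))]
    rw [hs.tsum_eq_zero_add, hcoef0, zero_add]
    simp_rw [hcoef]
    rfl
  have hBP : ∀ (l : ℕ) (a b : Fin m), ∑ i, ∑' k : ℕ, (C * A ^ k * B) i a *
      (C * A ^ (k + l) * B) i b = (Bᵀ * P * (A ^ l * B)) a b := by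
    intro l a b
    have h1 := hasSum_matrix_iff.1 (hasSum_mul_right (A ^ l * B) (hasSum_mul_left Bᵀ hsum)) a b
    rw [← h1.tsum_eq]
    have e : ∀ k : ℕ, (Bᵀ * (Aᵀ ^ k * (Cᵀ * C) * A ^ k) * (A ^ l * B)) a b =
        ∑ i, (C * A ^ k * B) i a * (C * A ^ (k + l) * B) i b := by
      intro k
      have : Bᵀ * (Aᵀ ^ k * (Cᵀ * C) * A ^ k) * (A ^ l * B) =
          (C * A ^ k * B)ᵀ * (C * A ^ (k + l) * B) := by
        rw [Matrix.transpose_mul, Matrix.transpose_mul, Matrix.transpose_pow, pow_add]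
        simp only [Matrix.mul_assoc]
      rw [this, Matrix.mul_apply]
      rfl
    simp_rw [e]
    refine (Summable.tsum_finsetSum fun i _ => ?_).symm
    have h2 := (summable_mul_mul_pow hA C B i a)
    obtain ⟨c, hc⟩ : ∃ c, ∀ k : ℕ, |(C * A ^ k * B) i b| ≤ c :=
      ⟨_, fun k => (summable_mul_mul_pow hA C B i b).le_tsum k fun _ _ => abs_nonneg _⟩
    refine Summable.of_abs (Summable.of_nonneg_of_le (fun _ => abs_nonneg _) (fun k => ?_)
      (h2.mul_right c))
    rw [abs_mul]
    exact mul_le_mul_of_nonneg_left (hc _) (abs_nonneg _)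
  have hPt : Pᵀ = P := hA.gram_transpose (by simp)
  have hcross : Dᵀ * C + Bᵀ * P * A = 0 := by
    have h1 : ∀ l : ℕ, (Dᵀ * C + Bᵀ * P * A) * (A ^ l * B) = 0 := by
      intro l
      ext a b
      have h2 := hcorr a b (l + 1)
      rw [if_neg (Nat.succ_ne_zero l)] at h2
      have e1 : coefM M (l + 1) = C * (A ^ l * B) := by
        rw [hreal, coefM_tf_succ, Matrix.mul_assoc]
      have e2 : ∀ i (k : ℕ), impulseResponse (M i b) (k + 1 + (l + 1)) =
          (C * A ^ (k + (l + 1)) * B) i b := fun i k => by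
        rw [← hcoef]; congr 1; ring
      simp_rw [e2] at h2
      rw [hBP, e1, ← Matrix.add_apply] at h2
      rw [Matrix.zero_apply, ← h2, pow_succ']
      rw [Matrix.add_mul]
      simp only [Matrix.mul_assoc]
    ext a j
    -- Each row annihilates Aᵏ B for all k, hence is zero by controllability.
    have h3 := hmin.1 ((Dᵀ * C + Bᵀ * P * A) a) fun k => by
      have := congrFun (h1 k) a
      exact this
    exact congrFun h3 j
  refine ⟨hA, hA.gram_posDef hmin.2, ?_, ?_, ?_, hD, hmin.2⟩
  · conv_rhs => rw [hP, hA.gram_eq]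
    rw [add_comm]
  · have := congrArg Matrix.transpose hcross
    rw [Matrix.transpose_add, Matrix.transpose_mul, Matrix.transpose_mul, Matrix.transpose_mul,
      hPt] at this
    simpa only [Matrix.transpose_transpose, Matrix.transpose_zero, Matrix.mul_assoc,
      add_comm] using this
  · ext a b
    have h2 := hcorr a b 0
    rw [if_pos rfl] at h2
    have e1 : coefM M 0 = D := by rw [hreal, coefM_tf_zero]
    simp_rw [add_zero, hcoef] at h2
    have h3 := hBP 0 a b
    simp only [add_zero, pow_zero, Matrix.one_mul] at h3
    rw [h3, e1] at h2
    rw [Matrix.add_apply, add_comm, h2]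

end MSStab

end

noncomputable section

namespace MSStab

open Matrix

/-! ### The Lyapunov and Riccati equations of an inner function -/

namespace InnerRealization

variable {m n : ℕ} {A : Matrix (Fin n) (Fin n) ℝ} {B : Matrix (Fin n) (Fin m) ℝ}
  {C : Matrix (Fin m) (Fin n) ℝ} {D : Matrix (Fin m) (Fin m) ℝ} {P : Matrix (Fin n) (Fin n) ℝ}

theorem isUnit_det (h : InnerRealization A B C D P) : IsUnit P.det :=
  (Matrix.isUnit_iff_isUnit_det P).1 h.posDef.isUnit

theorem transpose_eq (h : InnerRealization A B C D P) : Pᵀ = P :=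
  isHermitian_iff_transpose.1 h.posDef.1

theorem inv_transpose_eq (h : InnerRealization A B C D P) : P⁻¹ᵀ = P⁻¹ := by
  rw [Matrix.transpose_nonsing_inv, h.transpose_eq]

/-- `P⁻¹ Aᵀ P`, the inverse of `Â`. -/
def hatInv (A P : Matrix (Fin n) (Fin n) ℝ) : Matrix (Fin n) (Fin n) ℝ := P⁻¹ * Aᵀ * P

/-- The cross identity replaces AᵀPB by -CᵀD, so subtracting B D⁻¹ C from A contributes exactly the
CᵀC missing from the Lyapunov identity. As a result Â is invertible with inverse P⁻¹AᵀP, and every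
negative power of Â is a conjugate of a power of Aᵀ. -/
theorem transpose_mul_mul_Ahat (h : InnerRealization A B C D P) :
    Aᵀ * P * Ahat A B C D = P := by
  have h1 : Aᵀ * P * B = -(Cᵀ * D) := eq_neg_of_add_eq_zero_left h.cross
  have h2 : Aᵀ * P * (B * D⁻¹ * C) = -(Cᵀ * C) := by
    calc Aᵀ * P * (B * D⁻¹ * C) = (Aᵀ * P * B) * D⁻¹ * C := by simp only [Matrix.mul_assoc]
      _ = -(Cᵀ * (D * D⁻¹) * C) := by
        rw [h1, Matrix.neg_mul, Matrix.neg_mul]; simp only [Matrix.mul_assoc]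
      _ = _ := by rw [Matrix.mul_nonsing_inv _ h.isUnit, Matrix.mul_one]
  rw [Ahat, Matrix.mul_sub, h2, sub_neg_eq_add, h.lyap]

theorem hatInv_mul_Ahat (h : InnerRealization A B C D P) :
    hatInv A P * Ahat A B C D = 1 := by
  rw [hatInv, Matrix.mul_assoc, Matrix.mul_assoc, ← Matrix.mul_assoc Aᵀ,
    h.transpose_mul_mul_Ahat, Matrix.nonsing_inv_mul _ h.isUnit_det]

theorem Ahat_mul_hatInv (h : InnerRealization A B C D P) :
    Ahat A B C D * hatInv A P = 1 := mul_eq_one_comm.1 h.hatInv_mul_Ahat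

theorem hatInv_pow (h : InnerRealization A B C D P) (k : ℕ) :
    hatInv A P ^ k = P⁻¹ * Aᵀ ^ k * P := by
  induction k with
  | zero => rw [pow_zero, pow_zero, Matrix.mul_one, Matrix.nonsing_inv_mul _ h.isUnit_det]
  | succ k ih =>
    rw [pow_succ, ih, hatInv, pow_succ]
    simp only [Matrix.mul_assoc]
    rw [Matrix.mul_nonsing_inv_cancel_left _ _ h.isUnit_det]

theorem mul_hatInv_mul (h : InnerRealization A B C D P) :
    P * hatInv A P * (B * D⁻¹) = -Cᵀ := by
  have h1 : Aᵀ * P * B = -(Cᵀ * D) := eq_neg_of_add_eq_zero_left h.cross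
  calc P * hatInv A P * (B * D⁻¹) = (P * P⁻¹) * (Aᵀ * P * B) * D⁻¹ := by
        rw [hatInv]; simp only [Matrix.mul_assoc]
    _ = -Cᵀ := by
      rw [Matrix.mul_nonsing_inv _ h.isUnit_det, Matrix.one_mul, h1, Matrix.neg_mul,
        Matrix.mul_assoc, Matrix.mul_nonsing_inv _ h.isUnit, Matrix.mul_one]

/-- The dictionary between power series in Â⁻¹ applied to B D⁻¹ and sums weighted by (C Aᵏ)ᵀ. The
shift from k to k + 1 is the origin of the exponent τ - 1 in b. -/
theorem hatInv_pow_succ_mul (h : InnerRealization A B C D P) (k : ℕ) :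
    hatInv A P ^ (k + 1) * (B * D⁻¹) = -(P⁻¹ * (C * A ^ k)ᵀ) := by
  calc hatInv A P ^ (k + 1) * (B * D⁻¹)
      = P⁻¹ * Aᵀ ^ k * (P * hatInv A P * (B * D⁻¹)) := by
        rw [pow_succ, h.hatInv_pow]; simp only [Matrix.mul_assoc]
    _ = _ := by
      rw [h.mul_hatInv_mul, Matrix.transpose_mul, Matrix.transpose_pow, Matrix.mul_neg,
        Matrix.mul_assoc]

theorem transpose_mul_hatInv (h : InnerRealization A B C D P) :
    (hatInv A P)ᵀ * (Ahat A B C D)ᵀ = 1 ∧ (Ahat A B C D)ᵀ * (hatInv A P)ᵀ = 1 := by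
  rw [← Matrix.transpose_mul, ← Matrix.transpose_mul, h.Ahat_mul_hatInv, h.hatInv_mul_Ahat]
  simp

/-- The solution `Z` of `Z = Â Z Âᵀ - (B D⁻¹) Γ (B D⁻¹)ᵀ`. -/
def lyapSol (A : Matrix (Fin n) (Fin n) ℝ) (C : Matrix (Fin m) (Fin n) ℝ)
    (P : Matrix (Fin n) (Fin n) ℝ) (Γ : Matrix (Fin m) (Fin m) ℝ) : Matrix (Fin n) (Fin n) ℝ :=
  P⁻¹ * gram A (Cᵀ * Γ * C) * P⁻¹

/-- Conjugation by Â⁻¹ trades the equation for the antistable Â for one whose iteration converges.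
-/
theorem eq_hatInv_iff (h : InnerRealization A B C D P) (Z R : Matrix (Fin n) (Fin n) ℝ) :
    Z = Ahat A B C D * Z * (Ahat A B C D)ᵀ - R ↔
      Z = hatInv A P * (Z + R) * (hatInv A P)ᵀ := by
  obtain ⟨h1, h2⟩ := h.transpose_mul_hatInv
  constructor
  · intro hZ
    rw [eq_sub_iff_add_eq.1 hZ]
    calc Z = (hatInv A P * Ahat A B C D) * Z * ((Ahat A B C D)ᵀ * (hatInv A P)ᵀ) := by
          rw [h.hatInv_mul_Ahat, h2, Matrix.one_mul, Matrix.mul_one]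
      _ = _ := by simp only [Matrix.mul_assoc]
  · intro hZ
    rw [eq_sub_iff_add_eq]
    conv_rhs => rw [hZ]
    calc Z + R = (Ahat A B C D * hatInv A P) * (Z + R) * ((hatInv A P)ᵀ * (Ahat A B C D)ᵀ) := by
          rw [h.Ahat_mul_hatInv, h1, Matrix.one_mul, Matrix.mul_one]
      _ = _ := by simp only [Matrix.mul_assoc]

/-- Multiplication by P on both sides turns the equation into G = CᵀΓC + AᵀGA for G = PZP, whose
only solution is the Gramian. -/
theorem eq_lyapSol_iff (h : InnerRealization A B C D P) (Γ : Matrix (Fin m) (Fin m) ℝ)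
    (Z : Matrix (Fin n) (Fin n) ℝ) :
    Z = hatInv A P * (Z + (B * D⁻¹) * Γ * (B * D⁻¹)ᵀ) * (hatInv A P)ᵀ ↔ Z = lyapSol A C P Γ := by
  have hu := h.isUnit_det
  have hSt : (hatInv A P)ᵀ = P * A * P⁻¹ := by
    rw [hatInv, Matrix.transpose_mul, Matrix.transpose_mul, h.inv_transpose_eq, h.transpose_eq,
      Matrix.transpose_transpose, Matrix.mul_assoc]
  have hR : P * (hatInv A P * ((B * D⁻¹) * Γ * (B * D⁻¹)ᵀ) * (hatInv A P)ᵀ) * P =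
      Cᵀ * Γ * C := by
    have e : ((B * D⁻¹)ᵀ * (hatInv A P)ᵀ) * P = -C := by
      have := congrArg Matrix.transpose h.mul_hatInv_mul
      rw [Matrix.transpose_mul, Matrix.transpose_mul P, Matrix.transpose_neg,
        Matrix.transpose_transpose, h.transpose_eq] at this
      rw [Matrix.mul_assoc]; exact this
    calc _ = (P * hatInv A P * (B * D⁻¹)) * Γ * (((B * D⁻¹)ᵀ * (hatInv A P)ᵀ) * P) := by
          simp only [Matrix.mul_assoc]
      _ = _ := by
        rw [h.mul_hatInv_mul, e, Matrix.neg_mul, Matrix.neg_mul, Matrix.mul_neg, neg_neg]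
  have hZ : P * (hatInv A P * Z * (hatInv A P)ᵀ) * P = Aᵀ * (P * Z * P) * A := by
    rw [hSt, hatInv]
    simp only [Matrix.mul_assoc]
    rw [Matrix.mul_nonsing_inv_cancel_left _ _ hu, Matrix.nonsing_inv_mul _ hu, Matrix.mul_one]
  have hback : ∀ G, P⁻¹ * (P * G * P) * P⁻¹ = G := fun G => by
    simp only [Matrix.mul_assoc]
    rw [Matrix.mul_nonsing_inv _ hu, Matrix.mul_one, Matrix.nonsing_inv_mul_cancel_left _ _ hu]
  have hforth : ∀ G, P * (P⁻¹ * G * P⁻¹) * P = G := fun G => by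
    simp only [Matrix.mul_assoc]
    rw [Matrix.nonsing_inv_mul _ hu, Matrix.mul_one, Matrix.mul_nonsing_inv_cancel_left _ _ hu]
  constructor
  · intro hE
    have h1 : P * Z * P = Cᵀ * Γ * C + Aᵀ * (P * Z * P) * A := by
      conv_lhs => rw [hE]
      rw [Matrix.mul_add (hatInv A P), Matrix.add_mul, Matrix.mul_add, Matrix.add_mul, hR, hZ,
        add_comm]
    rw [lyapSol, ← h.pow.eq_gram h1, hback]
  · intro hE
    have h1 : P * Z * P = gram A (Cᵀ * Γ * C) := by rw [hE, lyapSol, hforth]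
    have h2 := h.pow.gram_eq (Cᵀ * Γ * C)
    rw [← h1, ← hR, ← hZ, ← Matrix.add_mul, ← Matrix.mul_add, add_comm, ← Matrix.add_mul,
      ← Matrix.mul_add] at h2
    have h3 := congrArg (fun G => P⁻¹ * G * P⁻¹) h2
    simp only [hback] at h3
    exact h3

theorem lyap_iff (h : InnerRealization A B C D P) (Γ : Matrix (Fin m) (Fin m) ℝ)
    (Z : Matrix (Fin n) (Fin n) ℝ) :
    Z = Ahat A B C D * Z * (Ahat A B C D)ᵀ - (B * D⁻¹) * Γ * (B * D⁻¹)ᵀ ↔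
      Z = lyapSol A C P Γ := by
  rw [h.eq_hatInv_iff, h.eq_lyapSol_iff]

theorem isLyapunovSolution_iff (h : InnerRealization A B C D P) (i : Fin m)
    (Z : Matrix (Fin n) (Fin n) ℝ) :
    IsLyapunovSolution A B C D i Z ↔ Z = lyapSol A C P (Matrix.diagonal (Pi.single i 1)) := by
  rw [← h.lyap_iff, IsLyapunovSolution]
  have : Matrix.vecMulVec ((B * D⁻¹) *ᵥ (Pi.single i 1)) ((B * D⁻¹) *ᵥ (Pi.single i 1)) =
      (B * D⁻¹) * Matrix.diagonal (Pi.single i (1 : ℝ)) * (B * D⁻¹)ᵀ := by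
    ext a b
    rw [Matrix.vecMulVec_apply, Matrix.mul_apply, Finset.sum_eq_single i]
    · simp
    · intro j _ hj
      simp [hj]
    · simp
  rw [this]

theorem lyapSol_sum (h : InnerRealization A B C D P) (γ : Fin m → ℝ) :
    ∑ j, γ j • lyapSol A C P (Matrix.diagonal (Pi.single j 1)) =
      lyapSol A C P (Matrix.diagonal γ) := by
  rw [← h.lyap_iff]
  have h1 : ∀ j, lyapSol A C P (Matrix.diagonal (Pi.single j 1)) = _ := fun j =>
    (h.lyap_iff (Matrix.diagonal (Pi.single j 1)) _).2 rfl
  have h2 : Matrix.diagonal γ = ∑ j, γ j • Matrix.diagonal (Pi.single j 1) := by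
    ext a b
    rw [Matrix.sum_apply]
    by_cases hab : a = b
    · subst hab
      simp [Pi.single_apply]
    · simp [hab]
  rw [h2]
  simp only [Matrix.mul_sum, Matrix.sum_mul, Matrix.mul_smul, Matrix.smul_mul]
  rw [← Finset.sum_sub_distrib]
  refine Finset.sum_congr rfl fun j _ => ?_
  rw [← smul_sub, ← h1 j]

theorem transpose_mul_diagonal_mul (C : Matrix (Fin m) (Fin n) ℝ) {γ δ : Fin m → ℝ}
    (hγ : ∀ i, γ i = δ i * δ i) :
    Cᵀ * Matrix.diagonal γ * C = (Matrix.diagonal δ * C)ᵀ * (Matrix.diagonal δ * C) := by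
  have : Matrix.diagonal γ = Matrix.diagonal δ * Matrix.diagonal δ := by
    rw [Matrix.diagonal_mul_diagonal]; congr 1; funext i; exact hγ i
  rw [this, Matrix.transpose_mul, Matrix.diagonal_transpose]
  simp only [Matrix.mul_assoc]

theorem lyapSol_single_posSemidef (h : InnerRealization A B C D P) (i : Fin m) :
    (lyapSol A C P (Matrix.diagonal (Pi.single i 1))).PosSemidef := by
  have h1 := h.pow.gram_posSemidef (Matrix.diagonal (Pi.single i (1 : ℝ)) * C)
  rw [← transpose_mul_diagonal_mul C (γ := Pi.single i 1) fun j => by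
    by_cases hj : j = i
    · subst hj; simp
    · simp [hj]] at h1
  have h2 := h1.mul_mul_conjTranspose_same P⁻¹
  rwa [Matrix.conjTranspose_eq_transpose_of_trivial, h.inv_transpose_eq] at h2

/-- Scaling the outputs by √γ_i > 0 preserves observability, so the weighted Gramian stays definite.
-/
theorem lyapSol_posDef (h : InnerRealization A B C D P) {γ : Fin m → ℝ} (hγ : ∀ i, 0 < γ i) :
    (lyapSol A C P (Matrix.diagonal γ)).PosDef := by
  have h1 : (gram A (Cᵀ * Matrix.diagonal γ * C)).PosDef := by
    rw [transpose_mul_diagonal_mul C (δ := fun i => Real.sqrt (γ i)) fun i =>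
      (Real.mul_self_sqrt (hγ i).le).symm]
    refine h.pow.gram_posDef fun x hx => h.obs x fun k => ?_
    have := hx k
    rw [Matrix.mul_assoc, ← Matrix.mulVec_mulVec] at this
    funext i
    have hi := congrFun this i
    rw [Matrix.mulVec_diagonal, Pi.zero_apply, mul_eq_zero] at hi
    exact hi.resolve_left (Real.sqrt_pos.2 (hγ i)).ne'
  have hu : IsUnit P⁻¹ := (Matrix.isUnit_nonsing_inv_iff).2 h.posDef.isUnit
  have h2 := (Matrix.IsUnit.posDef_star_right_conjugate_iff hu).2 h1
  rw [Matrix.star_eq_conjTranspose, Matrix.conjTranspose_eq_transpose_of_trivial,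
    h.inv_transpose_eq] at h2
  exact h2

/-- Feedback by F = D⁻¹C removes the cross terms: with R = DᵀΓD the Riccati equation becomes X =
Âᵀ(X⁻¹ + B R⁻¹Bᵀ)⁻¹Â. Inverting both sides leaves an equation linear in X⁻¹, the Lyapunov equation
with weight Γ⁻¹. Existence and uniqueness of X(Γ) follow from those of the Lyapunov solution. -/
theorem isDARESolution_iff (h : InnerRealization A B C D P) {γ : Fin m → ℝ}
    (hγ : ∀ i, 0 < γ i) {X : Matrix (Fin n) (Fin n) ℝ} (hX : X.PosDef) :
    IsDARESolution A B C D (Matrix.diagonal γ) X ↔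
      X⁻¹ = lyapSol A C P (Matrix.diagonal fun i => (γ i)⁻¹) := by
  set Γ := Matrix.diagonal γ with hΓ
  set Ah := Ahat A B C D with hAh
  set F := D⁻¹ * C with hF
  set R := Dᵀ * Γ * D with hR
  set Sg := R + Bᵀ * X * B with hSg
  have hXt : Xᵀ = X := isHermitian_iff_transpose.1 hX.1
  have hXu : IsUnit X.det := (Matrix.isUnit_iff_isUnit_det X).1 hX.isUnit
  have hΓpd : Γ.PosDef := Matrix.PosDef.diagonal hγ
  have hDu : IsUnit D := (Matrix.isUnit_iff_isUnit_det D).2 h.isUnit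
  have hRpd : R.PosDef := by
    have := (Matrix.IsUnit.posDef_star_left_conjugate_iff hDu).2 hΓpd
    rwa [Matrix.star_eq_conjTranspose, Matrix.conjTranspose_eq_transpose_of_trivial] at this
  have hBXB : (Bᵀ * X * B).PosSemidef := by
    have := hX.posSemidef.conjTranspose_mul_mul_same B
    rwa [Matrix.conjTranspose_eq_transpose_of_trivial] at this
  have hSpd : Sg.PosDef := hRpd.add_posSemidef hBXB
  have hSu : IsUnit Sg.det := (Matrix.isUnit_iff_isUnit_det Sg).1 hSpd.isUnit
  -- Both A and C are expressed through F, so that the terms containing F form a perfect square in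
  -- the metric Sg and cancel.
  have hA : A = Ah + B * F := by rw [hAh, Ahat, hF, ← Matrix.mul_assoc, sub_add_cancel]
  have hC : C = D * F := by
    rw [hF, ← Matrix.mul_assoc, Matrix.mul_nonsing_inv _ h.isUnit, Matrix.one_mul]
  clear_value F
  have hL : Bᵀ * X * A + Dᵀ * Γ * C = Bᵀ * X * Ah + Sg * F := by
    conv_lhs => rw [hA, hC]
    rw [hSg, hR, Matrix.mul_add, Matrix.add_mul]
    simp only [Matrix.mul_assoc]
    abel
  have hL' : Aᵀ * X * B + Cᵀ * Γ * D = Ahᵀ * X * B + Fᵀ * Sg := by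
    conv_lhs => rw [hA, hC]
    rw [hSg, hR, Matrix.transpose_add, Matrix.transpose_mul, Matrix.transpose_mul,
      Matrix.mul_add, Matrix.add_mul, Matrix.add_mul]
    simp only [Matrix.mul_assoc]
    abel
  have hQ : Aᵀ * X * A + Cᵀ * Γ * C = Ahᵀ * X * Ah + Ahᵀ * X * B * F + Fᵀ * (Bᵀ * X * Ah) +
      Fᵀ * Sg * F := by
    conv_lhs => rw [hA, hC]
    rw [hSg, hR, Matrix.transpose_add, Matrix.transpose_mul, Matrix.transpose_mul]
    simp only [Matrix.mul_add, Matrix.add_mul, Matrix.mul_assoc]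
    abel
  have hsq : (Ahᵀ * X * B + Fᵀ * Sg) * Sg⁻¹ * (Bᵀ * X * Ah + Sg * F) =
      Ahᵀ * X * B * Sg⁻¹ * (Bᵀ * X * Ah) + Ahᵀ * X * B * F + Fᵀ * (Bᵀ * X * Ah) +
        Fᵀ * Sg * F := by
    have e1 : Ahᵀ * X * B * Sg⁻¹ * (Sg * F) = Ahᵀ * X * B * F := by
      rw [Matrix.mul_assoc _ Sg⁻¹, Matrix.nonsing_inv_mul_cancel_left _ _ hSu]
    have e2 : Fᵀ * Sg * Sg⁻¹ = Fᵀ := Matrix.mul_nonsing_inv_cancel_right _ _ hSu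
    rw [Matrix.add_mul, e2, Matrix.add_mul, Matrix.mul_add, Matrix.mul_add, e1,
      ← Matrix.mul_assoc Fᵀ Sg F]
    abel
  have hYpd : X⁻¹.PosDef := hX.inv
  have hRu : IsUnit R.det := (Matrix.isUnit_iff_isUnit_det R).1 hRpd.isUnit
  set Z := X⁻¹ + B * R⁻¹ * Bᵀ with hZ
  have hZpd : Z.PosDef := by
    have := hRpd.inv.posSemidef.mul_mul_conjTranspose_same B
    rw [Matrix.conjTranspose_eq_transpose_of_trivial] at this
    exact hYpd.add_posSemidef this
  have hZu : IsUnit Z.det := (Matrix.isUnit_iff_isUnit_det Z).1 hZpd.isUnit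
  -- The Woodbury identity; it identifies what remains of the Riccati expression with Âᵀ Z⁻¹ Â.
  have hwood : Z⁻¹ = X - X * B * Sg⁻¹ * Bᵀ * X := by
    have := Matrix.add_mul_mul_inv_eq_sub X⁻¹ B R⁻¹ Bᵀ hYpd.isUnit hRpd.inv.isUnit (by
      rw [Matrix.nonsing_inv_nonsing_inv _ hRu, Matrix.nonsing_inv_nonsing_inv _ hXu]
      exact hSpd.isUnit)
    rwa [Matrix.nonsing_inv_nonsing_inv _ hRu, Matrix.nonsing_inv_nonsing_inv _ hXu] at this
  have hdare : IsDARESolution A B C D Γ X ↔ X = Ahᵀ * Z⁻¹ * Ah := by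
    rw [IsDARESolution]
    have : Aᵀ * X * A + Cᵀ * Γ * C - (Aᵀ * X * B + Cᵀ * Γ * D) * (Dᵀ * Γ * D + Bᵀ * X * B)⁻¹ *
        (Bᵀ * X * A + Dᵀ * Γ * C) = Ahᵀ * Z⁻¹ * Ah := by
      rw [hL, hL', hQ, ← hR, ← hSg, hsq, hwood, Matrix.mul_sub, Matrix.sub_mul]
      simp only [Matrix.mul_assoc]
      abel
    rw [this]
  have hBR : B * R⁻¹ * Bᵀ = (B * D⁻¹) * (Matrix.diagonal fun i => (γ i)⁻¹) * (B * D⁻¹)ᵀ := by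
    have hΓi : Γ⁻¹ = Matrix.diagonal fun i => (γ i)⁻¹ := by
      refine Matrix.inv_eq_right_inv ?_
      rw [hΓ, Matrix.diagonal_mul_diagonal, ← Matrix.diagonal_one]
      congr 1; funext i; exact mul_inv_cancel₀ (hγ i).ne'
    rw [hR, Matrix.mul_inv_rev, Matrix.mul_inv_rev, hΓi, Matrix.transpose_mul,
      Matrix.transpose_nonsing_inv]
    simp only [Matrix.mul_assoc]
  have hSinv : Ah⁻¹ = hatInv A P := Matrix.inv_eq_right_inv h.Ahat_mul_hatInv
  have hSinvt : Ahᵀ⁻¹ = (hatInv A P)ᵀ := by rw [← Matrix.transpose_nonsing_inv, hSinv]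
  rw [hdare, ← h.eq_lyapSol_iff, ← hBR, ← hZ]
  have hinv : (Ahᵀ * Z⁻¹ * Ah)⁻¹ = hatInv A P * Z * (hatInv A P)ᵀ := by
    rw [Matrix.mul_inv_rev, Matrix.mul_inv_rev, Matrix.nonsing_inv_nonsing_inv _ hZu, hSinv,
      hSinvt, Matrix.mul_assoc]
  constructor
  · intro hE
    rw [← hinv, ← hE]
  · intro hE
    have hAu : IsUnit Ah.det := by
      refine (Matrix.isUnit_iff_isUnit_det _).1 ⟨⟨Ah, hatInv A P, h.Ahat_mul_hatInv,
        h.hatInv_mul_Ahat⟩, rfl⟩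
    have hu : IsUnit (Ahᵀ * Z⁻¹ * Ah).det := by
      rw [Matrix.det_mul, Matrix.det_mul, Matrix.det_transpose]
      exact (hAu.mul (Matrix.isUnit_nonsing_inv_det _ hZu)).mul hAu
    rw [← hinv] at hE
    have := congrArg (fun G => G⁻¹) hE
    rwa [Matrix.nonsing_inv_nonsing_inv _ hXu, Matrix.nonsing_inv_nonsing_inv _ hu] at this

end InnerRealization

end MSStab

end

noncomputable section

namespace MSStab

open Matrix

/-! ### The range of multiplication by an inner function -/

theorem coefV_add {ι : Type*} {u v : ι → RatFunc ℝ} (hu : ∀ i, IsProper (u i))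
    (hv : ∀ i, IsProper (v i)) (k : ℕ) : coefV (u + v) k = coefV u k + coefV v k := by
  funext i
  exact impulseResponse_add (hu i) (hv i) k

theorem coefV_sub {ι : Type*} {u v : ι → RatFunc ℝ} (hu : ∀ i, IsProper (u i))
    (hv : ∀ i, IsProper (v i)) (k : ℕ) : coefV (u - v) k = coefV u k - coefV v k := by
  funext i
  exact impulseResponse_sub (hu i) (hv i) k

theorem isProper_mulVec {ι κ : Type*} [Fintype κ] {S : Matrix ι κ (RatFunc ℝ)}
    {v : κ → RatFunc ℝ} (hS : ∀ i j, IsProper (S i j)) (hv : ∀ i, IsProper (v i)) (i : ι) :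
    IsProper ((S *ᵥ v) i) :=
  IsProper.sum _ fun l _ => (hS i l).mul (hv l)

theorem isRHInf_mulVec {ι κ : Type*} [Fintype κ] {S : Matrix ι κ (RatFunc ℝ)}
    {v : κ → RatFunc ℝ} (hS : ∀ i j, IsRHInf (S i j)) (hv : ∀ i, IsRHInf (v i)) (i : ι) :
    IsRHInf ((S *ᵥ v) i) :=
  rhInfRing.sum_mem fun l _ => (hS i l).mul (hv l)

theorem coefV_map_C_mulVec {ι κ : Type*} [Fintype κ] (C : Matrix ι κ ℝ) {v : κ → RatFunc ℝ}
    (hv : ∀ i, IsProper (v i)) (k : ℕ) : coefV (C.map RatFunc.C *ᵥ v) k = C *ᵥ coefV v k := by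
  funext i
  rw [coefV, Matrix.mulVec, dotProduct,
    impulseResponse_sum _ fun l => (isProper_map_C C i l).mul (hv l)]
  exact Finset.sum_congr rfl fun l _ => impulseResponse_C_mul (hv l) (C i l) k

theorem isRHInf_of_summable {f : RatFunc ℝ} (hf : IsProper f)
    (h : Summable fun k => |impulseResponse f k|) : IsRHInf f :=
  isRHInf_of_isL1 hf (by simpa [IsL1] using h)

theorem PowSummable.isRHInf_resolventM {n : ℕ} {A : Matrix (Fin n) (Fin n) ℝ}
    (hA : PowSummable A) (i j) : IsRHInf (resolventM A i j) := by
  refine isRHInf_of_summable (isProper_resolventM A i j) ?_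
  rw [← summable_nat_add_iff 1]
  refine (hA i j).congr fun k => ?_
  rw [← coefM_resolventM_succ]
  rfl

theorem PowSummable.isRHInf_tf {n : ℕ} {ι κ : Type*} {A : Matrix (Fin n) (Fin n) ℝ}
    (hA : PowSummable A) (B : Matrix (Fin n) κ ℝ) (C : Matrix ι (Fin n) ℝ) (D : Matrix ι κ ℝ)
    (i j) : IsRHInf (tf A B C D i j) := by
  refine (isRHInf_C _).add ?_
  rw [Matrix.mul_apply]
  refine rhInfRing.sum_mem fun b _ => IsRHInf.mul ?_ (isRHInf_C _)
  rw [Matrix.mul_apply]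
  exact rhInfRing.sum_mem fun a _ => (isRHInf_C _).mul (hA.isRHInf_resolventM a b)

/-! ### State recursion in the time domain -/

section State

variable {m n : ℕ}

/-- The state `(zI - A)⁻¹ B p`. -/
def stateV (A : Matrix (Fin n) (Fin n) ℝ) (B : Matrix (Fin n) (Fin m) ℝ)
    (p : Fin m → RatFunc ℝ) : Fin n → RatFunc ℝ :=
  resolventM A *ᵥ (B.map RatFunc.C *ᵥ p)

variable (A : Matrix (Fin n) (Fin n) ℝ) (B : Matrix (Fin n) (Fin m) ℝ)
  (C : Matrix (Fin m) (Fin n) ℝ) (D : Matrix (Fin m) (Fin m) ℝ)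

theorem isProper_stateV {p : Fin m → RatFunc ℝ} (hp : ∀ i, IsProper (p i)) (i) :
    IsProper (stateV A B p i) :=
  isProper_mulVec (isProper_resolventM A) (isProper_mulVec (isProper_map_C B) hp) i

theorem coefV_stateV_zero {p : Fin m → RatFunc ℝ} (hp : ∀ i, IsProper (p i)) :
    coefV (stateV A B p) 0 = 0 := by
  rw [stateV, coefV_mulVec (isProper_resolventM A) (isProper_mulVec (isProper_map_C B) hp),
    Finset.Nat.antidiagonal_zero, Finset.sum_singleton, coefM_resolventM_zero, Matrix.zero_mulVec]

theorem stateV_eq (p : Fin m → RatFunc ℝ) : stateV A B p =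
    (RatFunc.X : RatFunc ℝ)⁻¹ • (B.map RatFunc.C *ᵥ p + A.map RatFunc.C *ᵥ stateV A B p) := by
  have h : (oneSubM A)⁻¹ =
      1 + (RatFunc.X : RatFunc ℝ)⁻¹ • (A.map RatFunc.C * (oneSubM A)⁻¹) := by
    have h := Matrix.mul_nonsing_inv _ (isProper_oneSubM_inv A).1.isUnit
    conv_lhs at h => rw [oneSubM]
    rw [sub_mul, one_mul, smul_mul_assoc, sub_eq_iff_eq_add] at h
    exact h
  rw [stateV, resolventM_eq, Matrix.smul_mulVec]
  conv_lhs => rw [h]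
  rw [Matrix.add_mulVec, Matrix.one_mulVec, Matrix.smul_mulVec, ← Matrix.mulVec_mulVec,
    Matrix.mulVec_smul]

theorem coefV_stateV_succ {p : Fin m → RatFunc ℝ} (hp : ∀ i, IsProper (p i)) (k : ℕ) :
    coefV (stateV A B p) (k + 1) = A *ᵥ coefV (stateV A B p) k + B *ᵥ coefV p k := by
  have h1 := isProper_mulVec (isProper_map_C B) hp
  have h2 := isProper_mulVec (isProper_map_C A) (isProper_stateV A B hp)
  rw [← coefV_map_C_mulVec B hp, ← coefV_map_C_mulVec A (isProper_stateV A B hp),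
    add_comm (coefV _ _) (coefV _ _), ← coefV_add h1 h2]
  funext i
  conv_lhs => rw [coefV, stateV_eq]
  rw [Pi.smul_apply, smul_eq_mul, ← pow_one (RatFunc.X : RatFunc ℝ)⁻¹]
  exact impulseResponse_X_inv_pow_mul ((h1 i).add (h2 i)) 1 k

theorem coefV_tf_mulVec {p : Fin m → RatFunc ℝ} (hp : ∀ i, IsProper (p i)) (k : ℕ) :
    coefV (tf A B C D *ᵥ p) k = C *ᵥ coefV (stateV A B p) k + D *ᵥ coefV p k := by
  have hs := isProper_stateV A B hp
  rw [← coefV_map_C_mulVec D hp, ← coefV_map_C_mulVec C hs, add_comm, ← coefV_add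
    (isProper_mulVec (isProper_map_C D) hp) (isProper_mulVec (isProper_map_C C) hs), tf,
    Matrix.add_mulVec, stateV, Matrix.mulVec_mulVec, Matrix.mulVec_mulVec, Matrix.mul_assoc]

end State

theorem hasSum_mulVec {ι κ : Type*} [Fintype κ] {f : ℕ → κ → ℝ} {a : κ → ℝ}
    (L : Matrix ι κ ℝ) (h : HasSum f a) : HasSum (fun k => L *ᵥ f k) (L *ᵥ a) :=
  h.map (Matrix.mulVecLin L).toAddMonoidHom (continuous_const.matrix_mulVec continuous_id)

theorem hasSum_dotProduct {κ : Type*} [Fintype κ] {f : ℕ → κ → ℝ} {a : κ → ℝ}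
    (x : κ → ℝ) (h : HasSum f a) : HasSum (fun k => x ⬝ᵥ f k) (x ⬝ᵥ a) := by
  have := hasSum_sum (s := Finset.univ) fun i _ => (Pi.hasSum.1 h i).mul_left (x i)
  exact this

/-- The pairs (l, k + l) form an injective subfamily of the summable double family a l * b l'. -/
theorem summable_correlation {a b : ℕ → ℝ} (ha0 : ∀ k, 0 ≤ a k) (hb0 : ∀ k, 0 ≤ b k)
    (ha : Summable a) (hb : Summable b) : Summable fun k => ∑' l, a l * b (k + l) := by
  have h := summable_mul_nonneg ha0 hb0 ha hb
  have hinj : Function.Injective fun p : ℕ × ℕ => (p.2, p.1 + p.2) := by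
    rintro ⟨a, b⟩ ⟨c, d⟩ h
    simp only [Prod.mk.injEq] at h
    ext <;> simp <;> omega
  have h2 := h.comp_injective hinj
  exact h2.prod

/-! ### The functionals that detect the stable range of an inner function -/

namespace InnerRealization

variable {m n : ℕ} {A : Matrix (Fin n) (Fin n) ℝ} {B : Matrix (Fin n) (Fin m) ℝ}
  {C : Matrix (Fin m) (Fin n) ℝ} {D : Matrix (Fin m) (Fin m) ℝ} {P : Matrix (Fin n) (Fin n) ℝ}

theorem summable_transpose_mulVec (h : InnerRealization A B C D P) {v : Fin m → RatFunc ℝ}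
    (hv : ∀ i, IsRHInf (v i)) :
    Summable fun k : ℕ => (C * A ^ k)ᵀ *ᵥ coefV v k := by
  rw [Pi.summable]
  intro a
  obtain ⟨c, hc⟩ : ∃ c, ∀ i, ∀ k : ℕ, |(C * A ^ k) i a| ≤ c := by
    have h1 : ∀ i, ∃ c, ∀ k : ℕ, |(C * A ^ k) i a| ≤ c := fun i => by
      have := summable_mul_mul_pow h.pow C 1 i a
      simp only [Matrix.mul_one] at this
      exact ⟨_, fun k => this.le_tsum k fun _ _ => abs_nonneg _⟩
    choose c hc using h1
    exact ⟨∑ i, |c i|, fun i k => (hc i k).trans ((le_abs_self _).trans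
      (Finset.single_le_sum (f := fun i => |c i|) (fun _ _ => abs_nonneg _)
        (Finset.mem_univ i)))⟩
  refine Summable.of_abs (Summable.of_nonneg_of_le (fun _ => abs_nonneg _) (fun k => ?_)
    (summable_sum (s := Finset.univ) fun i _ =>
      (summable_impulseResponse (hv i)).mul_left c))
  change |∑ i, (C * A ^ k)ᵀ a i * coefV v k i| ≤ _
  refine (Finset.abs_sum_le_sum_abs _ _).trans (Finset.sum_le_sum fun i _ => ?_)
  rw [abs_mul]
  exact mul_le_mul_of_nonneg_right (hc i k) (abs_nonneg _)

/-- `∑ₖ (C Aᵏ)ᵀ vₖ`, the pairing of `v` with the model space of the inner function. -/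
def ell (A : Matrix (Fin n) (Fin n) ℝ) (C : Matrix (Fin m) (Fin n) ℝ)
    (v : Fin m → RatFunc ℝ) : Fin n → ℝ := ∑' k : ℕ, (C * A ^ k)ᵀ *ᵥ coefV v k

theorem hasSum_ell (h : InnerRealization A B C D P) {v : Fin m → RatFunc ℝ}
    (hv : ∀ i, IsRHInf (v i)) :
    HasSum (fun k : ℕ => (C * A ^ k)ᵀ *ᵥ coefV v k) (ell A C v) :=
  (h.summable_transpose_mulVec hv).hasSum

theorem ell_add (h : InnerRealization A B C D P) {u v : Fin m → RatFunc ℝ}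
    (hu : ∀ i, IsRHInf (u i)) (hv : ∀ i, IsRHInf (v i)) :
    ell A C (u + v) = ell A C u + ell A C v := by
  have h1 := (h.hasSum_ell hu).add (h.hasSum_ell hv)
  rw [← h1.tsum_eq, ell]
  congr 1; funext k
  rw [coefV_add (fun i => (hu i).1) (fun i => (hv i).1), Matrix.mulVec_add]

theorem ell_sub (h : InnerRealization A B C D P) {u v : Fin m → RatFunc ℝ}
    (hu : ∀ i, IsRHInf (u i)) (hv : ∀ i, IsRHInf (v i)) :
    ell A C (u - v) = ell A C u - ell A C v := by
  have h1 := (h.hasSum_ell hu).sub (h.hasSum_ell hv)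
  rw [← h1.tsum_eq, ell]
  congr 1; funext k
  rw [coefV_sub (fun i => (hu i).1) (fun i => (hv i).1), Matrix.mulVec_sub]

/-- With x the state driven by p, the Lyapunov and cross identities make the k-th term equal to
(Aᵀ)ᵏP x_k - (Aᵀ)ᵏ⁺¹P x_{k+1}. The sum telescopes from x₀ = 0 to a limit that is zero. -/
theorem ell_tf_mulVec (h : InnerRealization A B C D P) {p : Fin m → RatFunc ℝ}
    (hp : ∀ i, IsRHInf (p i)) : ell A C (tf A B C D *ᵥ p) = 0 := by
  have hpp : ∀ i, IsProper (p i) := fun i => (hp i).1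
  have hs : ∀ i, IsRHInf (stateV A B p i) :=
    isRHInf_mulVec h.pow.isRHInf_resolventM (isRHInf_mulVec (fun i j => isRHInf_C _) hp)
  have hy : ∀ i, IsRHInf ((tf A B C D *ᵥ p) i) := isRHInf_mulVec (h.pow.isRHInf_tf B C D) hp
  set x := coefV (stateV A B p) with hx
  have hterm : ∀ k : ℕ, (C * A ^ k)ᵀ *ᵥ coefV (tf A B C D *ᵥ p) k =
      (Aᵀ ^ k * P) *ᵥ x k - (Aᵀ ^ (k + 1) * P) *ᵥ x (k + 1) := by
    intro k
    have h1 : Cᵀ * C = P - Aᵀ * P * A := by rw [eq_sub_iff_add_eq, add_comm, h.lyap]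
    have h2 : Cᵀ * D = -(Aᵀ * P * B) := eq_neg_of_add_eq_zero_right h.cross
    have hs1 : x (k + 1) = A *ᵥ x k + B *ᵥ coefV p k := coefV_stateV_succ A B hpp k
    rw [coefV_tf_mulVec A B C D hpp, hs1, ← hx, Matrix.transpose_mul,
      Matrix.transpose_pow, Matrix.mulVec_add, Matrix.mulVec_add, Matrix.mulVec_mulVec,
      Matrix.mulVec_mulVec, Matrix.mulVec_mulVec, Matrix.mulVec_mulVec, Matrix.mul_assoc,
      Matrix.mul_assoc, h1, h2, Matrix.mul_sub, Matrix.sub_mulVec, Matrix.mul_neg,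
      Matrix.neg_mulVec, pow_succ]
    simp only [Matrix.mul_assoc]
    abel
  have hpart : ∀ K : ℕ, ∑ k ∈ Finset.range K, (C * A ^ k)ᵀ *ᵥ coefV (tf A B C D *ᵥ p) k =
      -((Aᵀ ^ K * P) *ᵥ x K) := by
    intro K
    simp_rw [hterm]
    rw [Finset.sum_range_sub', hx, coefV_stateV_zero A B hpp, Matrix.mulVec_zero, zero_sub]
  have hlim := (h.hasSum_ell hy).tendsto_sum_nat
  simp_rw [hpart] at hlim
  have hx0 : Filter.Tendsto x Filter.atTop (nhds 0) := by
    rw [tendsto_pi_nhds]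
    intro i
    exact (summable_impulseResponse (hs i)).of_abs.tendsto_atTop_zero
  have h0 : Filter.Tendsto (fun K : ℕ => -((Aᵀ ^ K * P) *ᵥ x K)) Filter.atTop (nhds 0) := by
    have hc : Continuous fun q : Matrix (Fin n) (Fin n) ℝ × (Fin n → ℝ) => -((q.1 * P) *ᵥ q.2) :=
      ((continuous_fst.matrix_mul continuous_const).matrix_mulVec continuous_snd).neg
    have := (hc.tendsto (0, 0)).comp (h.pow.transpose.tendsto.prodMk_nhds hx0)
    simpa [Function.comp_def] using this
  exact tendsto_nhds_unique hlim h0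

/-- The Gramian identities say that one square block matrix is a left inverse of [A B; C D]. It is
then also a right inverse, and these are the blocks of that product. -/
theorem dual_identities (h : InnerRealization A B C D P) :
    A * (P⁻¹ * Aᵀ * P) + B * (Bᵀ * P) = 1 ∧ A * (P⁻¹ * Cᵀ) + B * Dᵀ = 0 ∧
      C * (P⁻¹ * Aᵀ * P) + D * (Bᵀ * P) = 0 ∧ C * (P⁻¹ * Cᵀ) + D * Dᵀ = 1 := by
  have hcr : Bᵀ * P * A + Dᵀ * C = 0 := by
    have := congrArg Matrix.transpose h.cross
    simpa only [Matrix.transpose_add, Matrix.transpose_mul, Matrix.transpose_transpose,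
      h.transpose_eq, Matrix.transpose_zero, Matrix.mul_assoc] using this
  have h1 : Matrix.fromBlocks (P⁻¹ * Aᵀ * P) (P⁻¹ * Cᵀ) (Bᵀ * P) Dᵀ *
      Matrix.fromBlocks A B C D = 1 := by
    rw [Matrix.fromBlocks_multiply, ← Matrix.fromBlocks_one]
    congr 1
    · rw [Matrix.mul_assoc, Matrix.mul_assoc, Matrix.mul_assoc, ← Matrix.mul_add,
        ← Matrix.mul_assoc Aᵀ, h.lyap, Matrix.nonsing_inv_mul _ h.isUnit_det]
    · rw [Matrix.mul_assoc, Matrix.mul_assoc, Matrix.mul_assoc, ← Matrix.mul_add,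
        ← Matrix.mul_assoc Aᵀ, h.cross, Matrix.mul_zero]
    · exact h.feed
  have h2 := mul_eq_one_comm.1 h1
  rw [Matrix.fromBlocks_multiply, ← Matrix.fromBlocks_one, Matrix.fromBlocks_inj] at h2
  exact h2

/-- The only candidate is p = M⁻¹f, which is proper because D is invertible but might be unstable.
An inner function is also inverted by its adjoint, an anticausal system with state ξ_k and output
Dᵀf_k + Bᵀξ_{k+1}. The vanishing of ℓ(f) is ξ₀ = 0; it makes P⁻¹ξ_k satisfy the causal state
recursion, so both inverses agree. The anticausal formula is summable, which proves that p is
stable. -/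
theorem exists_tf_mulVec_eq (h : InnerRealization A B C D P) {f : Fin m → RatFunc ℝ}
    (hf : ∀ i, IsRHInf (f i)) (hell : ell A C f = 0) :
    ∃ p : Fin m → RatFunc ℝ, (∀ i, IsRHInf (p i)) ∧ tf A B C D *ᵥ p = f := by
  obtain ⟨hdet, hinv⟩ := isProper_inv_apply (isProper_tf A B C D) (by
    rw [coefM_tf_zero]; exact h.isUnit.ne_zero)
  set p := (tf A B C D)⁻¹ *ᵥ f with hp
  have hMp : tf A B C D *ᵥ p = f := by
    rw [hp, Matrix.mulVec_mulVec, Matrix.mul_nonsing_inv _ hdet.isUnit, Matrix.one_mulVec]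
  have hpp : ∀ i, IsProper (p i) := isProper_mulVec hinv fun i => (hf i).1
  refine ⟨p, fun i => isRHInf_of_summable (hpp i) ?_, hMp⟩
  have hsh : ∀ k, Summable fun l : ℕ => (C * A ^ l)ᵀ *ᵥ coefV f (k + l) := by
    intro k
    rw [Pi.summable]
    intro a
    change Summable fun l : ℕ => ∑ i, (C * A ^ l)ᵀ a i * coefV f (k + l) i
    refine summable_sum fun i _ => ?_
    have h1 := summable_mul_mul_pow h.pow C 1 i a
    simp only [Matrix.mul_one] at h1
    obtain ⟨c, hc⟩ : ∃ c, ∀ k, |impulseResponse (f i) k| ≤ c :=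
      ⟨_, fun k => (summable_impulseResponse (hf i)).le_tsum k fun _ _ => abs_nonneg _⟩
    refine Summable.of_abs (Summable.of_nonneg_of_le (fun _ => abs_nonneg _) (fun k => ?_)
      (h1.mul_right c))
    rw [abs_mul]
    exact mul_le_mul_of_nonneg_left (hc _) (abs_nonneg _)
  -- The anticausal state: ξ_k is the pairing ℓ applied to the tail of f from time k on.
  set ξ : ℕ → Fin n → ℝ := fun k => ∑' l : ℕ, (C * A ^ l)ᵀ *ᵥ coefV f (k + l) with hξ
  have hξ0 : ξ 0 = 0 := by
    rw [← hell, hξ, ell]; simp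
  have hξs : ∀ k, ξ k = Cᵀ *ᵥ coefV f k + Aᵀ *ᵥ ξ (k + 1) := by
    intro k
    have h1 := hasSum_mulVec Aᵀ (hsh (k + 1)).hasSum
    have h2 : (fun l : ℕ => Aᵀ *ᵥ ((C * A ^ l)ᵀ *ᵥ coefV f (k + 1 + l))) =
        fun l : ℕ => (C * A ^ (l + 1))ᵀ *ᵥ coefV f (k + (l + 1)) := by
      funext l
      rw [Matrix.mulVec_mulVec, ← Matrix.transpose_mul, Matrix.mul_assoc, ← pow_succ,
        show k + 1 + l = k + (l + 1) by ring]
    rw [h2] at h1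
    have h3 := HasSum.zero_add (f := fun l : ℕ => (C * A ^ l)ᵀ *ᵥ coefV f (k + l)) h1
    rw [pow_zero, Matrix.mul_one, add_zero] at h3
    exact h3.tsum_eq
  obtain ⟨d1, d2, d3, d4⟩ := h.dual_identities
  have hPi : ∀ x : Fin n → ℝ, P *ᵥ (P⁻¹ *ᵥ x) = x := fun x => by
    rw [Matrix.mulVec_mulVec, Matrix.mul_nonsing_inv _ h.isUnit_det, Matrix.one_mulVec]
  -- The causal system, fed with the anticausal output and started in P⁻¹ξ_k, moves to P⁻¹ξ_{k+1}
  -- and emits f_k.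
  have key : ∀ k, A *ᵥ (P⁻¹ *ᵥ ξ k) + B *ᵥ (Dᵀ *ᵥ coefV f k + Bᵀ *ᵥ ξ (k + 1)) =
        P⁻¹ *ᵥ ξ (k + 1) ∧
      C *ᵥ (P⁻¹ *ᵥ ξ k) + D *ᵥ (Dᵀ *ᵥ coefV f k + Bᵀ *ᵥ ξ (k + 1)) = coefV f k := by
    intro k
    set η := P⁻¹ *ᵥ ξ (k + 1) with hη
    have hη' : ξ (k + 1) = P *ᵥ η := (hPi _).symm
    rw [hξs k, hη']
    have e1 := congrArg (fun Z => Z *ᵥ η) d1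
    have e2 := congrArg (fun Z => Z *ᵥ coefV f k) d2
    have e3 := congrArg (fun Z => Z *ᵥ η) d3
    have e4 := congrArg (fun Z => Z *ᵥ coefV f k) d4
    simp only [Matrix.add_mulVec, Matrix.one_mulVec, Matrix.zero_mulVec,
      ← Matrix.mulVec_mulVec] at e1 e2 e3 e4
    constructor
    · simp only [Matrix.mulVec_add]
      calc _ = (A *ᵥ P⁻¹ *ᵥ Cᵀ *ᵥ coefV f k + B *ᵥ Dᵀ *ᵥ coefV f k) +
            (A *ᵥ P⁻¹ *ᵥ Aᵀ *ᵥ P *ᵥ η + B *ᵥ Bᵀ *ᵥ P *ᵥ η) := by abel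
        _ = η := by rw [e1, e2, zero_add]
    · simp only [Matrix.mulVec_add]
      calc _ = (C *ᵥ P⁻¹ *ᵥ Cᵀ *ᵥ coefV f k + D *ᵥ Dᵀ *ᵥ coefV f k) +
            (C *ᵥ P⁻¹ *ᵥ Aᵀ *ᵥ P *ᵥ η + D *ᵥ Bᵀ *ᵥ P *ᵥ η) := by abel
        _ = _ := by rw [e3, e4, add_zero]
  have hstep : ∀ k, coefV (stateV A B p) k = P⁻¹ *ᵥ ξ k →
      coefV p k = Dᵀ *ᵥ coefV f k + Bᵀ *ᵥ ξ (k + 1) := by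
    intro k hk
    have h1 := coefV_tf_mulVec A B C D hpp k
    rw [hMp, hk] at h1
    have h2 := (key k).2
    conv_rhs at h2 => rw [h1]
    have h3 := congrArg (fun y => D⁻¹ *ᵥ y) (add_left_cancel h2)
    simp only [Matrix.mulVec_mulVec, Matrix.nonsing_inv_mul _ h.isUnit, Matrix.one_mulVec] at h3
    exact h3.symm
  have hstate : ∀ k, coefV (stateV A B p) k = P⁻¹ *ᵥ ξ k := by
    intro k
    induction k with
    | zero => rw [coefV_stateV_zero A B hpp, hξ0, Matrix.mulVec_zero]
    | succ k ih => rw [coefV_stateV_succ A B hpp, hstep k ih, ih, (key k).1]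
  have hcoef : ∀ k, impulseResponse (p i) k =
      (Dᵀ *ᵥ coefV f k) i + (Bᵀ *ᵥ ξ (k + 1)) i := fun k =>
    congrFun (hstep k (hstate k)) i
  have hξsum : ∀ a, Summable fun k => |ξ k a| := by
    intro a
    have h1 : ∀ j, Summable fun k => ∑' l : ℕ, |(C * A ^ l) j a| * |impulseResponse (f j) (k + l)| :=
      fun j => by
        have h2 := summable_mul_mul_pow h.pow C 1 j a
        simp only [Matrix.mul_one] at h2
        exact summable_correlation (a := fun l => |(C * A ^ l) j a|)
          (b := fun k => |impulseResponse (f j) k|) (fun _ => abs_nonneg _) (fun _ => abs_nonneg _)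
          h2 (summable_impulseResponse (hf j))
    refine Summable.of_nonneg_of_le (fun _ => abs_nonneg _) (fun k => ?_)
      (summable_sum (s := Finset.univ) fun j _ => h1 j)
    have h2 : ∀ j, Summable fun l : ℕ => |(C * A ^ l) j a| * |impulseResponse (f j) (k + l)| := by
      intro j
      have h3 := summable_mul_mul_pow h.pow C 1 j a
      simp only [Matrix.mul_one] at h3
      refine Summable.of_nonneg_of_le (fun _ => by positivity) (fun l => ?_)
        (h3.mul_right (∑' k, |impulseResponse (f j) k|))
      exact mul_le_mul_of_nonneg_left ((summable_impulseResponse (hf j)).le_tsum (k + l)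
        fun _ _ => abs_nonneg _) (abs_nonneg _)
    rw [← Summable.tsum_finsetSum fun j _ => h2 j]
    have h4 := Pi.hasSum.1 (hsh k).hasSum a
    rw [show ξ k a = _ from h4.tsum_eq.symm]
    have h5 : Summable fun l : ℕ => ∑ j, |(C * A ^ l) j a| * |impulseResponse (f j) (k + l)| :=
      summable_sum fun j _ => h2 j
    rw [← Real.norm_eq_abs]
    refine (tsum_of_norm_bounded h5.hasSum fun l => ?_)
    rw [Real.norm_eq_abs]
    change |∑ j, (C * A ^ l)ᵀ a j * coefV f (k + l) j| ≤ _
    refine (Finset.abs_sum_le_sum_abs _ _).trans_eq (Finset.sum_congr rfl fun j _ => ?_)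
    rw [abs_mul]; rfl
  refine Summable.of_nonneg_of_le (fun _ => abs_nonneg _) (fun k => ?_)
    ((summable_sum (s := Finset.univ) fun j _ =>
      (summable_impulseResponse (hf j)).mul_left |Dᵀ i j|).add
      (summable_sum (s := Finset.univ) fun a _ =>
        ((summable_nat_add_iff 1).2 (hξsum a)).mul_left |Bᵀ i a|))
  rw [hcoef]
  refine (abs_add_le _ _).trans (add_le_add ?_ ?_)
  · change |∑ j, Dᵀ i j * coefV f k j| ≤ _
    refine (Finset.abs_sum_le_sum_abs _ _).trans_eq (Finset.sum_congr rfl fun j _ => ?_)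
    rw [abs_mul]; rfl
  · change |∑ a, Bᵀ i a * ξ (k + 1) a| ≤ _
    refine (Finset.abs_sum_le_sum_abs _ _).trans_eq (Finset.sum_congr rfl fun j _ => ?_)
    rw [abs_mul]

end InnerRealization

end MSStab

end

noncomputable section

namespace MSStab

open Matrix

/-! ### Rational functions of a matrix -/

section FunctionalCalculus

open scoped Matrix.Norms.Operator

theorem aeval_reflect_mul_pow {R : Type*} [Ring R] [Algebra ℝ R] {S T : R} (h : S * T = 1)
    {q : ℝ[X]} {N : ℕ} (hN : q.natDegree ≤ N) : aeval S (q.reflect N) * T ^ N = aeval T q := by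
  have hST : ∀ k, S ^ k * T ^ k = 1 := fun k => by
    induction k with
    | zero => simp
    | succ k ih => rw [pow_succ, pow_succ', mul_assoc, ← mul_assoc S, h, one_mul, ih]
  have h1 : (q.reflect N).natDegree < N + 1 := by
    have := Polynomial.natDegree_reflect_le (p := q) (N := N)
    omega
  rw [Polynomial.aeval_eq_sum_range' h1, Polynomial.aeval_eq_sum_range' (Nat.lt_succ_of_le hN),
    ← Finset.sum_range_reflect, Finset.sum_mul]
  refine Finset.sum_congr rfl fun k hk => ?_
  have hk' : k ≤ N := by simpa [Nat.lt_succ_iff] using hk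
  rw [Polynomial.coeff_reflect, Polynomial.revAt_le (by omega), smul_mul_assoc,
    show N + 1 - 1 - k = N - k by omega, show N - (N - k) = k by omega]
  congr 1
  rw [← Nat.sub_add_cancel hk', pow_add, ← mul_assoc, Nat.add_sub_cancel, hST, one_mul]

/-- The definition of w(T) uses a matrix inverse that has a default value when it does not exist, so
the substance is that the denominator of w is invertible at T. Stability of w and bounded powers of
S = T⁻¹ provide the inverse as a convergent series. -/
theorem evalSeries_imp_eq_evalMat {n : ℕ} {S T : Matrix (Fin n) (Fin n) ℝ} (h : S * T = 1)
    {c : ℝ} (hS : ∀ k, ‖S ^ k‖ ≤ c) {w : RatFunc ℝ} (hw : IsRHInf w) :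
    evalSeries S (imp w) = evalMat w T := by
  set N := w.denom.natDegree with hN
  have h1 := congrArg (evalSeries S) (imp_mul_reflect_denom w)
  rw [evalSeries_mul hS hw.isL1 (isL1_coe _), evalSeries_coe, evalSeries_coe] at h1
  have h2 := congrArg (· * T ^ N) h1
  simp only [mul_assoc] at h2
  rw [aeval_reflect_mul_pow h le_rfl, aeval_reflect_mul_pow h (isProper_iff_natDegree.1 hw.1)] at h2
  -- The expansion of zᴺ / denominator inverts the reflected denominator, so its value at S,
  -- multiplied by Sᴺ, is an explicit left inverse of the denominator at T.
  set e : RatFunc ℝ := algebraMap ℝ[X] _ (Polynomial.X ^ N) / algebraMap _ _ w.denom with he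
  have hep : IsProper e := isProper_of_eq_div w.denom_ne_zero he (by simp [hN])
  have heR : IsRHInf e := isRHInf_of_eq_div w.denom_ne_zero he hep hw.2
  have h3 := congrArg (evalSeries S) (imp_mul_reflect (N := N) w.denom_ne_zero he hep (by simp) le_rfl)
  rw [evalSeries_mul hS heR.isL1 (isL1_coe _), evalSeries_coe, evalSeries_coe] at h3
  have h4 := congrArg (· * T ^ N) h3
  simp only [mul_assoc] at h4
  rw [aeval_reflect_mul_pow h le_rfl, aeval_reflect_mul_pow h (by simp), map_pow, aeval_X] at h4
  have hSTN : S ^ N * T ^ N = 1 := by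
    rw [← (Commute.mul_pow (h.trans (mul_eq_one_comm.1 h).symm)), h, one_pow]
  have h5 : (S ^ N * evalSeries S (imp e)) * aeval T w.denom = T ^ N * 0 + 1 := by
    rw [mul_assoc, h4, hSTN]; simp
  have hu : IsUnit (aeval T w.denom).det := Matrix.isUnit_det_of_left_inverse (by simpa using h5)
  rw [evalMat, ← h2, mul_assoc, Matrix.mul_nonsing_inv _ hu, mul_one]

theorem hasSum_evalMat {n : ℕ} {S T : Matrix (Fin n) (Fin n) ℝ} (h : S * T = 1)
    {c : ℝ} (hS : ∀ k i j, |(S ^ k) i j| ≤ c) {w : RatFunc ℝ} (hw : IsRHInf w) :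
    HasSum (fun k => impulseResponse w k • S ^ k) (evalMat w T) := by
  have hS' : ∀ k, ‖S ^ k‖ ≤ ((∑ _j : Fin n, c.toNNReal : NNReal) : ℝ) := by
    intro k
    rw [Matrix.linfty_opNorm_def, NNReal.coe_le_coe]
    refine Finset.sup_le fun i _ => Finset.sum_le_sum fun j _ => ?_
    rw [← NNReal.coe_le_coe, coe_nnnorm, Real.norm_eq_abs]
    exact (hS k i j).trans (Real.le_coe_toNNReal c)
  rw [← evalSeries_imp_eq_evalMat h hS' hw]
  have := (summable_norm_coeff_smul_pow hS' hw.isL1).of_norm.hasSum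
  simp only [coeff_imp] at this
  simp only [evalSeries, coeff_imp]
  exact this

end FunctionalCalculus

/-! ### Minimal norm interpolation -/

theorem coefV_X_inv_pow_smul {ι : Type*} {g : ι → RatFunc ℝ} (hg : ∀ i, IsProper (g i))
    (t k : ℕ) : coefV ((RatFunc.X : RatFunc ℝ)⁻¹ ^ t • g) (k + t) = coefV g k := by
  funext i
  exact impulseResponse_X_inv_pow_mul (hg i) t k

theorem coefV_X_inv_pow_smul_of_lt {ι : Type*} {g : ι → RatFunc ℝ} (hg : ∀ i, IsProper (g i))
    {t k : ℕ} (hk : k < t) : coefV ((RatFunc.X : RatFunc ℝ)⁻¹ ^ t • g) k = 0 := by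
  funext i
  exact impulseResponse_X_inv_pow_mul_of_lt (hg i) hk

theorem isRHInf_X_inv_pow_mul {g : RatFunc ℝ} (hg : IsRHInf g) (t : ℕ) :
    IsRHInf ((RatFunc.X : RatFunc ℝ)⁻¹ ^ t * g) :=
  rhInfRing.mul_mem (rhInfRing.pow_mem isRHInf_X_inv t) hg

theorem h2NormSq_X_inv_pow_mul {g : RatFunc ℝ} (hg : IsRHInf g) (t : ℕ) :
    h2NormSq ((RatFunc.X : RatFunc ℝ)⁻¹ ^ t * g) = h2NormSq g := by
  have hs := summable_sq_impulseResponse (isRHInf_X_inv_pow_mul hg t)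
  rw [h2NormSq_eq_tsum hg, h2NormSq_eq_tsum (isRHInf_X_inv_pow_mul hg t),
    ← hs.sum_add_tsum_nat_add t, Finset.sum_eq_zero fun k hk => by
      rw [impulseResponse_X_inv_pow_mul_of_lt hg.1 (Finset.mem_range.1 hk)]; simp, zero_add]
  simp_rw [impulseResponse_X_inv_pow_mul hg.1]

theorem hasSum_mulVec_const {ι κ : Type*} [Fintype κ] {f : ℕ → Matrix ι κ ℝ} {a : Matrix ι κ ℝ}
    (x : κ → ℝ) (h : HasSum f a) : HasSum (fun k => f k *ᵥ x) (a *ᵥ x) :=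
  h.map ((Matrix.mulVecBilin ℝ ℝ).flip x).toAddMonoidHom
    (continuous_id.matrix_mulVec continuous_const)

theorem PowSummable.exists_coefV_eq {n : ℕ} {ι : Type*} {A : Matrix (Fin n) (Fin n) ℝ}
    (hA : PowSummable A) (C : Matrix ι (Fin n) ℝ) (η : Fin n → ℝ) :
    ∃ g : ι → RatFunc ℝ, (∀ i, IsRHInf (g i)) ∧ ∀ k, coefV g k = (C * A ^ k) *ᵥ η := by
  -- Input column Aη and feedthrough Cη make the free response C Aᵏ η begin at k = 0 without a
  -- delay.
  set T := tf A (Matrix.replicateCol Unit (A *ᵥ η)) C (Matrix.replicateCol Unit (C *ᵥ η)) with hT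
  refine ⟨fun i => T i (), fun i => hA.isRHInf_tf _ _ _ i (), fun k => ?_⟩
  funext i
  have h1 : coefV (fun i => T i ()) k i = coefM T k i () := rfl
  rw [h1, hT]
  cases k with
  | zero => rw [coefM_tf_zero, pow_zero, Matrix.mul_one]; rfl
  | succ k =>
    rw [coefM_tf_succ, pow_succ, ← Matrix.mul_assoc, ← Matrix.mulVec_mulVec]; rfl

namespace InnerRealization

variable {m n : ℕ} {A : Matrix (Fin n) (Fin n) ℝ} {B : Matrix (Fin n) (Fin m) ℝ}
  {C : Matrix (Fin m) (Fin n) ℝ} {D : Matrix (Fin m) (Fin m) ℝ} {P : Matrix (Fin n) (Fin n) ℝ}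

theorem hatInv_bounded (h : InnerRealization A B C D P) :
    ∃ c, ∀ (k : ℕ) i j, |(hatInv A P ^ k) i j| ≤ c := by
  have h1 : ∀ i j, ∃ c, ∀ k : ℕ, |(hatInv A P ^ k) i j| ≤ c := fun i j => by
    have := summable_mul_mul_pow h.pow.transpose P⁻¹ P i j
    refine ⟨∑' k, |(P⁻¹ * Aᵀ ^ k * P) i j|, fun k => ?_⟩
    rw [h.hatInv_pow]
    exact this.le_tsum k fun _ _ => abs_nonneg _
  choose c hc using h1
  refine ⟨∑ i, ∑ j, |c i j|, fun k i j => (hc i j k).trans ((le_abs_self _).trans ?_)⟩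
  exact (Finset.single_le_sum (f := fun j => |c i j|) (fun _ _ => abs_nonneg _)
    (Finset.mem_univ j)).trans (Finset.single_le_sum (f := fun i => ∑ j, |c i j|)
      (fun _ _ => Finset.sum_nonneg fun _ _ => abs_nonneg _) (Finset.mem_univ i))

/-- Each (C Aᵏ)ᵀ is replaced by -P Â⁻⁽ᵏ⁺¹⁾ B D⁻¹, and the resulting power series in Â⁻¹ sums to
w(Â). This is how W_j(Â) enters b_j. -/
theorem ell_smul_single (h : InnerRealization A B C D P) {w : RatFunc ℝ} (hw : IsRHInf w)
    (j : Fin m) : ell A C (Pi.single j w) =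
      -((P * hatInv A P * evalMat w (Ahat A B C D) * (B * D⁻¹)) *ᵥ Pi.single j 1) := by
  obtain ⟨c, hc⟩ := h.hatInv_bounded
  have h1 := hasSum_evalMat h.hatInv_mul_Ahat hc hw
  have h2 := hasSum_mul_right (B * D⁻¹) (hasSum_mul_left (P * hatInv A P) h1)
  have h3 : HasSum (fun k : ℕ => (P * hatInv A P * (impulseResponse w k • hatInv A P ^ k) *
      (B * D⁻¹)) *ᵥ Pi.single j 1) _ := hasSum_mulVec_const (Pi.single j (1 : ℝ)) h2
  rw [ell, ← h3.neg.tsum_eq]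
  congr 1
  funext k
  have h4 : coefV (Pi.single j w) k = impulseResponse w k • Pi.single j (1 : ℝ) := by
    funext i
    rw [coefV, Pi.smul_apply]
    by_cases hi : i = j
    · subst hi; simp
    · simp [hi]
  have h5 : P * hatInv A P * (impulseResponse w k • hatInv A P ^ k) * (B * D⁻¹) =
      -(impulseResponse w k • (C * A ^ k)ᵀ) := by
    rw [Matrix.mul_smul, Matrix.smul_mul, Matrix.mul_assoc P, ← pow_succ', Matrix.mul_assoc P,
      h.hatInv_pow_succ_mul, Matrix.mul_neg, ← Matrix.mul_assoc,
      Matrix.mul_nonsing_inv _ h.isUnit_det, Matrix.one_mul, smul_neg]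
  rw [h4, h5, Matrix.mulVec_smul, Matrix.neg_mulVec, neg_neg, Matrix.smul_mulVec]

theorem ell_X_inv_pow_smul (h : InnerRealization A B C D P) {g : Fin m → RatFunc ℝ}
    (hg : ∀ i, IsRHInf (g i)) (t : ℕ) :
    ell A C ((RatFunc.X : RatFunc ℝ)⁻¹ ^ t • g) = Aᵀ ^ t *ᵥ ell A C g := by
  have hg' : ∀ i, IsRHInf (((RatFunc.X : RatFunc ℝ)⁻¹ ^ t • g) i) := fun i =>
    isRHInf_X_inv_pow_mul (hg i) t
  have h1 := (h.summable_transpose_mulVec hg').sum_add_tsum_nat_add t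
  rw [Finset.sum_eq_zero fun k hk => by
    rw [coefV_X_inv_pow_smul_of_lt (fun i => (hg i).1) (Finset.mem_range.1 hk),
      Matrix.mulVec_zero], zero_add] at h1
  rw [ell, ← h1, ← (hasSum_mulVec (Aᵀ ^ t) (h.hasSum_ell hg)).tsum_eq]
  congr 1
  funext k
  rw [coefV_X_inv_pow_smul fun i => (hg i).1, Matrix.mulVec_mulVec, ← Matrix.transpose_pow,
    ← Matrix.transpose_mul, Matrix.mul_assoc, ← pow_add]

/-- The pairing annihilates the range of the inner factor, so only W_j e_j is left on the right. On
the left the delay acts as (Aᵀ)^τ, which is conjugate to Â^{-τ} and can be undone. -/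
theorem ell_eq_of_interpolation (h : InnerRealization A B C D P) {W : Fin m → RatFunc ℝ}
    {τ : Fin m → ℕ} {j : Fin m} (hτ : 1 ≤ τ j) (hW : IsRHInf (W j)) {g p : Fin m → RatFunc ℝ}
    (hg : ∀ i, IsRHInf (g i)) (hp : ∀ i, IsRHInf (p i))
    (hgp : (RatFunc.X : RatFunc ℝ)⁻¹ ^ τ j • g = Pi.single j (W j) + tf A B C D *ᵥ p) :
    ell A C g = -(P *ᵥ bVec A B C D W τ j) := by
  have hs : ∀ i, IsRHInf ((Pi.single j (W j) : Fin m → RatFunc ℝ) i) := fun i => by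
    by_cases hi : i = j
    · subst hi; simpa using hW
    · simpa [hi] using isRHInf_C 0
  have h1 := congrArg (ell A C) hgp
  rw [h.ell_X_inv_pow_smul hg, h.ell_add hs (isRHInf_mulVec (h.pow.isRHInf_tf B C D) hp),
    h.ell_tf_mulVec hp, add_zero, h.ell_smul_single hW] at h1
  have h2 : ∀ x, P⁻¹ *ᵥ (Aᵀ ^ τ j *ᵥ x) = hatInv A P ^ τ j *ᵥ (P⁻¹ *ᵥ x) := fun x => by
    rw [h.hatInv_pow, Matrix.mulVec_mulVec, Matrix.mulVec_mulVec, Matrix.mul_assoc _ P,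
      Matrix.mul_nonsing_inv _ h.isUnit_det, Matrix.mul_one]
  have hpow : ∀ k : ℕ, Ahat A B C D ^ k * hatInv A P ^ k = 1 := fun k => by
    rw [← (Commute.mul_pow (h.Ahat_mul_hatInv.trans h.hatInv_mul_Ahat.symm)), h.Ahat_mul_hatInv,
      one_pow]
  have h3 := congrArg (fun x => Ahat A B C D ^ τ j *ᵥ (P⁻¹ *ᵥ x)) h1
  beta_reduce at h3
  rw [h2, Matrix.mulVec_mulVec, hpow, Matrix.one_mulVec] at h3
  have h4 := congrArg (fun x => P *ᵥ x) h3
  beta_reduce at h4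
  rw [Matrix.mulVec_mulVec, Matrix.mul_nonsing_inv _ h.isUnit_det, Matrix.one_mulVec] at h4
  rw [h4, Matrix.mulVec_neg, Matrix.mulVec_neg, Matrix.mulVec_neg, bVec]
  simp only [Matrix.mulVec_mulVec]
  congr 2
  -- One factor Â cancels against the Â⁻¹ in the value of ℓ at W_j e_j, which leaves the exponent
  -- τ_j - 1.
  obtain ⟨t, ht⟩ : ∃ t, τ j = t + 1 := ⟨τ j - 1, by omega⟩
  rw [ht, Nat.add_sub_cancel, pow_succ]
  calc _ = P * (Ahat A B C D ^ t * (Ahat A B C D * (P⁻¹ * P * hatInv A P)) *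
        evalMat (W j) (Ahat A B C D) * B * D⁻¹) := by simp only [Matrix.mul_assoc]
    _ = _ := by
      rw [Matrix.nonsing_inv_mul _ h.isUnit_det, Matrix.one_mul, h.Ahat_mul_hatInv,
        Matrix.mul_one]

theorem hasSum_weighted (h : InnerRealization A B C D P) (γ : Fin m → ℝ) (η : Fin n → ℝ) :
    HasSum (fun k : ℕ => ∑ i, γ i * ((C * A ^ k) *ᵥ η) i ^ 2)
      (η ⬝ᵥ gram A (Cᵀ * Matrix.diagonal γ * C) *ᵥ η) := by
  have h1 := hasSum_mulVec_const η (h.pow.hasSum_gram (Cᵀ * Matrix.diagonal γ * C))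
  refine (hasSum_dotProduct η h1).congr_fun fun k => ?_
  have e : Aᵀ ^ k * (Cᵀ * Matrix.diagonal γ * C) * A ^ k =
      (C * A ^ k)ᵀ * (Matrix.diagonal γ * (C * A ^ k)) := by
    rw [Matrix.transpose_mul, Matrix.transpose_pow]; simp only [Matrix.mul_assoc]
  rw [e, ← Matrix.mulVec_mulVec η (C * A ^ k)ᵀ, Matrix.dotProduct_mulVec η,
    Matrix.vecMul_transpose, ← Matrix.mulVec_mulVec η (Matrix.diagonal γ), dotProduct]
  refine Finset.sum_congr rfl fun i _ => ?_
  rw [Matrix.mulVec_diagonal]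
  ring

/-- The vector η = P⁻¹Y⁻¹b is the Lagrange multiplier of the problem of least norm under ℓ(g) = -P
b. -/
theorem exists_gram_mulVec_eq (h : InnerRealization A B C D P) {γ : Fin m → ℝ}
    (hγ : ∀ i, 0 < γ i) (b : Fin n → ℝ) :
    ∃ η : Fin n → ℝ, gram A (Cᵀ * Matrix.diagonal γ * C) *ᵥ η = P *ᵥ b ∧
      η ⬝ᵥ P *ᵥ b = b ⬝ᵥ (lyapSol A C P (Matrix.diagonal γ))⁻¹ *ᵥ b := by
  have hY : IsUnit (lyapSol A C P (Matrix.diagonal γ)).det :=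
    (Matrix.isUnit_iff_isUnit_det _).1 (h.lyapSol_posDef hγ).isUnit
  set Y := lyapSol A C P (Matrix.diagonal γ) with hYd
  have hG : gram A (Cᵀ * Matrix.diagonal γ * C) = P * Y * P := by
    rw [hYd, lyapSol]
    calc _ = 1 * gram A (Cᵀ * Matrix.diagonal γ * C) * 1 := by rw [Matrix.one_mul, Matrix.mul_one]
      _ = (P * P⁻¹) * gram A (Cᵀ * Matrix.diagonal γ * C) * (P⁻¹ * P) := by
        rw [Matrix.mul_nonsing_inv _ h.isUnit_det, Matrix.nonsing_inv_mul _ h.isUnit_det]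
      _ = _ := by simp only [Matrix.mul_assoc]
  refine ⟨(P⁻¹ * Y⁻¹) *ᵥ b, ?_, ?_⟩
  · rw [hG, Matrix.mulVec_mulVec]
    congr 1
    calc _ = P * Y * (P * P⁻¹) * Y⁻¹ := by simp only [Matrix.mul_assoc]
      _ = _ := by
        rw [Matrix.mul_nonsing_inv _ h.isUnit_det, Matrix.mul_one, Matrix.mul_assoc,
          Matrix.mul_nonsing_inv _ hY, Matrix.mul_one]
  · rw [Matrix.dotProduct_mulVec, ← Matrix.mulVec_transpose, h.transpose_eq,
      Matrix.mulVec_mulVec, ← Matrix.mul_assoc, Matrix.mul_nonsing_inv _ h.isUnit_det,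
      Matrix.one_mul, dotProduct_comm]

theorem hasSum_weighted_h2NormSq {g : Fin m → RatFunc ℝ} (hg : ∀ i, IsRHInf (g i))
    (γ : Fin m → ℝ) :
    HasSum (fun k : ℕ => ∑ i, γ i * coefV g k i ^ 2) (∑ i, γ i * h2NormSq (g i)) := by
  refine hasSum_sum fun i _ => ?_
  rw [h2NormSq_eq_tsum (hg i)]
  exact (summable_sq_impulseResponse (hg i)).hasSum.mul_left (γ i)

/-- Weak duality. The nonnegative sum of γ_i (g_{k,i} + γ_i⁻¹ (C Aᵏ η)_i)² over k and i expands to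
the cost plus 2 η·ℓ(g) plus the Gramian form at η. With the multiplier η the last two terms are -2q
and q, where q = bᵀY⁻¹b. -/
theorem quad_le_of_ell_eq (h : InnerRealization A B C D P) {γ : Fin m → ℝ} (hγ : ∀ i, 0 < γ i)
    {g : Fin m → RatFunc ℝ} (hg : ∀ i, IsRHInf (g i)) {b : Fin n → ℝ}
    (hb : ell A C g = -(P *ᵥ b)) :
    b ⬝ᵥ (lyapSol A C P (Matrix.diagonal fun i => (γ i)⁻¹))⁻¹ *ᵥ b ≤ ∑ i, γ i * h2NormSq (g i) := by
  obtain ⟨η, h1, h2⟩ := h.exists_gram_mulVec_eq (fun i => inv_pos.2 (hγ i)) b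
  have s1 := hasSum_weighted_h2NormSq hg γ
  have s2 := hasSum_dotProduct η (h.hasSum_ell hg)
  have s3 := h.hasSum_weighted (fun i => (γ i)⁻¹) η
  rw [hb, dotProduct_neg, h2] at s2
  rw [h1, h2] at s3
  have s4 := (s1.add (s2.mul_left 2)).add s3
  have h0 := s4.nonneg fun k => ?_
  · linarith
  · rw [Matrix.dotProduct_mulVec η, Matrix.vecMul_transpose, dotProduct, Finset.mul_sum,
      ← Finset.sum_add_distrib, ← Finset.sum_add_distrib]
    refine Finset.sum_nonneg fun i _ => ?_
    have hi := hγ i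
    set x := coefV g k i
    set y := ((C * A ^ k) *ᵥ η) i
    have : γ i * x ^ 2 + 2 * (y * x) + (γ i)⁻¹ * y ^ 2 = γ i * (x + (γ i)⁻¹ * y) ^ 2 := by
      field_simp
      ring
    rw [this]
    positivity

/-- Equality in the completed square forces g_k = -Γ⁻¹ C Aᵏ η, a free response of the stable system,
hence rational and in RH∞. -/
theorem exists_ell_eq_and_quad_eq (h : InnerRealization A B C D P) {γ : Fin m → ℝ}
    (hγ : ∀ i, 0 < γ i) (b : Fin n → ℝ) :
    ∃ g : Fin m → RatFunc ℝ, (∀ i, IsRHInf (g i)) ∧ ell A C g = -(P *ᵥ b) ∧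
      ∑ i, γ i * h2NormSq (g i) =
        b ⬝ᵥ (lyapSol A C P (Matrix.diagonal fun i => (γ i)⁻¹))⁻¹ *ᵥ b := by
  obtain ⟨η, h1, h2⟩ := h.exists_gram_mulVec_eq (fun i => inv_pos.2 (hγ i)) b
  obtain ⟨g, hg, hc⟩ := h.pow.exists_coefV_eq (-(Matrix.diagonal (fun i => (γ i)⁻¹) * C)) η
  have hc' : ∀ k i, coefV g k i = -((γ i)⁻¹ * ((C * A ^ k) *ᵥ η) i) := fun k i => by
    rw [hc, Matrix.neg_mul, Matrix.neg_mulVec, Pi.neg_apply, Matrix.mul_assoc,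
      ← Matrix.mulVec_mulVec, Matrix.mulVec_diagonal]
  refine ⟨g, hg, ?_, ?_⟩
  · have s := hasSum_mulVec_const η
      (h.pow.hasSum_gram (Cᵀ * Matrix.diagonal (fun i => (γ i)⁻¹) * C))
    rw [← h1, ← s.neg.tsum_eq, ell]
    congr 1
    funext k
    rw [hc, Matrix.neg_mul, Matrix.neg_mulVec, Matrix.mulVec_neg, Matrix.mulVec_mulVec,
      Matrix.transpose_mul, Matrix.transpose_pow]
    simp only [Matrix.mul_assoc]
  · have s := h.hasSum_weighted (fun i => (γ i)⁻¹) η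
    rw [h1, h2] at s
    refine (hasSum_weighted_h2NormSq hg γ).unique (s.congr_fun fun k => ?_)
    refine Finset.sum_congr rfl fun i _ => ?_
    rw [hc']
    have := (hγ i).ne'
    field_simp

end InnerRealization

end MSStab

end

noncomputable section

namespace MSStab

open Matrix

/-! ### The cost of a Youla parameter -/

theorem regularAt_det_and_evalC_det {m : ℕ} {T : TFMatrix m} {z : ℂ}
    (hT : ∀ i j, RegularAt z (T i j)) :
    RegularAt z T.det ∧ evalC T.det z = (evalMatC T z).det := by
  set T' : Matrix (Fin m) (Fin m) (regularRing z) := fun i j => ⟨T i j, hT i j⟩ with hT'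
  have h1 : T = (regularRing z).subtype.mapMatrix T' := by ext i j; rfl
  have h2 : T.det = (T'.det : regularRing z).1 := by
    rw [h1, ← RingHom.map_det]; rfl
  refine ⟨by rw [h2]; exact T'.det.2, ?_⟩
  have h3 : evalC T.det z = evalHom z T'.det := by rw [h2]; rfl
  rw [h3, RingHom.map_det]
  rfl

theorem isRHInf_det_and_adjugate {m : ℕ} {T : TFMatrix m} (hT : MatRHInf T) :
    IsRHInf T.det ∧ MatRHInf T.adjugate := by
  set T' : Matrix (Fin m) (Fin m) rhInfRing := fun i j => ⟨T i j, hT i j⟩ with hT'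
  have h1 : T = rhInfRing.subtype.mapMatrix T' := by ext i j; rfl
  have h2 : T.det = (T'.det : rhInfRing).1 := by
    rw [h1, ← RingHom.map_det]; rfl
  refine ⟨by rw [h2]; exact T'.det.2, fun i j => ?_⟩
  have h3 : T.adjugate = rhInfRing.subtype.mapMatrix T'.adjugate := by
    rw [h1, RingHom.map_adjugate]
  rw [h3]
  exact (T'.adjugate i j).2

theorem MatRHInf.mul {m : ℕ} {S T : TFMatrix m} (hS : MatRHInf S) (hT : MatRHInf T) :
    MatRHInf (S * T) := fun i j => by
  rw [Matrix.mul_apply]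
  exact rhInfRing.sum_mem fun l _ => (hS i l).mul (hT l j)

theorem MatRHInf.add {m : ℕ} {S T : TFMatrix m} (hS : MatRHInf S) (hT : MatRHInf T) :
    MatRHInf (S + T) := fun i j => (hS i j).add (hT i j)

theorem MatRHInf.neg {m : ℕ} {S : TFMatrix m} (hS : MatRHInf S) :
    MatRHInf (-S) := fun i j => (hS i j).neg

theorem MatRHInf.sub {m : ℕ} {S T : TFMatrix m} (hS : MatRHInf S) (hT : MatRHInf T) :
    MatRHInf (S - T) := by rw [sub_eq_add_neg]; exact hS.add hT.neg

theorem MatRHInf.one {m : ℕ} : MatRHInf (1 : TFMatrix m) := fun i j => by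
  rw [Matrix.one_apply]
  split_ifs
  · exact rhInfRing.one_mem
  · exact rhInfRing.zero_mem

theorem MatRHInf.zero {m : ℕ} : MatRHInf (0 : TFMatrix m) := fun _ _ => rhInfRing.zero_mem

theorem MatRHInf.diagonal {m : ℕ} {d : Fin m → RatFunc ℝ} (hd : ∀ i, IsRHInf (d i)) :
    MatRHInf (Matrix.diagonal d) := fun i j => by
  rw [Matrix.diagonal_apply]
  split_ifs
  · exact hd i
  · exact rhInfRing.zero_mem

theorem MatRHInf.isProper {m : ℕ} {S : TFMatrix m} (hS : MatRHInf S) (i j) : IsProper (S i j) :=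
  (hS i j).1

/-- Young's inequality with a free parameter, so that a small perturbation r costs a factor of a
arbitrarily close to 1. -/
theorem h2NormSq_sub_le {a r : RatFunc ℝ} (ha : IsRHInf a) (hr : IsRHInf r) {ε : ℝ}
    (hε : 0 < ε) : h2NormSq (a - r) ≤ (1 + ε) * h2NormSq a + (1 + ε⁻¹) * h2NormSq r := by
  have har : IsRHInf (a - r) := rhInfRing.sub_mem ha hr
  rw [h2NormSq_eq_tsum ha, h2NormSq_eq_tsum hr, h2NormSq_eq_tsum har]
  refine hasSum_le (fun k => ?_) (summable_sq_impulseResponse har).hasSum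
    (((summable_sq_impulseResponse ha).hasSum.mul_left (1 + ε)).add
      ((summable_sq_impulseResponse hr).hasSum.mul_left (1 + ε⁻¹)))
  rw [impulseResponse_sub ha.1 hr.1]
  set x := impulseResponse a k
  set y := impulseResponse r k
  have : (1 + ε) * x ^ 2 + (1 + ε⁻¹) * y ^ 2 - (x - y) ^ 2 = ε * (x + ε⁻¹ * y) ^ 2 := by
    field_simp
    ring
  nlinarith [mul_nonneg hε.le (sq_nonneg (x + ε⁻¹ * y))]

theorem IsInner.h2NormSq_mulVec_le {m : ℕ} {M : TFMatrix m} (hM : IsInner M)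
    {v : Fin m → RatFunc ℝ} (hv : ∀ i, IsRHInf (v i)) (i : Fin m) :
    h2NormSq ((M *ᵥ v) i) ≤ ∑ l, h2NormSq (v l) := by
  have hcont : ∀ {f : RatFunc ℝ}, IsRHInf f → IntervalIntegrable
      (fun θ => ‖evalC f (circ θ)‖ ^ 2) volume (-Real.pi) Real.pi := fun hf =>
    ((continuous_evalC_circ hf).norm.pow 2).intervalIntegrable _ _
  have hdef : ∀ f, h2NormSq f = (2 * Real.pi)⁻¹ *
      ∫ θ in (-Real.pi)..Real.pi, ‖evalC f (circ θ)‖ ^ 2 := fun f => rfl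
  simp only [hdef]
  rw [← Finset.mul_sum, ← intervalIntegral.integral_finsetSum fun l _ => hcont (hv l)]
  refine mul_le_mul_of_nonneg_left ?_ (by positivity)
  refine intervalIntegral.integral_mono_on (by linarith [Real.pi_pos])
    (hcont (isRHInf_mulVec hM.1 hv i))
    ((continuous_finsetSum _ fun l _ =>
      (continuous_evalC_circ (hv l)).norm.pow 2).intervalIntegrable _ _) fun θ _ => ?_
  have hz : ‖circ θ‖ = 1 := norm_circ θ
  set z := circ θ with hzd
  change ‖evalC ((M *ᵥ v) i) z‖ ^ 2 ≤ ∑ l, ‖evalC (v l) z‖ ^ 2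
  set x : Fin m → ℂ := fun l => evalC (v l) z with hx
  have h1 : ∀ i, evalC ((M *ᵥ v) i) z = (evalMatC M z *ᵥ x) i := fun i => by
    rw [Matrix.mulVec, dotProduct, evalC_sum _ fun l =>
      ((hM.1 i l).regularAt hz.ge).mul ((hv l).regularAt hz.ge)]
    exact Finset.sum_congr rfl fun l _ =>
      evalC_mul ((hM.1 i l).regularAt hz.ge) ((hv l).regularAt hz.ge)
  have h2 : ∀ y : Fin m → ℂ, star y ⬝ᵥ y = ((∑ l, ‖y l‖ ^ 2 : ℝ) : ℂ) := fun y => by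
    rw [dotProduct, Complex.ofReal_sum]
    refine Finset.sum_congr rfl fun l _ => ?_
    rw [Pi.star_apply, mul_comm, Complex.star_def, Complex.mul_conj, Complex.normSq_eq_norm_sq]
  have h3 : star (evalMatC M z *ᵥ x) ⬝ᵥ (evalMatC M z *ᵥ x) = star x ⬝ᵥ x := by
    rw [Matrix.star_mulVec, ← Matrix.dotProduct_mulVec, Matrix.mulVec_mulVec, hM.2 z hz,
      Matrix.one_mulVec]
  rw [h2, h2] at h3
  have h4 : ∑ l, ‖(evalMatC M z *ᵥ x) l‖ ^ 2 = ∑ l, ‖x l‖ ^ 2 := by exact_mod_cast h3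
  rw [h1, ← h4]
  exact Finset.single_le_sum (f := fun l => ‖(evalMatC M z *ᵥ x) l‖ ^ 2)
    (fun _ _ => by positivity) (Finset.mem_univ i)

/-- The data of the optimization over the Youla parameter, for a minimum-phase plant. -/
structure YoulaData {m n : ℕ} (U M Nt Vt Nout Nout' Mout : TFMatrix m)
    (A : Matrix (Fin n) (Fin n) ℝ) (B : Matrix (Fin n) (Fin m) ℝ) (C : Matrix (Fin m) (Fin n) ℝ)
    (D : Matrix (Fin m) (Fin m) ℝ) (P : Matrix (Fin n) (Fin n) ℝ)
    (W : Fin m → RatFunc ℝ) (τ : Fin m → ℕ) : Prop where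
  real : InnerRealization A B C D P
  inner : IsInner (tf A B C D)
  M_eq : M = tf A B C D * Mout
  outer : IsOuter Mout
  det_outer : impulseResponse Mout.det 0 ≠ 0
  bezout : M * Vt + U * Nt = 1
  Nt_eq : Nt = Nout * Matrix.diagonal fun i => (RatFunc.X : RatFunc ℝ)⁻¹ ^ τ i
  rh_U : MatRHInf U
  rh_Vt : MatRHInf Vt
  rh_Nout : MatRHInf Nout
  rh_Nout' : MatRHInf Nout'
  Nout_mul : Nout' * Nout = 1
  one_le : ∀ i, 1 ≤ τ i
  rh_W : ∀ i, IsRHInf (W i)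
  W_zero : ∀ i, impulseResponse (W i) 0 ≠ 0
  W_ne : ∀ i, ∀ z : ℂ, 1 < ‖z‖ → evalC (W i) z ≠ 0

/-! ### Optimization over the Youla parameter, column by column -/

namespace YoulaData

variable {m n : ℕ} {U M Nt Vt Nout Nout' Mout : TFMatrix m}
  {A : Matrix (Fin n) (Fin n) ℝ} {B : Matrix (Fin n) (Fin m) ℝ} {C : Matrix (Fin m) (Fin n) ℝ}
  {D : Matrix (Fin m) (Fin m) ℝ} {P : Matrix (Fin n) (Fin n) ℝ}
  {W : Fin m → RatFunc ℝ} {τ : Fin m → ℕ}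

theorem rh_M (h : YoulaData U M Nt Vt Nout Nout' Mout A B C D P W τ) : MatRHInf M := by
  rw [h.M_eq]; exact h.inner.1.mul h.outer.1

theorem rh_Nt (h : YoulaData U M Nt Vt Nout Nout' Mout A B C D P W τ) : MatRHInf Nt := by
  rw [h.Nt_eq]
  exact h.rh_Nout.mul (MatRHInf.diagonal fun i => rhInfRing.pow_mem isRHInf_X_inv _)

theorem isRHInf_column (h : YoulaData U M Nt Vt Nout Nout' Mout A B C D P W τ) {Q : TFMatrix m}
    (hQ : MatRHInf Q) (i j) : IsRHInf (((U + M * Q) * Nout) i j * W j) :=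
  (((h.rh_U.add (h.rh_M.mul hQ)).mul h.rh_Nout) i j).mul (h.rh_W j)

theorem X_inv_pow_smul_column (h : YoulaData U M Nt Vt Nout Nout' Mout A B C D P W τ)
    (Q : TFMatrix m) (i j) : ((U + M * Q) * Nt) i j * W j =
      (RatFunc.X : RatFunc ℝ)⁻¹ ^ τ j * (((U + M * Q) * Nout) i j * W j) := by
  rw [h.Nt_eq, ← Matrix.mul_assoc, Matrix.mul_diagonal]
  ring

theorem JMat_eq (h : YoulaData U M Nt Vt Nout Nout' Mout A B C D P W τ) {Q : TFMatrix m}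
    (hQ : MatRHInf Q) (i j) :
    JMat U M Nt W Q i j = h2NormSq (((U + M * Q) * Nout) i j * W j) := by
  rw [JMat, Matrix.of_apply, h.X_inv_pow_smul_column, h2NormSq_X_inv_pow_mul (h.isRHInf_column hQ i j)]

/-- By Bezout, (U + MQ)Ñ = 1 + M_in M_out (QÑ - Ṽ): modulo the range of the inner factor every
column equals W_j e_j. The value of ℓ is thus the same for all Q, and it is the only constraint that
survives in the closure. -/
theorem ell_column (h : YoulaData U M Nt Vt Nout Nout' Mout A B C D P W τ) {Q : TFMatrix m}
    (hQ : MatRHInf Q) (j : Fin m) :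
    InnerRealization.ell A C (fun i => ((U + M * Q) * Nout) i j * W j) =
      -(P *ᵥ bVec A B C D W τ j) := by
  have hR : MatRHInf (Mout * (Q * Nt - Vt)) := h.outer.1.mul ((hQ.mul h.rh_Nt).sub h.rh_Vt)
  refine h.real.ell_eq_of_interpolation (p := fun i => (Mout * (Q * Nt - Vt)) i j * W j)
    (h.one_le j) (h.rh_W j) (fun i => h.isRHInf_column hQ i j)
    (fun i => (hR i j).mul (h.rh_W j)) ?_
  funext i
  have h1 : (U + M * Q) * Nt = 1 + tf A B C D * (Mout * (Q * Nt - Vt)) := by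
    rw [← Matrix.mul_assoc, ← h.M_eq, Matrix.mul_sub, Matrix.add_mul, ← h.bezout,
      ← Matrix.mul_assoc]
    abel
  rw [Pi.smul_apply, smul_eq_mul, ← h.X_inv_pow_smul_column, h1, Matrix.add_apply, add_mul,
    Pi.add_apply]
  congr 1
  · by_cases hij : i = j
    · subst hij; simp
    · simp [hij]
  · rw [Matrix.mul_apply, Finset.sum_mul, Matrix.mulVec, dotProduct]
    exact Finset.sum_congr rfl fun l _ => mul_assoc _ _ _

theorem quad_le_JMat (h : YoulaData U M Nt Vt Nout Nout' Mout A B C D P W τ) {Q : TFMatrix m}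
    (hQ : MatRHInf Q) {γ : Fin m → ℝ} (hγ : ∀ i, 0 < γ i) (j : Fin m) :
    bVec A B C D W τ j ⬝ᵥ (InnerRealization.lyapSol A C P (Matrix.diagonal fun i => (γ i)⁻¹))⁻¹ *ᵥ
      bVec A B C D W τ j ≤ ∑ i, γ i * JMat U M Nt W Q i j := by
  simp_rw [h.JMat_eq hQ]
  exact h.real.quad_le_of_ell_eq hγ (fun i => h.isRHInf_column hQ i j) (h.ell_column hQ j)

/-- A target g with the right pairing differs from the column of Q = 0 by M_in p. With d =
det(M_out) W_j outer, p is approximated by d s, and q = adj(M_out) s gives M q W_j = M_in d s. The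
error M_in (p - d s) is no larger than p - d s, since M_in is isometric. -/
theorem exists_column_approx (h : YoulaData U M Nt Vt Nout Nout' Mout A B C D P W τ)
    {g : Fin m → RatFunc ℝ} (hg : ∀ i, IsRHInf (g i)) {j : Fin m}
    (hell : InnerRealization.ell A C g = -(P *ᵥ bVec A B C D W τ j)) {δ : ℝ} (hδ : 0 < δ) :
    ∃ q r : Fin m → RatFunc ℝ, (∀ i, IsRHInf (q i)) ∧ (∀ i, IsRHInf (r i)) ∧
      (∀ i, (U * Nout) i j * W j + (M *ᵥ q) i * W j = g i - r i) ∧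
      ∀ i, h2NormSq (r i) ≤ m * δ := by
  have hg0 : ∀ i, IsRHInf ((U * Nout) i j * W j) := fun i =>
    ((h.rh_U.mul h.rh_Nout) i j).mul (h.rh_W j)
  have hell0 := h.ell_column MatRHInf.zero j
  rw [Matrix.mul_zero, add_zero] at hell0
  obtain ⟨p, hp, hpe⟩ := h.real.exists_tf_mulVec_eq
    (f := g - fun i => (U * Nout) i j * W j) (fun i => rhInfRing.sub_mem (hg i) (hg0 i)) (by
      rw [h.real.ell_sub hg hg0, hell, hell0, sub_self])
  obtain ⟨hdet, hadj⟩ := isRHInf_det_and_adjugate h.outer.1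
  set d := Mout.det * W j with hd
  have hdR : IsRHInf d := hdet.mul (h.rh_W j)
  have hd0 : impulseResponse d 0 ≠ 0 := by
    rw [hd, impulseResponse_mul hdet.1 (h.rh_W j).1, Finset.Nat.antidiagonal_zero,
      Finset.sum_singleton]
    exact mul_ne_zero h.det_outer (h.W_zero j)
  have hdz : ∀ z : ℂ, 1 < ‖z‖ → evalC d z ≠ 0 := fun z hz => by
    obtain ⟨h1, h2⟩ := regularAt_det_and_evalC_det fun i j => (h.outer.1 i j).regularAt hz.le
    rw [hd, evalC_mul h1 ((h.rh_W j).regularAt hz.le), h2]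
    exact mul_ne_zero (h.outer.2 z hz) (h.W_ne j z hz)
  have hs : ∀ i, ∃ s, IsRHInf s ∧ h2NormSq (p i - d * s) < δ := fun i =>
    exists_h2NormSq_sub_mul_lt hdR hd0 hdz (hp i) hδ
  choose s hsR hsδ using hs
  have hδR : ∀ i, IsRHInf (p i - d * s i) := fun i =>
    rhInfRing.sub_mem (hp i) (hdR.mul (hsR i))
  refine ⟨Mout.adjugate *ᵥ s, tf A B C D *ᵥ fun i => p i - d * s i,
    isRHInf_mulVec hadj hsR, isRHInf_mulVec h.inner.1 hδR, fun i => ?_, fun i => ?_⟩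
  · have h1 : M *ᵥ (Mout.adjugate *ᵥ s) = Mout.det • (tf A B C D *ᵥ s) := by
      rw [h.M_eq, Matrix.mulVec_mulVec, Matrix.mul_assoc, Matrix.mul_adjugate, Matrix.mul_smul,
        Matrix.mul_one, Matrix.smul_mulVec]
    have h2 : (fun i => p i - d * s i) = p - d • s := rfl
    rw [h1, h2, Matrix.mulVec_sub, hpe, Matrix.mulVec_smul]
    simp only [Pi.sub_apply, Pi.smul_apply, smul_eq_mul, hd]
    ring
  · refine (h.inner.h2NormSq_mulVec_le hδR i).trans
      ((Finset.sum_le_sum fun l _ => (hsδ l).le).trans_eq ?_)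
    simp

theorem exists_column_sum_lt (h : YoulaData U M Nt Vt Nout Nout' Mout A B C D P W τ)
    {γ : Fin m → ℝ} (hγ : ∀ i, 0 < γ i) (j : Fin m) {e : ℝ} (he : 0 < e) :
    ∃ q : Fin m → RatFunc ℝ, (∀ i, IsRHInf (q i)) ∧
      ∑ i, γ i * h2NormSq ((U * Nout) i j * W j + (M *ᵥ q) i * W j) <
        bVec A B C D W τ j ⬝ᵥ
          (InnerRealization.lyapSol A C P (Matrix.diagonal fun i => (γ i)⁻¹))⁻¹ *ᵥ
            bVec A B C D W τ j + e := by
  obtain ⟨g, hg, hell, hq⟩ := h.real.exists_ell_eq_and_quad_eq hγ (bVec A B C D W τ j)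
  rw [← hq]
  set c := ∑ i, γ i * h2NormSq (g i) with hc
  have hc0 : 0 ≤ c := Finset.sum_nonneg fun i _ => mul_nonneg (hγ i).le (h2NormSq_nonneg _)
  set Γ := ∑ i, γ i with hΓ
  have hΓ0 : 0 ≤ Γ := Finset.sum_nonneg fun i _ => (hγ i).le
  -- The error e is halved: this ε pays for the factor 1 + ε on the optimal cost c, and the accuracy
  -- e / (2(b + 1)) below pays for the remainder. The +1 keeps the denominators positive.
  set ε := e / (2 * (c + 1)) with hε
  have hε0 : 0 < ε := by positivity
  set b := (1 + ε⁻¹) * Γ * m with hb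
  have hb0 : 0 ≤ b := by positivity
  obtain ⟨q, r, hqR, hrR, heq, hr⟩ := h.exists_column_approx hg hell
    (δ := e / (2 * (b + 1))) (by positivity)
  refine ⟨q, hqR, ?_⟩
  have h1 : ∑ i, γ i * h2NormSq ((U * Nout) i j * W j + (M *ᵥ q) i * W j) ≤
      (1 + ε) * c + b * (e / (2 * (b + 1))) := by
    calc _ ≤ ∑ i, γ i * ((1 + ε) * h2NormSq (g i) +
          (1 + ε⁻¹) * (m * (e / (2 * (b + 1))))) := by
          refine Finset.sum_le_sum fun i _ => mul_le_mul_of_nonneg_left ?_ (hγ i).le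
          rw [heq]
          refine (h2NormSq_sub_le (hg i) (hrR i) hε0).trans ?_
          gcongr
          exact hr i
      _ = _ := by
          rw [hc, hb, hΓ, Finset.mul_sum, Finset.mul_sum, Finset.sum_mul, Finset.sum_mul,
            ← Finset.sum_add_distrib]
          exact Finset.sum_congr rfl fun i _ => by ring
  have h2 : ε * c < e / 2 := by
    rw [hε, div_mul_eq_mul_div, div_lt_div_iff₀ (by positivity) (by norm_num)]
    nlinarith
  have h3 : b * (e / (2 * (b + 1))) < e / 2 := by
    rw [mul_div_assoc', div_lt_div_iff₀ (by positivity) (by norm_num)]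
    nlinarith
  linarith

/-- Right multiplication by the inverse of Nout makes Q Nout any prescribed RH∞ matrix, so
near-optimal columns chosen separately come from one Q. -/
theorem exists_JMat_lt (h : YoulaData U M Nt Vt Nout Nout' Mout A B C D P W τ)
    {γ : Fin m → ℝ} (hγ : ∀ i, 0 < γ i) {e : Fin m → ℝ} (he : ∀ j, 0 < e j) :
    ∃ Q : TFMatrix m, MatRHInf Q ∧ ∀ j, ∑ i, γ i * JMat U M Nt W Q i j <
      bVec A B C D W τ j ⬝ᵥ
        (InnerRealization.lyapSol A C P (Matrix.diagonal fun i => (γ i)⁻¹))⁻¹ *ᵥ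
          bVec A B C D W τ j + e j := by
  choose q hqR hq using fun j => h.exists_column_sum_lt hγ j (he j)
  have hQ' : MatRHInf (Matrix.of fun i j => q j i) := fun i j => hqR j i
  refine ⟨(Matrix.of fun i j => q j i) * Nout', hQ'.mul h.rh_Nout', fun j => ?_⟩
  simp_rw [h.JMat_eq (hQ'.mul h.rh_Nout')]
  convert hq j using 5 with i
  rw [← add_mul, Matrix.add_mul, Matrix.mul_assoc, Matrix.mul_assoc, h.Nout_mul, Matrix.mul_one]
  rfl

end YoulaData

end MSStab

end

noncomputable section

namespace MSStab

open Matrix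

/-! ### The spectral radius of a nonnegative matrix -/

section SpectralRadius

open scoped Matrix.Norms.Operator

variable {m : ℕ} {J : Matrix (Fin m) (Fin m) ℝ}

theorem spectralRadius_lt_top (T : Matrix (Fin m) (Fin m) ℂ) : spectralRadius ℂ T < ⊤ :=
  (spectrum.spectralRadius_le_pow_nnnorm_pow_one_div ℂ T 0).trans_lt (by
    simpa using ENNReal.mul_lt_top ENNReal.coe_lt_top ENNReal.coe_lt_top)

theorem specRad_nonneg : 0 ≤ specRad J := ENNReal.toReal_nonneg

theorem exists_mulVec_eq_of_mem_spectrum {T : Matrix (Fin m) (Fin m) ℂ} {z : ℂ}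
    (hz : z ∈ spectrum ℂ T) : ∃ v, v ≠ 0 ∧ T *ᵥ v = z • v := by
  rw [spectrum.mem_iff, Matrix.isUnit_iff_isUnit_det, isUnit_iff_ne_zero, not_not] at hz
  obtain ⟨v, hv, h⟩ := Matrix.exists_mulVec_eq_zero_iff.2 hz
  refine ⟨v, hv, ?_⟩
  rw [Matrix.sub_mulVec, sub_eq_zero, Algebra.algebraMap_eq_smul_one, Matrix.smul_mulVec,
    Matrix.one_mulVec] at h
  exact h.symm

/-- The entrywise modulus of an eigenvector, by the triangle inequality. Such a subinvariant vector
takes the place of a Perron eigenvector throughout. -/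
theorem norm_mul_norm_le_of_mem_spectrum (hJ : ∀ i j, 0 ≤ J i j) {z : ℂ}
    (hz : z ∈ spectrum ℂ (J.map (algebraMap ℝ ℂ))) :
    ∃ x : Fin m → ℝ, (∀ i, 0 ≤ x i) ∧ x ≠ 0 ∧ ∀ i, ‖z‖ * x i ≤ (J *ᵥ x) i := by
  obtain ⟨v, hv, h⟩ := exists_mulVec_eq_of_mem_spectrum hz
  refine ⟨fun i => ‖v i‖, fun i => norm_nonneg _, fun h0 => hv ?_, fun i => ?_⟩
  · funext i
    exact norm_eq_zero.1 (congrFun h0 i)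
  · rw [← norm_mul, ← smul_eq_mul, ← Pi.smul_apply, ← h, Matrix.mulVec, Matrix.mulVec, dotProduct,
      dotProduct]
    refine (norm_sum_le _ _).trans (Finset.sum_le_sum fun j _ => ?_)
    rw [norm_mul, Matrix.map_apply, Complex.coe_algebraMap, Complex.norm_real, Real.norm_eq_abs,
      abs_of_nonneg (hJ i j)]

theorem exists_le_mulVec_of_le_specRad (hm : 0 < m) (hJ : ∀ i j, 0 ≤ J i j) :
    ∃ x : Fin m → ℝ, (∀ i, 0 ≤ x i) ∧ x ≠ 0 ∧ ∀ i, specRad J * x i ≤ (J *ᵥ x) i := by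
  -- A nonempty index set makes the matrix algebra nontrivial, so the spectral radius is attained at
  -- a spectral value.
  have : Nonempty (Fin m) := ⟨⟨0, hm⟩⟩
  obtain ⟨z, hz, h⟩ := spectrum.exists_nnnorm_eq_spectralRadius (J.map (algebraMap ℝ ℂ))
  have h1 : specRad J = ‖z‖ := by
    rw [specRad, ← h]; simp
  rw [h1]
  exact norm_mul_norm_le_of_mem_spectrum hJ hz

/-- The positive row vector γ is paired with the subinvariant vector x: ρ γ·x ≤ γ·Jx ≤ r γ·x, and
γ·x > 0. -/
theorem specRad_le_of_sum_le (hm : 0 < m) (hJ : ∀ i j, 0 ≤ J i j) {γ : Fin m → ℝ}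
    (hγ : ∀ i, 0 < γ i) {r : ℝ} (h : ∀ j, ∑ i, γ i * J i j ≤ r * γ j) : specRad J ≤ r := by
  obtain ⟨x, hx0, hx, hle⟩ := exists_le_mulVec_of_le_specRad hm hJ
  have h1 : specRad J * ∑ i, γ i * x i ≤ r * ∑ i, γ i * x i := by
    calc specRad J * ∑ i, γ i * x i = ∑ i, γ i * (specRad J * x i) := by
          rw [Finset.mul_sum]; exact Finset.sum_congr rfl fun i _ => by ring
      _ ≤ ∑ i, γ i * ∑ j, J i j * x j :=
          Finset.sum_le_sum fun i _ => mul_le_mul_of_nonneg_left (hle i) (hγ i).le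
      _ = ∑ j, (∑ i, γ i * J i j) * x j := by
          simp_rw [Finset.mul_sum, Finset.sum_mul]
          rw [Finset.sum_comm]
          exact Finset.sum_congr rfl fun i _ => Finset.sum_congr rfl fun j _ => by ring
      _ ≤ ∑ j, (r * γ j) * x j :=
          Finset.sum_le_sum fun j _ => mul_le_mul_of_nonneg_right (h j) (hx0 j)
      _ = _ := by rw [Finset.mul_sum]; exact Finset.sum_congr rfl fun i _ => by ring
  refine le_of_mul_le_mul_right h1 ?_
  obtain ⟨i, hi⟩ := Function.ne_iff.1 hx
  exact Finset.sum_pos' (fun i _ => mul_nonneg (hγ i).le (hx0 i))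
    ⟨i, Finset.mem_univ i, mul_pos (hγ i) (lt_of_le_of_ne (hx0 i) (Ne.symm hi))⟩

theorem summable_pow_of_specRad_lt {r : ℝ} (h : specRad J < r) (i j) :
    Summable fun k : ℕ => (r ^ k)⁻¹ * (J ^ k) i j := by
  have hr : 0 < r := specRad_nonneg.trans_lt h
  -- By Gelfand's formula the powers are eventually below sᵏ, so the normalized powers decay like
  -- (s/r)ᵏ.
  obtain ⟨s, hs, hsr⟩ := exists_between h
  have hs0 : 0 ≤ s := specRad_nonneg.trans hs.le
  set T := J.map (algebraMap ℝ ℂ) with hT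
  have ht := spectrum.pow_nnnorm_pow_one_div_tendsto_nhds_spectralRadius T
  have hlt : spectralRadius ℂ T < ENNReal.ofReal s := by
    rw [ENNReal.lt_ofReal_iff_toReal_lt (spectralRadius_lt_top T).ne]
    exact hs
  have hev := (ht.eventually_lt_const hlt).and (Filter.eventually_gt_atTop 0)
  have hbd : ∀ᶠ k : ℕ in Filter.atTop, ‖(r ^ k)⁻¹ * (J ^ k) i j‖ ≤ (s / r) ^ k := by
    filter_upwards [hev] with k ⟨hk, hk0⟩
    have h1 : (‖T ^ k‖₊ : ENNReal) ≤ ENNReal.ofReal s ^ k := by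
      have h2 := ENNReal.rpow_le_rpow hk.le (Nat.cast_nonneg k)
      rwa [← ENNReal.rpow_mul, one_div, inv_mul_cancel₀ (by exact_mod_cast hk0.ne'),
        ENNReal.rpow_one, ENNReal.rpow_natCast] at h2
    have h3 : ‖T ^ k‖ ≤ s ^ k := by
      have h4 := ENNReal.toReal_mono (by finiteness) h1
      rwa [ENNReal.toReal_pow, ENNReal.toReal_ofReal hs0] at h4
    have h5 : ‖(T ^ k) i j‖ ≤ ‖T ^ k‖ := by
      have := Matrix.linfty_opNNNorm_def (T ^ k)
      have h6 : ‖(T ^ k) i j‖₊ ≤ ‖T ^ k‖₊ := by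
        rw [this]
        refine le_trans ?_ (Finset.le_sup (f := fun i => ∑ j, ‖(T ^ k) i j‖₊) (Finset.mem_univ i))
        exact Finset.single_le_sum (f := fun j => ‖(T ^ k) i j‖₊) (fun _ _ => zero_le)
          (Finset.mem_univ j)
      exact_mod_cast h6
    have h7 : (T ^ k) i j = (((J ^ k) i j : ℝ) : ℂ) := by
      have : T ^ k = (algebraMap ℝ ℂ).mapMatrix (J ^ k) := by rw [map_pow]; rfl
      rw [this]; rfl
    rw [h7, Complex.norm_real] at h5
    rw [norm_mul, norm_inv, norm_pow, Real.norm_of_nonneg hr.le, div_pow, div_eq_inv_mul]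
    exact mul_le_mul_of_nonneg_left (h5.trans h3) (by positivity)
  exact Summable.of_norm_bounded_eventually_nat (summable_geometric_of_lt_one (by positivity)
    ((div_lt_one hr).2 hsr)) hbd

theorem pow_apply_nonneg (hJ : ∀ i j, 0 ≤ J i j) (k : ℕ) (i j) : 0 ≤ (J ^ k) i j := by
  induction k generalizing i j with
  | zero => rw [pow_zero, Matrix.one_apply]; split_ifs <;> norm_num
  | succ k ih =>
    rw [pow_succ, Matrix.mul_apply]
    exact Finset.sum_nonneg fun l _ => mul_nonneg (ih i l) (hJ l j)

/-- The vector x = ∑ₖ r⁻ᵏ Jᵏ 1 satisfies r x = r 1 + J x, and its term k = 0 gives x ≥ 1. -/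
theorem exists_mulVec_lt_of_specRad_lt (hJ : ∀ i j, 0 ≤ J i j) {r : ℝ} (h : specRad J < r) :
    ∃ x : Fin m → ℝ, (∀ i, 0 < x i) ∧ ∀ i, ∑ j, J i j * x j < r * x i := by
  have hr : 0 < r := specRad_nonneg.trans_lt h
  have hs := fun i j => summable_pow_of_specRad_lt h i j
  have hs' : ∀ i, HasSum (fun k : ℕ => ∑ j, (r ^ k)⁻¹ * (J ^ k) i j)
      (∑ j, ∑' k : ℕ, (r ^ k)⁻¹ * (J ^ k) i j) := fun i => hasSum_sum fun j _ => (hs i j).hasSum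
  set x : Fin m → ℝ := fun i => ∑ j, ∑' k : ℕ, (r ^ k)⁻¹ * (J ^ k) i j with hx
  have h0 : ∀ i, ∑ j, ((r ^ 0)⁻¹ * (J ^ 0) i j) = 1 := fun i => by simp [Matrix.one_apply]
  have hrec : ∀ i, r * x i = r + ∑ l, J i l * x l := by
    intro i
    have h1 : HasSum (fun k : ℕ => ∑ l, J i l * ∑ j, (r ^ k)⁻¹ * (J ^ k) l j)
        (∑ l, J i l * x l) := hasSum_sum fun l _ => (hs' l).mul_left _
    have h2 : (fun k : ℕ => r * ∑ j, (r ^ (k + 1))⁻¹ * (J ^ (k + 1)) i j) =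
        fun k : ℕ => ∑ l, J i l * ∑ j, (r ^ k)⁻¹ * (J ^ k) l j := by
      funext k
      simp_rw [pow_succ' J, Matrix.mul_apply, Finset.mul_sum]
      rw [Finset.sum_comm]
      refine Finset.sum_congr rfl fun l _ => Finset.sum_congr rfl fun j _ => ?_
      rw [pow_succ]
      field_simp
    rw [← h2] at h1
    have h3 := HasSum.zero_add (f := fun k : ℕ => r * ∑ j, (r ^ k)⁻¹ * (J ^ k) i j) h1
    rw [h0, mul_one] at h3
    exact ((hs' i).mul_left r).unique h3
  refine ⟨x, fun i => ?_, fun i => ?_⟩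
  · have := (hs' i).summable.le_tsum 0 fun k _ => Finset.sum_nonneg fun j _ =>
      mul_nonneg (by positivity) (pow_apply_nonneg hJ k i j)
    rw [h0, (hs' i).tsum_eq] at this
    exact zero_lt_one.trans_le this
  · rw [hrec]; linarith

theorem specRad_transpose (J : Matrix (Fin m) (Fin m) ℝ) : specRad Jᵀ = specRad J := by
  have : spectrum ℂ (Jᵀ.map (algebraMap ℝ ℂ)) = spectrum ℂ (J.map (algebraMap ℝ ℂ)) := by
    ext z
    rw [spectrum.mem_iff, spectrum.mem_iff, Matrix.isUnit_iff_isUnit_det,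
      Matrix.isUnit_iff_isUnit_det, ← Matrix.det_transpose, Matrix.transpose_sub,
      Algebra.algebraMap_eq_smul_one, Matrix.transpose_smul, Matrix.transpose_one,
      Matrix.transpose_map, Matrix.transpose_transpose]
  rw [specRad, specRad, spectralRadius, spectralRadius, this]

theorem exists_sum_lt_of_specRad_lt (hJ : ∀ i j, 0 ≤ J i j) {r : ℝ} (h : specRad J < r) :
    ∃ γ : Fin m → ℝ, (∀ i, 0 < γ i) ∧ ∀ j, ∑ i, γ i * J i j < r * γ j := by
  rw [← specRad_transpose] at h
  obtain ⟨x, hx, hlt⟩ := exists_mulVec_lt_of_specRad_lt (fun i j => hJ j i) h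
  refine ⟨x, hx, fun j => (hlt j).trans_eq' (Finset.sum_congr rfl fun i _ => mul_comm _ _)⟩

end SpectralRadius

/-! ### The optimal value -/

/-- A Schur complement. Necessity comes from the test vector Y⁻¹b, sufficiency from a square
completed in the metric Y. -/
theorem posDef_sub_smul_vecMulVec_iff {n : ℕ} {Y : Matrix (Fin n) (Fin n) ℝ} (hY : Y.PosDef)
    (b : Fin n → ℝ) {c : ℝ} (hc : 0 < c) :
    (Y - c • Matrix.vecMulVec b b).PosDef ↔ b ⬝ᵥ Y⁻¹ *ᵥ b < c⁻¹ := by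
  have hYu : IsUnit Y.det := (Matrix.isUnit_iff_isUnit_det _).1 hY.isUnit
  have hYt : Yᵀ = Y := isHermitian_iff_transpose.1 hY.1
  have hquad : ∀ v, v ⬝ᵥ (Y - c • Matrix.vecMulVec b b) *ᵥ v = v ⬝ᵥ Y *ᵥ v - c * (b ⬝ᵥ v) ^ 2 := by
    intro v
    rw [Matrix.sub_mulVec, dotProduct_sub, Matrix.smul_mulVec, dotProduct_smul,
      Matrix.vecMulVec_mulVec, smul_eq_mul]
    simp only [op_smul_eq_smul, dotProduct_smul, smul_eq_mul, dotProduct_comm v b]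
    ring
  have hYX : Y *ᵥ (Y⁻¹ *ᵥ b) = b := by
    rw [Matrix.mulVec_mulVec, Matrix.mul_nonsing_inv _ hYu, Matrix.one_mulVec]
  set q := b ⬝ᵥ Y⁻¹ *ᵥ b with hq
  constructor
  · intro h
    by_cases hb : b = 0
    · rw [hq, hb, zero_dotProduct]; positivity
    · have hv : Y⁻¹ *ᵥ b ≠ 0 := fun h0 => hb (by rw [← hYX, h0, Matrix.mulVec_zero])
      have h1 := (Matrix.posDef_iff_dotProduct_mulVec.1 h).2 hv
      rw [star_trivial, hquad, hYX, dotProduct_comm _ b, ← hq] at h1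
      have hq0 : 0 ≤ q := (Matrix.posSemidef_iff_dotProduct_mulVec.1 hY.inv.posSemidef).2 b
      rw [← one_div, lt_div_iff₀ hc]
      by_contra! hle
      nlinarith [mul_nonneg hq0 (sub_nonneg.2 hle)]
  · intro h
    refine Matrix.posDef_iff_dotProduct_mulVec.2 ⟨?_, fun v hv => ?_⟩
    · rw [isHermitian_iff_transpose, Matrix.transpose_sub, hYt, Matrix.transpose_smul,
        Matrix.transpose_vecMulVec]
    · rw [star_trivial, hquad]
      have hpos := (Matrix.posDef_iff_dotProduct_mulVec.1 hY).2 hv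
      rw [star_trivial] at hpos
      set s := b ⬝ᵥ v with hs
      -- With s = b·v and q = b·Y⁻¹b, the Y-form at v - c s Y⁻¹b is v·Yv - 2cs² + c²s²q.
      -- Nonnegativity gives v·Yv - cs² ≥ cs²(1 - cq), which is positive when s ≠ 0.
      have h1 := (Matrix.posSemidef_iff_dotProduct_mulVec.1 hY.posSemidef).2
        (v - (c * s) • (Y⁻¹ *ᵥ b))
      have hcross : (Y⁻¹ *ᵥ b) ⬝ᵥ Y *ᵥ v = s := by
        rw [Matrix.dotProduct_mulVec, ← Matrix.mulVec_transpose, hYt, hYX]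
      rw [star_trivial, Matrix.mulVec_sub, Matrix.mulVec_smul, hYX, sub_dotProduct, dotProduct_sub,
        dotProduct_sub, smul_dotProduct, smul_dotProduct, dotProduct_smul, dotProduct_smul,
        hcross, dotProduct_comm v b, ← hs, dotProduct_comm _ b, ← hq] at h1
      simp only [smul_eq_mul] at h1
      by_cases hs0 : s = 0
      · rw [hs0]; simpa using hpos
      · have hs2 : 0 < s ^ 2 := by positivity
        have hcq : c * q < 1 := by
          rwa [← lt_inv_mul_iff₀ hc, mul_one]
        nlinarith [mul_pos hc hs2, mul_pos (mul_pos hc hs2) (sub_pos.2 hcq)]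

theorem JMat_nonneg {m : ℕ} (U M Nt : TFMatrix m) (W : Fin m → RatFunc ℝ) (Q : TFMatrix m)
    (i j) : 0 ≤ JMat U M Nt W Q i j := h2NormSq_nonneg _

theorem rhoMin_le {m : ℕ} {U M Nt : TFMatrix m} {W : Fin m → RatFunc ℝ} {Q : TFMatrix m}
    (hQ : MatRHInf Q) : rhoMin U M Nt W ≤ specRad (JMat U M Nt W Q) :=
  csInf_le ⟨0, by rintro _ ⟨Q, -, rfl⟩; exact specRad_nonneg⟩ ⟨Q, hQ, rfl⟩

theorem le_rhoMin {m : ℕ} {U M Nt : TFMatrix m} {W : Fin m → RatFunc ℝ} {r : ℝ}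
    (h : ∀ Q, MatRHInf Q → r ≤ specRad (JMat U M Nt W Q)) : r ≤ rhoMin U M Nt W :=
  le_csInf ⟨_, 0, MatRHInf.zero, rfl⟩ (by rintro _ ⟨Q, hQ, rfl⟩; exact h Q hQ)

theorem exists_specRad_lt {m : ℕ} {U M Nt : TFMatrix m} {W : Fin m → RatFunc ℝ} {r : ℝ}
    (h : rhoMin U M Nt W < r) : ∃ Q, MatRHInf Q ∧ specRad (JMat U M Nt W Q) < r := by
  by_contra! hle
  exact absurd h (not_lt.2 (le_rhoMin hle))

theorem InnerRealization.existsUnique_isDARESolution {m n : ℕ} {A : Matrix (Fin n) (Fin n) ℝ}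
    {B : Matrix (Fin n) (Fin m) ℝ} {C : Matrix (Fin m) (Fin n) ℝ} {D : Matrix (Fin m) (Fin m) ℝ}
    {P : Matrix (Fin n) (Fin n) ℝ} (h : InnerRealization A B C D P) {γ : Fin m → ℝ}
    (hγ : ∀ i, 0 < γ i) :
    ∃! X : Matrix (Fin n) (Fin n) ℝ, X.PosDef ∧ IsDARESolution A B C D (Matrix.diagonal γ) X := by
  have hY := h.lyapSol_posDef fun i => inv_pos.2 (hγ i)
  have hYu := (Matrix.isUnit_iff_isUnit_det _).1 hY.isUnit
  refine ⟨(lyapSol A C P (Matrix.diagonal fun i => (γ i)⁻¹))⁻¹, ⟨hY.inv,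
    (h.isDARESolution_iff hγ hY.inv).2 (Matrix.nonsing_inv_nonsing_inv _ hYu)⟩, ?_⟩
  rintro X ⟨hX, hX'⟩
  rw [← (h.isDARESolution_iff hγ hX).1 hX',
    Matrix.nonsing_inv_nonsing_inv _ ((Matrix.isUnit_iff_isUnit_det _).1 hX.isUnit)]

/-! ### The two characterizations of ρ_min -/

namespace YoulaData

variable {m n : ℕ} {U M Nt Vt Nout Nout' Mout : TFMatrix m}
  {A : Matrix (Fin n) (Fin n) ℝ} {B : Matrix (Fin n) (Fin m) ℝ} {C : Matrix (Fin m) (Fin n) ℝ}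
  {D : Matrix (Fin m) (Fin m) ℝ} {P : Matrix (Fin n) (Fin n) ℝ}
  {W : Fin m → RatFunc ℝ} {τ : Fin m → ℕ}

theorem mem_riccatiSet_iff (h : YoulaData U M Nt Vt Nout Nout' Mout A B C D P W τ) {r : ℝ} :
    r ∈ riccatiSet A B C D W τ ↔ ∃ γ : Fin m → ℝ, (∀ i, 0 < γ i) ∧ ∀ i,
      bVec A B C D W τ i ⬝ᵥ
        (InnerRealization.lyapSol A C P (Matrix.diagonal fun i => (γ i)⁻¹))⁻¹ *ᵥ
          bVec A B C D W τ i ≤ r * γ i := by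
  constructor
  · rintro ⟨γ, hγ, X, hX, hX', hle⟩
    refine ⟨γ, hγ, fun i => ?_⟩
    rw [← (h.real.isDARESolution_iff hγ hX).1 hX',
      Matrix.nonsing_inv_nonsing_inv _ ((Matrix.isUnit_iff_isUnit_det _).1 hX.isUnit)]
    exact hle i
  · rintro ⟨γ, hγ, hle⟩
    have hY := h.real.lyapSol_posDef fun i => inv_pos.2 (hγ i)
    have hYu := (Matrix.isUnit_iff_isUnit_det _).1 hY.isUnit
    exact ⟨γ, hγ, _, hY.inv, (h.real.isDARESolution_iff hγ hY.inv).2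
      (Matrix.nonsing_inv_nonsing_inv _ hYu), hle⟩

theorem mem_lmiSet_iff (h : YoulaData U M Nt Vt Nout Nout' Mout A B C D P W τ) {r : ℝ} :
    r ∈ lmiSet A B C D W τ (fun i => InnerRealization.lyapSol A C P
        (Matrix.diagonal (Pi.single i 1))) ↔ 0 < r ∧ ∃ γ : Fin m → ℝ, (∀ i, 0 < γ i) ∧ ∀ i,
      bVec A B C D W τ i ⬝ᵥ
        (InnerRealization.lyapSol A C P (Matrix.diagonal fun i => (γ i)⁻¹))⁻¹ *ᵥ
          bVec A B C D W τ i < r * γ i := by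
  have key : ∀ (γ : Fin m → ℝ), (∀ i, 0 < γ i) → 0 < r → ∀ i, (∑ j, γ j •
      InnerRealization.lyapSol A C P (Matrix.diagonal (Pi.single j 1)) - (γ i / r) •
      Matrix.vecMulVec (bVec A B C D W τ i) (bVec A B C D W τ i)).PosDef ↔
      bVec A B C D W τ i ⬝ᵥ (InnerRealization.lyapSol A C P (Matrix.diagonal γ))⁻¹ *ᵥ
          bVec A B C D W τ i < r * (γ i)⁻¹ := fun γ hγ hr i => by
    rw [h.real.lyapSol_sum, posDef_sub_smul_vecMulVec_iff (h.real.lyapSol_posDef hγ) _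
      (div_pos (hγ i) hr), inv_div, div_eq_mul_inv]
  constructor
  · rintro ⟨hr, γ, hγ, hpd⟩
    -- The multipliers of the matrix inequality are the reciprocals of the Riccati weights.
    refine ⟨hr, fun i => (γ i)⁻¹, fun i => inv_pos.2 (hγ i), fun i => ?_⟩
    simp_rw [inv_inv]
    exact (key γ hγ hr i).1 (hpd i)
  · rintro ⟨hr, γ, hγ, hlt⟩
    refine ⟨hr, fun i => (γ i)⁻¹, fun i => inv_pos.2 (hγ i), fun i =>
      (key _ (fun i => inv_pos.2 (hγ i)) hr i).2 ?_⟩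
    rw [inv_inv]
    exact hlt i

/-- The optimal columns are only approached, so the bound is obtained up to every ε > 0; the
tolerance ε γ_j in column j is what raises r to r + ε. -/
theorem rhoMin_le_of_mem (h : YoulaData U M Nt Vt Nout Nout' Mout A B C D P W τ) (hm : 0 < m)
    {r : ℝ} (hr : r ∈ riccatiSet A B C D W τ) : rhoMin U M Nt W ≤ r := by
  obtain ⟨γ, hγ, hle⟩ := h.mem_riccatiSet_iff.1 hr
  refine le_of_forall_pos_le_add fun ε hε => ?_
  obtain ⟨Q, hQ, hlt⟩ := h.exists_JMat_lt hγ (e := fun j => ε * γ j) fun j => mul_pos hε (hγ j)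
  refine (rhoMin_le hQ).trans (specRad_le_of_sum_le hm (JMat_nonneg U M Nt W Q) hγ fun j => ?_)
  rw [add_mul]
  exact ((hlt j).trans_le (add_le_add_left (hle j) _)).le

theorem exists_quad_lt (h : YoulaData U M Nt Vt Nout Nout' Mout A B C D P W τ) {r : ℝ}
    (hr : rhoMin U M Nt W < r) : ∃ γ : Fin m → ℝ, (∀ i, 0 < γ i) ∧ ∀ i,
      bVec A B C D W τ i ⬝ᵥ
        (InnerRealization.lyapSol A C P (Matrix.diagonal fun i => (γ i)⁻¹))⁻¹ *ᵥ
          bVec A B C D W τ i < r * γ i := by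
  obtain ⟨Q, hQ, hlt⟩ := exists_specRad_lt hr
  obtain ⟨γ, hγ, hsum⟩ := exists_sum_lt_of_specRad_lt (JMat_nonneg U M Nt W Q) hlt
  exact ⟨γ, hγ, fun j => (h.quad_le_JMat hQ hγ j).trans_lt (hsum j)⟩

theorem isGLB_riccatiSet (h : YoulaData U M Nt Vt Nout Nout' Mout A B C D P W τ) (hm : 0 < m) :
    IsGLB (riccatiSet A B C D W τ) (rhoMin U M Nt W) := by
  refine ⟨fun r hr => h.rhoMin_le_of_mem hm hr, fun l hl => ?_⟩
  refine le_of_forall_gt_imp_ge_of_dense fun r hr => hl (h.mem_riccatiSet_iff.2 ?_)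
  obtain ⟨γ, hγ, hlt⟩ := h.exists_quad_lt hr
  exact ⟨γ, hγ, fun i => (hlt i).le⟩

theorem isGLB_lmiSet (h : YoulaData U M Nt Vt Nout Nout' Mout A B C D P W τ) (hm : 0 < m) :
    IsGLB (lmiSet A B C D W τ fun i => InnerRealization.lyapSol A C P
        (Matrix.diagonal (Pi.single i 1))) (rhoMin U M Nt W) := by
  constructor
  · intro r hr
    obtain ⟨-, γ, hγ, hlt⟩ := h.mem_lmiSet_iff.1 hr
    exact h.rhoMin_le_of_mem hm (h.mem_riccatiSet_iff.2 ⟨γ, hγ, fun i => (hlt i).le⟩)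
  · intro l hl
    refine le_of_forall_gt_imp_ge_of_dense fun r hr => hl (h.mem_lmiSet_iff.2
      ⟨lt_of_le_of_lt (le_rhoMin fun Q _ => specRad_nonneg) hr, h.exists_quad_lt hr⟩)

end YoulaData

end MSStab

end

noncomputable section

namespace MSStab

open Matrix

/-! ### The parametrization of the stabilizing controllers -/

namespace IsDoublyCoprime

variable {m : ℕ} {L N M Nt Mt U V Ut Vt : TFMatrix m}

theorem identities (h : IsDoublyCoprime L N M Nt Mt U V Ut Vt) :
    Vt * M + Ut * N = 1 ∧ Mt * N = Nt * M ∧ Nt * U + Mt * V = 1 ∧ M * Vt + U * Nt = 1 := by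
  have h1 := h.bezout₁
  have h2 := h.bezout₂
  rw [Matrix.fromBlocks_multiply, ← Matrix.fromBlocks_one, Matrix.fromBlocks_inj] at h1 h2
  refine ⟨h1.1, ?_, ?_, ?_⟩
  · have := h1.2.2.1
    rw [Matrix.neg_mul, neg_add_eq_zero] at this
    exact this.symm
  · simpa using h1.2.2.2
  · simpa using h2.1

theorem N_eq (h : IsDoublyCoprime L N M Nt Mt U V Ut Vt) : N = L * M := by
  rw [h.right, Matrix.mul_assoc, Matrix.nonsing_inv_mul _ h.det_right.isUnit, Matrix.mul_one]

theorem Nt_eq (h : IsDoublyCoprime L N M Nt Mt U V Ut Vt) : Nt = Mt * L := by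
  rw [h.left, ← Matrix.mul_assoc, Matrix.mul_nonsing_inv _ h.det_left.isUnit, Matrix.one_mul]

theorem inv_M (h : IsDoublyCoprime L N M Nt Mt U V Ut Vt) : M⁻¹ = Vt + Ut * L := by
  refine Matrix.inv_eq_left_inv ?_
  rw [Matrix.add_mul, Matrix.mul_assoc, ← h.N_eq, h.identities.1]

theorem inv_Mt (h : IsDoublyCoprime L N M Nt Mt U V Ut Vt) : Mt⁻¹ = V + L * U := by
  refine Matrix.inv_eq_right_inv ?_
  rw [Matrix.mul_add, ← Matrix.mul_assoc, ← h.Nt_eq, add_comm, h.identities.2.2.1]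

/-- Since L vanishes at infinity, so do N and Ñ, and the Bezout identities taken there reduce to Ṽ M
= 1 and M̃ V = 1. -/
theorem coefM_zero (h : IsDoublyCoprime L N M Nt Mt U V Ut Vt)
    (hL : ∀ i j, IsProper (L i j)) (hL0 : coefM L 0 = 0) :
    (coefM M 0).det ≠ 0 ∧ (coefM V 0).det ≠ 0 ∧ coefM N 0 = 0 := by
  obtain ⟨hN, hM, hNt, hMt, hU, hV, hUt, hVt⟩ := h.rhInf
  obtain ⟨e1, -, e3, -⟩ := h.identities
  have hadd : ∀ {S T : TFMatrix m}, MatRHInf S → MatRHInf T →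
      coefM (S + T) 0 = coefM S 0 + coefM T 0 := fun hS hT => by
    ext i j
    exact impulseResponse_add (hS i j).1 (hT i j).1 0
  have hN0 : coefM N 0 = 0 := by
    rw [h.N_eq, coefM_zero_mul hL hM.isProper, hL0, Matrix.zero_mul]
  have hNt0 : coefM Nt 0 = 0 := by
    rw [h.Nt_eq, coefM_zero_mul hMt.isProper hL, hL0, Matrix.mul_zero]
  refine ⟨?_, ?_, hN0⟩
  · have := congrArg (fun T => coefM T 0) e1
    beta_reduce at this
    rw [hadd (hVt.mul hM) (hUt.mul hN), coefM_zero_mul hVt.isProper hM.isProper,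
      coefM_zero_mul hUt.isProper hN.isProper, hN0, Matrix.mul_zero, add_zero,
      coefM_one_zero] at this
    exact (Matrix.isUnit_det_of_left_inverse this).ne_zero
  · have := congrArg (fun T => coefM T 0) e3
    beta_reduce at this
    rw [hadd (hNt.mul hU) (hMt.mul hV), coefM_zero_mul hNt.isProper hU.isProper,
      coefM_zero_mul hMt.isProper hV.isProper, hNt0, Matrix.zero_mul, zero_add,
      coefM_one_zero] at this
    exact (Matrix.isUnit_det_of_left_inverse this).ne_zero

/-- Solving (U + MQ)Ñ = X L for Q, where X = K(1 + LK)⁻¹, gives Q = M⁻¹(X M̃⁻¹ - U). Here M⁻¹ = Ṽ +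
Ũ L and M̃⁻¹ = V + L U, so Q is a polynomial in the Bezout factors and the four stable closed-loop
maps. -/
theorem exists_param (h : IsDoublyCoprime L N M Nt Mt U V Ut Vt) {K : TFMatrix m}
    (hK : InternallyStabilizes L K) :
    ∃ Q, MatRHInf Q ∧ K * (1 + L * K)⁻¹ * L = (U + M * Q) * Nt := by
  obtain ⟨hN, hM, hNt, hMt, hU, hV, hUt, hVt⟩ := h.rhInf
  obtain ⟨-, hdet, hY, hX, hYL, hT⟩ := hK
  set Y := (1 + L * K)⁻¹ with hYd
  set X := K * Y with hXd
  have hLX : L * X = 1 - Y := by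
    rw [eq_sub_iff_add_eq, hXd, ← Matrix.mul_assoc]
    have := Matrix.mul_nonsing_inv _ hdet.isUnit
    rw [Matrix.add_mul, Matrix.one_mul, add_comm, ← hYd] at this
    exact this
  refine ⟨M⁻¹ * (X * Mt⁻¹ - U), ?_, ?_⟩
  · have e : M⁻¹ * (X * Mt⁻¹ - U) = Vt * X * V + Vt * (X * L) * U + Ut * (1 - Y) * V -
        Ut * (Y * L) * U - Vt * U := by
      have hLXL : L * (X * (L * U)) = L * U - Y * (L * U) := by
        rw [← Matrix.mul_assoc, hLX, Matrix.sub_mul, Matrix.one_mul]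
      have hLXV : L * (X * V) = V - Y * V := by
        rw [← Matrix.mul_assoc, hLX, Matrix.sub_mul, Matrix.one_mul]
      rw [h.inv_M, h.inv_Mt]
      simp only [Matrix.add_mul, Matrix.mul_add, Matrix.mul_sub, Matrix.sub_mul, Matrix.mul_one,
        Matrix.mul_assoc, hLXL, hLXV]
      abel
    rw [e]
    exact (((((hVt.mul hX).mul hV).add ((hVt.mul hT).mul hU)).add
      ((hUt.mul (MatRHInf.one.sub hY)).mul hV)).sub ((hUt.mul hYL).mul hU)).sub (hVt.mul hU)
  · rw [← Matrix.mul_assoc, Matrix.mul_nonsing_inv _ h.det_right.isUnit, Matrix.one_mul,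
      add_sub_cancel, Matrix.mul_assoc X, ← h.left]

/-- The controller is K = (U + MQ)(V - NQ)⁻¹. It is proper because N vanishes at infinity and V is
invertible there. Bezout gives 1 + LK = M̃⁻¹(V - NQ)⁻¹, so each closed-loop map is a product of
stable factors. -/
theorem exists_controller (h : IsDoublyCoprime L N M Nt Mt U V Ut Vt)
    (hL : ∀ i j, IsProper (L i j)) (hL0 : coefM L 0 = 0) {Q : TFMatrix m} (hQ : MatRHInf Q) :
    ∃ K, InternallyStabilizes L K ∧ K * (1 + L * K)⁻¹ * L = (U + M * Q) * Nt := by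
  obtain ⟨hN, hM, hNt, hMt, hU, hV, hUt, hVt⟩ := h.rhInf
  obtain ⟨-, hV0, hN0⟩ := h.coefM_zero hL hL0
  obtain ⟨-, e2, e3, -⟩ := h.identities
  set A₁ := U + M * Q with hA
  set B₁ := V - N * Q with hB
  have hAR : MatRHInf A₁ := hU.add (hM.mul hQ)
  have hBR : MatRHInf B₁ := hV.sub (hN.mul hQ)
  have hB0 : coefM B₁ 0 = coefM V 0 := by
    have : coefM B₁ 0 = coefM V 0 - coefM (N * Q) 0 := by
      ext i j
      exact impulseResponse_sub (hV i j).1 (hN.mul hQ i j).1 0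
    rw [this, coefM_zero_mul hN.isProper hQ.isProper, hN0, Matrix.zero_mul, sub_zero]
  obtain ⟨hBdet, hBinv⟩ := isProper_inv_apply hBR.isProper (by rw [hB0]; exact hV0)
  have hid : Mt * B₁ + Nt * A₁ = 1 := by
    rw [hA, hB, Matrix.mul_sub, Matrix.mul_add, ← Matrix.mul_assoc, ← Matrix.mul_assoc, e2, ← e3]
    abel
  clear_value A₁ B₁
  have hone : 1 + L * (A₁ * B₁⁻¹) = Mt⁻¹ * B₁⁻¹ := by
    have h1 : Mt⁻¹ * (Mt * B₁ + Nt * A₁) * B₁⁻¹ = Mt⁻¹ * B₁⁻¹ := by rw [hid, Matrix.mul_one]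
    rw [← h1, Matrix.mul_add, ← Matrix.mul_assoc Mt⁻¹, ← Matrix.mul_assoc Mt⁻¹,
      Matrix.nonsing_inv_mul _ h.det_left.isUnit, Matrix.one_mul, ← h.left, Matrix.add_mul,
      Matrix.mul_nonsing_inv _ hBdet.isUnit, Matrix.mul_assoc]
  have hinv : (1 + L * (A₁ * B₁⁻¹))⁻¹ = B₁ * Mt := by
    rw [hone]
    refine Matrix.inv_eq_right_inv ?_
    rw [Matrix.mul_assoc, ← Matrix.mul_assoc B₁⁻¹, Matrix.nonsing_inv_mul _ hBdet.isUnit,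
      Matrix.one_mul, Matrix.nonsing_inv_mul _ h.det_left.isUnit]
  have hKY : A₁ * B₁⁻¹ * (B₁ * Mt) = A₁ * Mt := by
    rw [Matrix.mul_assoc, ← Matrix.mul_assoc B₁⁻¹, Matrix.nonsing_inv_mul _ hBdet.isUnit,
      Matrix.one_mul]
  refine ⟨A₁ * B₁⁻¹, ⟨isProper_mul_apply hAR.isProper hBinv, ?_, ?_, ?_, ?_, ?_⟩, ?_⟩
  · rw [hone, Matrix.det_mul]
    exact mul_ne_zero (Matrix.isUnit_nonsing_inv_det _ h.det_left.isUnit).ne_zero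
      (Matrix.isUnit_nonsing_inv_det _ hBdet.isUnit).ne_zero
  · rw [hinv]; exact hBR.mul hMt
  · rw [hinv, hKY]; exact hAR.mul hMt
  · rw [hinv, Matrix.mul_assoc, ← h.Nt_eq]; exact hBR.mul hNt
  · rw [hinv, hKY, Matrix.mul_assoc, ← h.Nt_eq]; exact hAR.mul hNt
  · rw [hinv, hKY, Matrix.mul_assoc, ← h.Nt_eq]

end IsDoublyCoprime

/-! ### The mean channel and its frequency weight -/

namespace Channel

variable {m : ℕ} {Ch : Channel m} {φ : Fin m → ℝ[X]}

theorem inZInv_HPoly_ne_zero (hH : Ch.MeanMinPhase) (i : Fin m) : inZInv (Ch.HPoly i) ≠ 0 := by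
  intro h
  have h1 : (Ch.HPoly i).coeff 0 = 0 := by
    rw [← impulseResponse_inZInv, h]; simp
  refine hH i 0 (by simp) ?_
  rw [Polynomial.aeval_def, Polynomial.eval₂_at_zero, h1, map_zero]

theorem isRHInf_W (hH : Ch.MeanMinPhase) (i : Fin m) : IsRHInf (Ch.W φ i) :=
  (isRHInf_inv_inZInv (hH i)).mul (isRHInf_inZInv _)

theorem W_mul (hH : Ch.MeanMinPhase) (i : Fin m) :
    inZInv (Ch.HPoly i) * Ch.W φ i = inZInv (φ i) := by
  rw [W, ← mul_assoc, mul_inv_cancel₀ (inZInv_HPoly_ne_zero hH i), one_mul]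

theorem impulseResponse_W_zero_ne (hH : Ch.MeanMinPhase) (hφ : ∀ i, Ch.IsSpectralFactor i (φ i))
    (i : Fin m) : impulseResponse (Ch.W φ i) 0 ≠ 0 := by
  intro h
  have h1 := congrArg (fun f => impulseResponse f 0) (W_mul (φ := φ) hH i)
  beta_reduce at h1
  rw [impulseResponse_mul (isProper_inZInv _) (isRHInf_W hH i).1, Finset.Nat.antidiagonal_zero,
    Finset.sum_singleton, h, mul_zero, impulseResponse_inZInv] at h1
  refine (hφ i).2 0 (by simp) ?_
  rw [Polynomial.aeval_def, Polynomial.eval₂_at_zero, ← h1, map_zero]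

theorem evalC_W_ne (hH : Ch.MeanMinPhase) (hφ : ∀ i, Ch.IsSpectralFactor i (φ i))
    (i : Fin m) {z : ℂ} (hz : 1 < ‖z‖) : evalC (Ch.W φ i) z ≠ 0 := by
  intro h
  have hz0 : z ≠ 0 := fun h => by rw [h, norm_zero] at hz; linarith
  have h1 := congrArg (fun f => evalC f z) (W_mul (φ := φ) hH i)
  beta_reduce at h1
  rw [evalC_mul ((isRHInf_inZInv _).regularAt hz.le) ((isRHInf_W hH i).regularAt hz.le), h,
    mul_zero, evalC_inZInv _ hz0] at h1
  refine (hφ i).2 z⁻¹ ?_ h1.symm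
  rw [norm_inv]
  exact inv_lt_one_of_one_lt₀ hz

theorem isRHInf_H : MatRHInf Ch.H := MatRHInf.diagonal fun _ => isRHInf_inZInv _

theorem nominalG_mul (P K : TFMatrix m) (i j : Fin m) :
    (K * (1 + P * Ch.H * K)⁻¹ * (P * Ch.H)) i j =
      nominalG P Ch.H K i j * inZInv (Ch.HPoly j) := by
  rw [← Matrix.mul_assoc, H, Matrix.mul_diagonal]
  rfl

end Channel

theorem coefM_plant {m : ℕ} {Ch : Channel m} {P : TFMatrix m}
    (hP : ∀ i j, IsStrictlyProper (P i j)) :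
    (∀ i j, IsProper ((P * Ch.H) i j)) ∧ coefM P 0 = 0 ∧ coefM (P * Ch.H) 0 = 0 := by
  have hP' : ∀ i j, IsProper (P i j) := fun i j => (hP i j).isProper
  have h0 : coefM P 0 = 0 := by
    ext i j
    exact impulseResponse_zero_of_isStrictlyProper (hP i j)
  refine ⟨isProper_mul_apply hP' Channel.isRHInf_H.isProper, h0, ?_⟩
  rw [coefM_zero_mul hP' Channel.isRHInf_H.isProper, h0, Matrix.zero_mul]

/-- The nominal system is stable and strictly proper, and its weighted gains are the entries of
`J(Q)`. -/
theorem nominalG_properties {m : ℕ} {Ch : Channel m} (hH : Ch.MeanMinPhase) {φ : Fin m → ℝ[X]}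
    {P : TFMatrix m} (hP : ∀ i j, IsStrictlyProper (P i j)) {K U M Q Nt : TFMatrix m}
    (hK : InternallyStabilizes (P * Ch.H) K)
    (hT : K * (1 + P * Ch.H * K)⁻¹ * (P * Ch.H) = (U + M * Q) * Nt) :
    MatRHInf (nominalG P Ch.H K) ∧ (∀ i j, impulseResponse (nominalG P Ch.H K i j) 0 = 0) ∧
      ∀ i j, JMat U M Nt (Ch.W φ) Q i j =
        h2NormSq (nominalG P Ch.H K i j * inZInv (φ j)) := by
  refine ⟨fun i j => ?_, fun i j => ?_, fun i j => ?_⟩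
  -- The closed-loop map is G H; dividing by H_j keeps stability because H_j is minimum phase.
  · have h1 : nominalG P Ch.H K i j = (K * (1 + P * Ch.H * K)⁻¹ * (P * Ch.H)) i j *
        (inZInv (Ch.HPoly j))⁻¹ := by
      rw [Channel.nominalG_mul, mul_assoc, mul_inv_cancel₀ (Channel.inZInv_HPoly_ne_zero hH j),
        mul_one]
    rw [h1]
    exact (hK.2.2.2.2.2 i j).mul (isRHInf_inv_inZInv (hH j))
  · have h1 : coefM (nominalG P Ch.H K) 0 = 0 := by
      rw [nominalG, coefM_zero_mul hK.2.2.2.1.isProper fun i j => (hP i j).isProper,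
        (coefM_plant (Ch := Ch) hP).2.1, Matrix.mul_zero]
    exact congrFun (congrFun h1 i) j
  · rw [JMat, Matrix.of_apply, ← hT, Channel.nominalG_mul, mul_assoc, Channel.W_mul hH]

end MSStab

end

noncomputable section

namespace MSStab

open Matrix

/-! ### The response to a single packet -/

namespace Channel

variable {m : ℕ} (Ch : Channel m)

/-- The deviation of the channel from its mean when the delay is `x`, as a polynomial in
`z⁻¹`. -/
def devPoly (i : Fin m) (x : ℕ) : ℝ[X] :=
  ∑ s ∈ Finset.range (Ch.maxDelay i + 1),
    Polynomial.C (Ch.h i x s - Ch.mean i s) * Polynomial.X ^ s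

theorem coeff_devPoly (i : Fin m) (x s : ℕ) : (Ch.devPoly i x).coeff s =
    if s ∈ Finset.range (Ch.maxDelay i + 1) then Ch.h i x s - Ch.mean i s else 0 := by
  rw [devPoly, Polynomial.finsetSum_coeff]
  simp_rw [Polynomial.coeff_C_mul_X_pow]
  rw [Finset.sum_ite_eq]

/-- The response at output `i`, `t` steps after a packet sent through channel `j` with
delay `x`. -/
def kern (G : TFMatrix m) (i j : Fin m) (x t : ℕ) : ℝ :=
  impulseResponse (G i j * inZInv (Ch.devPoly j x)) t

variable {Ch}

theorem kern_eq {G : TFMatrix m} (hG : ∀ i j, IsProper (G i j)) (i j : Fin m) (x t : ℕ) :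
    Ch.kern G i j x t = ∑ s ∈ Finset.range (t + 1),
      impulseResponse (G i j) (t - s) * (Ch.devPoly j x).coeff s := by
  rw [kern, mul_comm, impulseResponse_mul (isProper_inZInv _) (hG i j),
    Finset.Nat.sum_antidiagonal_eq_sum_range_succ_mk]
  simp_rw [impulseResponse_inZInv]
  exact Finset.sum_congr rfl fun s _ => mul_comm _ _

theorem kern_zero {G : TFMatrix m} (hG : ∀ i j, IsProper (G i j))
    (hG0 : ∀ i j, impulseResponse (G i j) 0 = 0) (i j : Fin m) (x : ℕ) :
    Ch.kern G i j x 0 = 0 := by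
  rw [kern_eq hG]; simp [hG0]

theorem uncertaintyOutput_eq (i : Fin m) (x : ℕ → ℕ) (u : ℕ → ℝ) (l : ℕ) :
    Ch.uncertaintyOutput i x u l =
      ∑ n ∈ Finset.range (l + 1), (Ch.devPoly i (x n)).coeff (l - n) * u n := by
  have h1 : Ch.uncertaintyOutput i x u l =
      ∑ s ∈ Finset.range (l + 1), (Ch.devPoly i (x (l - s))).coeff s * u (l - s) := by
    rw [uncertaintyOutput]
    simp_rw [coeff_devPoly, ite_mul, zero_mul]
    rw [← Finset.sum_filter, ← Finset.sum_filter]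
    refine Finset.sum_congr ?_ fun _ _ => rfl
    ext s
    simp only [Finset.mem_filter, Finset.mem_range]
    omega
  rw [h1, ← Finset.sum_range_reflect]
  refine Finset.sum_congr rfl fun n hn => ?_
  have : n ≤ l := by simpa [Nat.lt_succ_iff] using hn
  rw [show l + 1 - 1 - n = l - n by omega, show l - (l - n) = n by omega]

/-- Interchanging the sums sorts the response by sending time instead of arrival time, so that each
random delay occurs in a single summand. -/
theorem sum_uncertaintyOutput {G : TFMatrix m} (hG : ∀ i j, IsProper (G i j)) (i j : Fin m)
    (x : ℕ → ℕ) (u : ℕ → ℝ) (k : ℕ) :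
    ∑ l ∈ Finset.range (k + 1), impulseResponse (G i j) (k - l) *
        Ch.uncertaintyOutput j x u l =
      ∑ n ∈ Finset.range (k + 1), Ch.kern G i j (x n) (k - n) * u n := by
  simp_rw [uncertaintyOutput_eq, kern_eq hG, Finset.mul_sum, Finset.sum_mul]
  rw [Finset.sum_comm' (t' := Finset.range (k + 1)) (s' := fun n => Finset.Ico n (k + 1)) (by
    intro l n
    simp only [Finset.mem_range, Finset.mem_Ico]
    omega)]
  refine Finset.sum_congr rfl fun n hn => ?_
  have hn' : n ≤ k := by simpa [Nat.lt_succ_iff] using hn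
  rw [Finset.sum_Ico_eq_sum_range, show k + 1 - n = k - n + 1 by omega]
  refine Finset.sum_congr rfl fun s _ => ?_
  rw [show k - (n + s) = k - n - s by omega, show n + s - n = s by omega, mul_assoc]

/-- The response of the nominal system to the noise. -/
def noiseResponse (G : TFMatrix m) (v : ℕ → Fin m → ℝ) (k : ℕ) (i : Fin m) : ℝ :=
  ∑ l ∈ Finset.range (k + 1), ∑ j, impulseResponse (G i j) (k - l) * v l j

/-- The packet sent at time k itself drops out because G has no direct feedthrough; this makes the
loop an explicit recursion. -/
theorem sum_loop_eq {G : TFMatrix m} (hG : ∀ i j, IsProper (G i j))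
    (hG0 : ∀ i j, impulseResponse (G i j) 0 = 0) (x : Fin m → ℕ → ℕ) (v u : ℕ → Fin m → ℝ)
    (k : ℕ) (i : Fin m) :
    ∑ l ∈ Finset.range (k + 1), ∑ j, impulseResponse (G i j) (k - l) *
        (v l j - Ch.uncertaintyOutput j (x j) (fun n => u n j) l) =
      noiseResponse G v k i -
        ∑ q ∈ Finset.univ ×ˢ Finset.range k, Ch.kern G i q.1 (x q.1 q.2) (k - q.2) * u q.2 q.1 := by
  simp_rw [mul_sub, Finset.sum_sub_distrib]
  congr 1
  rw [Finset.sum_comm, Finset.sum_product]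
  refine Finset.sum_congr rfl fun j _ => ?_
  rw [sum_uncertaintyOutput hG, Finset.sum_range_succ, Nat.sub_self, kern_zero hG hG0, zero_mul,
    add_zero]

/-! ### The energy of the response -/

theorem sum_p_mul_sub (i : Fin m) (s : ℕ) : ∑ x ∈ Finset.range (Ch.maxDelay i + 1),
    Ch.p i x * (Ch.h i x s - Ch.mean i s) = 0 := by
  simp_rw [mul_sub, Finset.sum_sub_distrib, ← Finset.sum_mul, Ch.p_sum, one_mul]
  rw [mean, sub_self]

theorem sum_p_mul_kern {G : TFMatrix m} (hG : ∀ i j, IsProper (G i j)) (i j : Fin m) (t : ℕ) :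
    ∑ x ∈ Finset.range (Ch.maxDelay j + 1), Ch.p j x * Ch.kern G i j x t = 0 := by
  simp_rw [kern_eq hG, Finset.mul_sum]
  rw [Finset.sum_comm]
  refine Finset.sum_eq_zero fun s _ => ?_
  simp_rw [coeff_devPoly]
  split_ifs
  · have := congrArg (fun y => impulseResponse (G i j) (t - s) * y) (sum_p_mul_sub (Ch := Ch) j s)
    simp only [Finset.mul_sum, mul_zero] at this
    rw [← this]
    exact Finset.sum_congr rfl fun x _ => by ring
  · simp

theorem abs_h_sub_mean_le (i : Fin m) (x s : ℕ) :
    |Ch.h i x s - Ch.mean i s| ≤ Ch.α i s + |Ch.mean i s| := by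
  refine (abs_sub _ _).trans (add_le_add_left ?_ _)
  rw [h]
  split_ifs
  · rw [abs_of_nonneg (Ch.α_nonneg i s)]
  · rw [abs_zero]; exact Ch.α_nonneg i s

theorem exists_abs_coeff_devPoly_le (i : Fin m) (s : ℕ) :
    ∃ c, 0 ≤ c ∧ ∀ x, |(Ch.devPoly i x).coeff s| ≤ c := by
  refine ⟨Ch.α i s + |Ch.mean i s|, add_nonneg (Ch.α_nonneg i s) (abs_nonneg _), fun x => ?_⟩
  rw [coeff_devPoly]
  split_ifs
  · exact abs_h_sub_mean_le i x s
  · rw [abs_zero]; exact add_nonneg (Ch.α_nonneg i s) (abs_nonneg _)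

theorem exists_abs_kern_le {G : TFMatrix m} (hG : ∀ i j, IsProper (G i j)) (i j : Fin m) (t : ℕ) :
    ∃ c, ∀ x, |Ch.kern G i j x t| ≤ c := by
  choose c _ hc using fun s => exists_abs_coeff_devPoly_le (Ch := Ch) j s
  refine ⟨∑ s ∈ Finset.range (t + 1), |impulseResponse (G i j) (t - s)| * c s, fun x => ?_⟩
  rw [kern_eq hG]
  refine (Finset.abs_sum_le_sum_abs _ _).trans (Finset.sum_le_sum fun s _ => ?_)
  rw [abs_mul]
  exact mul_le_mul_of_nonneg_left (hc s x) (abs_nonneg _)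

theorem evalC_inZInv_devPoly (i : Fin m) (x : ℕ) {z : ℂ} (hz : z ≠ 0) :
    evalC (inZInv (Ch.devPoly i x)) z = ∑ s ∈ Finset.range (Ch.maxDelay i + 1),
      ((Ch.h i x s - Ch.mean i s : ℝ) : ℂ) * z⁻¹ ^ s := by
  rw [evalC_inZInv _ hz, devPoly, map_sum]
  simp

theorem cov_comm (i : Fin m) (s t : ℕ) : Ch.cov i s t = Ch.cov i t s := by
  unfold cov
  exact Finset.sum_congr rfl fun x _ => by ring

theorem evalC_X_zpow {z : ℂ} (hz : z ≠ 0) (l : ℤ) :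
    RegularAt z ((RatFunc.X : RatFunc ℝ) ^ l) ∧ evalC ((RatFunc.X : RatFunc ℝ) ^ l) z = z ^ l := by
  cases l with
  | ofNat n =>
    rw [Int.ofNat_eq_natCast, zpow_natCast, zpow_natCast]
    exact ⟨(regularAt_X z).pow n, by rw [evalC_pow (regularAt_X z), evalC_X]⟩
  | negSucc n =>
    rw [zpow_negSucc, zpow_negSucc, ← inv_pow, ← inv_pow]
    exact ⟨(regularAt_X_inv hz).pow _, by rw [evalC_pow (regularAt_X_inv hz), evalC_X_inv hz]⟩

theorem evalC_S (i : Fin m) {z : ℂ} (hz : z ≠ 0) :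
    evalC (Ch.S i) z = ∑ s ∈ Finset.range (Ch.maxDelay i + 1),
      ∑ t ∈ Finset.range (Ch.maxDelay i + 1), (Ch.cov i s t : ℂ) * z ^ ((t : ℤ) - s) := by
  have hreg : ∀ l : ℤ, RegularAt z (RatFunc.C (Ch.r i l) * (RatFunc.X : RatFunc ℝ) ^ (-l)) :=
    fun l => (regularAt_C z _).mul (evalC_X_zpow hz _).1
  rw [S, evalC_sum _ hreg, ← Finset.sum_product']
  have h1 : ∀ l : ℤ, evalC (RatFunc.C (Ch.r i l) * (RatFunc.X : RatFunc ℝ) ^ (-l)) z =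
      ∑ j ∈ Finset.range (Ch.maxDelay i + 1 - l.natAbs),
        (Ch.cov i j (j + l.natAbs) : ℂ) * z ^ (-l) := fun l => by
    rw [evalC_mul (regularAt_C z _) (evalC_X_zpow hz _).1, evalC_C, (evalC_X_zpow hz _).2, r,
      Complex.ofReal_sum, Finset.sum_mul]
  simp_rw [h1]
  rw [Finset.sum_sigma']
  -- A pair of delays (s, t) corresponds to the lag l = s - t and the smaller delay j = min s t;
  -- negative lags use the symmetry of the covariance.
  refine Finset.sum_bij' (fun a _ => (a.2 + a.1.toNat, a.2 + (-a.1).toNat))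
    (fun b _ => ⟨(b.1 : ℤ) - b.2, min b.1 b.2⟩) ?_ ?_ ?_ ?_ ?_
  · rintro ⟨l, j⟩ h
    simp only [Finset.mem_sigma, Finset.mem_Icc, Finset.mem_range, Finset.mem_product] at h ⊢
    omega
  · rintro ⟨s, t⟩ h
    simp only [Finset.mem_sigma, Finset.mem_Icc, Finset.mem_range, Finset.mem_product] at h ⊢
    omega
  · rintro ⟨l, j⟩ h
    simp only [Sigma.mk.injEq, heq_eq_eq]
    omega
  · rintro ⟨s, t⟩ h
    simp only [Prod.mk.injEq]
    omega
  · rintro ⟨l, j⟩ h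
    simp only
    rcases le_total 0 l with hl | hl
    · rw [show (-l).toNat = 0 by omega, show l.natAbs = l.toNat by omega, add_zero, cov_comm]
      congr 2
      omega
    · rw [show l.toNat = 0 by omega, show l.natAbs = (-l).toNat by omega, add_zero]
      congr 2
      omega

theorem evalC_aeval_X (q : ℝ[X]) (z : ℂ) : RegularAt z (aeval (RatFunc.X : RatFunc ℝ) q) ∧
    evalC (aeval (RatFunc.X : RatFunc ℝ) q) z = aeval z q := by
  rw [RatFunc.aeval_X_left_eq_algebraMap]
  exact ⟨by simp [RegularAt], by rw [evalC, RatFunc.eval_algebraMap, Polynomial.aeval_def]; rfl⟩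

/-- On the unit circle z⁻¹ is the conjugate of z. There S_i(z) is the expected squared modulus of
the deviation from the mean channel, and the factorization makes it |Φ_i(z)|². -/
theorem sum_p_mul_norm_sq (i : Fin m) {φ : ℝ[X]} (hφ : Ch.IsSpectralFactor i φ) {z : ℂ}
    (hz : ‖z‖ = 1) : ∑ x ∈ Finset.range (Ch.maxDelay i + 1),
      Ch.p i x * ‖evalC (inZInv (Ch.devPoly i x)) z‖ ^ 2 = ‖evalC (inZInv φ) z‖ ^ 2 := by
  have hz0 : z ≠ 0 := fun h => by rw [h, norm_zero] at hz; exact zero_ne_one hz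
  have hconj : (starRingEnd ℂ) z = z⁻¹ := by
    rw [Complex.inv_def, Complex.normSq_eq_norm_sq, hz]; simp
  have hsq : ∀ w : ℂ, ((‖w‖ ^ 2 : ℝ) : ℂ) = w * (starRingEnd ℂ) w := fun w => by
    rw [Complex.mul_conj, Complex.normSq_eq_norm_sq]
  have h1 : evalC (Ch.S i) z = ((‖evalC (inZInv φ) z‖ ^ 2 : ℝ) : ℂ) := by
    have hX := evalC_aeval_X φ z
    rw [hφ.1, evalC_mul ((isRHInf_inZInv φ).regularAt hz.ge) hX.1, hX.2, hsq, evalC_inZInv _ hz0,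
      ← hconj, Polynomial.aeval_conj, Complex.conj_conj]
  have h2 : evalC (Ch.S i) z = ((∑ x ∈ Finset.range (Ch.maxDelay i + 1),
      Ch.p i x * ‖evalC (inZInv (Ch.devPoly i x)) z‖ ^ 2 : ℝ) : ℂ) := by
    rw [evalC_S i hz0, Complex.ofReal_sum]
    simp_rw [Complex.ofReal_mul, hsq, evalC_inZInv_devPoly i _ hz0, map_sum, map_mul, map_pow,
      map_inv₀, hconj, inv_inv, Complex.conj_ofReal, Finset.sum_mul_sum, cov, Finset.mul_sum,
      Complex.ofReal_sum, Finset.sum_mul]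
    symm
    rw [Finset.sum_comm]
    refine Finset.sum_congr rfl fun s _ => ?_
    rw [Finset.sum_comm]
    refine Finset.sum_congr rfl fun t _ => Finset.sum_congr rfl fun x _ => ?_
    rw [zpow_sub₀ hz0, zpow_natCast, zpow_natCast, Complex.ofReal_mul, Complex.ofReal_mul,
      div_eq_mul_inv, inv_pow]
    ring
  exact_mod_cast h2.symm.trans h1

theorem sum_p_mul_h2NormSq {f : RatFunc ℝ} (hf : IsRHInf f) (j : Fin m) {φ : ℝ[X]}
    (hφ : Ch.IsSpectralFactor j φ) : ∑ x ∈ Finset.range (Ch.maxDelay j + 1),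
      Ch.p j x * h2NormSq (f * inZInv (Ch.devPoly j x)) = h2NormSq (f * inZInv φ) := by
  have hdef : ∀ f, h2NormSq f = (2 * Real.pi)⁻¹ *
      ∫ θ in (-Real.pi)..Real.pi, ‖evalC f (circ θ)‖ ^ 2 := fun f => rfl
  have hcont : ∀ x, IntervalIntegrable (fun θ => Ch.p j x *
      ‖evalC (f * inZInv (Ch.devPoly j x)) (circ θ)‖ ^ 2) volume (-Real.pi) Real.pi := fun x =>
    (((continuous_evalC_circ (hf.mul (isRHInf_inZInv _))).norm.pow 2).const_mul
      (Ch.p j x)).intervalIntegrable _ _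
  simp_rw [hdef, mul_left_comm (Ch.p j _), ← Finset.mul_sum]
  congr 1
  simp_rw [← intervalIntegral.integral_const_mul]
  rw [← intervalIntegral.integral_finsetSum fun x _ => hcont x]
  congr 1
  funext θ
  have hz := norm_circ θ
  have hmul : ∀ q : ℝ[X], ‖evalC (f * inZInv q) (circ θ)‖ ^ 2 =
      ‖evalC f (circ θ)‖ ^ 2 * ‖evalC (inZInv q) (circ θ)‖ ^ 2 := fun q => by
    rw [evalC_mul (hf.regularAt hz.ge) ((isRHInf_inZInv q).regularAt hz.ge), norm_mul, mul_pow]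
  simp only [hmul]
  rw [← sum_p_mul_norm_sq j hφ hz, Finset.mul_sum]
  exact Finset.sum_congr rfl fun x _ => by ring

/-- The mean square of the response, `t` steps after a packet was sent. -/
def energy (Ch : Channel m) (G : TFMatrix m) (i j : Fin m) (t : ℕ) : ℝ :=
  ∑ x ∈ Finset.range (Ch.maxDelay j + 1), Ch.p j x * Ch.kern G i j x t ^ 2

theorem energy_nonneg (G : TFMatrix m) (i j : Fin m) (t : ℕ) : 0 ≤ Ch.energy G i j t :=
  Finset.sum_nonneg fun x _ => mul_nonneg (Ch.p_nonneg j x) (sq_nonneg _)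

theorem hasSum_energy {G : TFMatrix m} (hG : MatRHInf G) (i j : Fin m) {φ : ℝ[X]}
    (hφ : Ch.IsSpectralFactor j φ) :
    HasSum (Ch.energy G i j) (h2NormSq (G i j * inZInv φ)) := by
  rw [← sum_p_mul_h2NormSq (hG i j) j hφ]
  refine hasSum_sum fun x _ => ?_
  have hR := (hG i j).mul (isRHInf_inZInv (Ch.devPoly j x))
  rw [h2NormSq_eq_tsum hR]
  exact (summable_sq_impulseResponse hR).hasSum.mul_left _

end Channel

end MSStab

end

noncomputable section

namespace MSStab

set_option linter.unusedSectionVars false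

/-! ### Independence in the feedback loop -/

/-- Adjoins the noise, as the index `none`, to the independent family of delays, so that disjoint
blocks of the joint family are independent. -/
theorem iIndep_option {Ω ι : Type*} [MeasurableSpace Ω] {μ : Measure Ω} [IsProbabilityMeasure μ]
    {m₀ : MeasurableSpace Ω} {m₁ : ι → MeasurableSpace Ω} {m₂ : MeasurableSpace Ω}
    (h₀ : Indep m₀ m₂ μ) (h₁ : iIndep m₁ μ) (hle : ∀ i, m₁ i ≤ m₂) :
    iIndep (fun o : Option ι => o.elim m₀ m₁) μ := by
  classical
  rw [iIndep_iff]
  intro s f hf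
  have hsome : ∀ t : Finset ι, (∀ i ∈ t, MeasurableSet[m₁ i] (f (some i))) →
      μ (⋂ i ∈ t, f (some i)) = ∏ i ∈ t, μ (f (some i)) ∧
        MeasurableSet[m₂] (⋂ i ∈ t, f (some i)) := fun t ht =>
    ⟨(iIndep_iff m₁ μ).1 h₁ t (f := fun i => f (some i)) ht,
      @Finset.measurableSet_biInter _ _ m₂ _ t fun i hi => hle i _ (ht i hi)⟩
  by_cases hn : none ∈ s
  · have hs : s = Finset.insertNone (Finset.eraseNone s) := by
      rw [Finset.insertNone_eraseNone, Finset.insert_eq_of_mem hn]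
    have ht := hsome (Finset.eraseNone s) fun i hi => hf (some i) (Finset.mem_eraseNone.1 hi)
    have hI : ⋂ o ∈ s, f o = f none ∩ ⋂ i ∈ Finset.eraseNone s, f (some i) := by
      ext ω
      simp only [Set.mem_iInter, Set.mem_inter_iff, Finset.mem_eraseNone]
      constructor
      · exact fun h => ⟨h none hn, fun i hi => h _ hi⟩
      · rintro ⟨h1, h2⟩ (_ | i) ho
        · exact h1
        · exact h2 i ho
    rw [hI, (Indep_iff m₀ m₂ μ).1 h₀ _ _ (hf none hn) ht.2, ht.1]
    conv_rhs => rw [hs]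
    rw [Finset.prod_insertNone]
  · have hs : s = (Finset.eraseNone s).map Function.Embedding.some := by
      rw [Finset.map_some_eraseNone, Finset.erase_eq_of_notMem hn]
    have ht := hsome (Finset.eraseNone s) fun i hi => hf (some i) (Finset.mem_eraseNone.1 hi)
    have hI : ⋂ o ∈ s, f o = ⋂ i ∈ Finset.eraseNone s, f (some i) := by
      ext ω
      simp only [Set.mem_iInter, Finset.mem_eraseNone]
      constructor
      · exact fun h i hi => h _ hi
      · rintro h2 (_ | i) ho
        · exact absurd ho hn
        · exact h2 i ho
    rw [hI, ht.1]
    conv_rhs => rw [hs]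
    rw [Finset.prod_map]
    rfl

section Others

variable {m : ℕ} {Ω : Type} [mΩ : MeasurableSpace Ω]

/-- The information in the noise and in all delays but that of the packet `q₀`. -/
abbrev others (χ : Fin m → ℕ → Ω → ℕ) (v : ℕ → Ω → Fin m → ℝ) (q₀ : Fin m × ℕ) : MeasurableSpace Ω :=
  MeasurableSpace.comap (fun ω k => v k ω) inferInstance ⊔
    ⨆ q ∈ {q : Fin m × ℕ | q ≠ q₀}, MeasurableSpace.comap (χ q.1 q.2) inferInstance

variable {χ : Fin m → ℕ → Ω → ℕ} {v : ℕ → Ω → Fin m → ℝ} {q₀ : Fin m × ℕ}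

theorem measurable_noise_others (l : ℕ) (j : Fin m) :
    Measurable[others χ v q₀] fun ω => v l ω j := by
  have h1 : Measurable[MeasurableSpace.comap (fun ω k => v k ω) inferInstance]
      fun ω (k : ℕ) => v k ω := comap_measurable _
  have h2 : Measurable fun w : ℕ → Fin m → ℝ => w l j := by fun_prop
  exact (h2.comp h1).mono le_sup_left le_rfl

theorem measurable_delay_others {q : Fin m × ℕ} (hq : q ≠ q₀) :
    Measurable[others χ v q₀] (χ q.1 q.2) := by
  refine (comap_measurable (χ q.1 q.2)).mono (le_trans ?_ le_sup_right) le_rfl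
  exact le_iSup₂_of_le (f := fun (q : Fin m × ℕ) (_ : q ∈ {q : Fin m × ℕ | q ≠ q₀}) =>
    MeasurableSpace.comap (χ q.1 q.2) inferInstance) q hq le_rfl

theorem others_le (hχ : ∀ i k, Measurable (χ i k)) (hv : ∀ k, Measurable (v k)) :
    others χ v q₀ ≤ mΩ :=
  sup_le (measurable_pi_lambda _ hv).comap_le (iSup₂_le fun q _ => (hχ q.1 q.2).comap_le)

variable {μ : Measure Ω} [IsProbabilityMeasure μ] {Ch : Channel m}

theorem indep_others (hχ : Ch.IsDelayProcess μ χ) (hv : ∀ k, Measurable (v k))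
    (hind : IndepFun (fun ω k => v k ω) (fun ω (q : Fin m × ℕ) => χ q.1 q.2 ω) μ)
    (q₀ : Fin m × ℕ) :
    Indep (MeasurableSpace.comap (χ q₀.1 q₀.2) inferInstance) (others χ v q₀) μ := by
  have h1 := iIndep_option (m₁ := fun q : Fin m × ℕ => MeasurableSpace.comap (χ q.1 q.2)
      inferInstance) ((IndepFun_iff_Indep _ _ _).1 hind) hχ.indep.iIndep (fun q => by
    have h : Measurable[MeasurableSpace.comap (fun ω (q : Fin m × ℕ) => χ q.1 q.2 ω)
        inferInstance] (χ q.1 q.2) :=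
      (measurable_pi_apply (X := fun _ => ℕ) q).comp
        (comap_measurable fun ω (q : Fin m × ℕ) => χ q.1 q.2 ω)
    exact h.comap_le)
  have h2 := indep_iSup_of_disjoint (fun o => by
    cases o with
    | none => exact (measurable_pi_lambda _ hv).comap_le
    | some q => exact (hχ.measurable q.1 q.2).comap_le) h1
    (S := {some q₀}) (T := {o | o ≠ some q₀}) (by simp)
  refine indep_of_indep_of_le_left (indep_of_indep_of_le_right h2 ?_) ?_
  · refine sup_le ?_ (iSup₂_le fun q hq => ?_)
    · exact le_iSup₂_of_le (f := fun (o : Option (Fin m × ℕ)) (_ : o ∈ {o | o ≠ some q₀}) => _)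
        none (by simp) le_rfl
    · exact le_iSup₂_of_le (f := fun (o : Option (Fin m × ℕ)) (_ : o ∈ {o | o ≠ some q₀}) => _)
        (some q) (by simpa using hq) le_rfl
  · exact le_iSup₂_of_le (f := fun (o : Option (Fin m × ℕ)) (_ : o ∈ ({some q₀} : Set _)) => _)
        (some q₀) (by simp) le_rfl

/-- The law is prescribed only on the admissible delays, but those probabilities already sum to one.
-/
theorem ae_delay_mem (hχ : Ch.IsDelayProcess μ χ) (i : Fin m) (k : ℕ) :
    ∀ᵐ ω ∂μ, χ i k ω ∈ Finset.range (Ch.maxDelay i + 1) := by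
  have hmeas : ∀ j, MeasurableSet {ω | χ i k ω = j} := fun j =>
    hχ.measurable i k (measurableSet_singleton j)
  have h1 : {ω | χ i k ω ∈ Finset.range (Ch.maxDelay i + 1)} =
      ⋃ j ∈ Finset.range (Ch.maxDelay i + 1), {ω | χ i k ω = j} := by
    ext ω; simp
  have h2 : μ {ω | χ i k ω ∈ Finset.range (Ch.maxDelay i + 1)} = 1 := by
    rw [h1, measure_biUnion_finset (fun a _ b _ hab => by
      rw [Function.onFun, Set.disjoint_left]
      intro ω ha hb
      exact hab (ha.symm.trans hb)) fun j _ => hmeas j, Finset.sum_congr rfl (hχ.pmf i k),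
      ← ENNReal.ofReal_sum_of_nonneg fun j _ => Ch.p_nonneg i j, Ch.p_sum, ENNReal.ofReal_one]
  exact (mem_ae_iff_prob_eq_one
    (by rw [h1]; exact Finset.measurableSet_biUnion _ fun j _ => hmeas j)).2 h2

theorem integral_comp_delay (hχ : Ch.IsDelayProcess μ χ) (i : Fin m) (k : ℕ) (F : ℕ → ℝ) :
    ∫ ω, F (χ i k ω) ∂μ = ∑ x ∈ Finset.range (Ch.maxDelay i + 1), Ch.p i x * F x := by
  have hmeas : ∀ j, MeasurableSet {ω | χ i k ω = j} := fun j =>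
    hχ.measurable i k (measurableSet_singleton j)
  have h1 : ∀ᵐ ω ∂μ, F (χ i k ω) = ∑ x ∈ Finset.range (Ch.maxDelay i + 1),
      {ω | χ i k ω = x}.indicator (fun _ => F x) ω := by
    filter_upwards [ae_delay_mem hχ i k] with ω hω
    rw [Finset.sum_eq_single (χ i k ω)]
    · simp
    · intro x _ hx
      rw [Set.indicator_of_notMem]
      exact fun h => hx h.symm
    · exact fun h => absurd hω h
  rw [integral_congr_ae h1, integral_finsetSum _ fun x _ =>
    (integrable_const (F x)).indicator (hmeas x)]
  refine Finset.sum_congr rfl fun x hx => ?_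
  rw [integral_indicator_const _ (hmeas x), smul_eq_mul, Measure.real, hχ.pmf i k x hx,
    ENNReal.toReal_ofReal (Ch.p_nonneg i x)]

theorem integral_delay_mul (hχ : Ch.IsDelayProcess μ χ) (hv : ∀ k, Measurable (v k))
    (hind : IndepFun (fun ω k => v k ω) (fun ω (q : Fin m × ℕ) => χ q.1 q.2 ω) μ)
    (q₀ : Fin m × ℕ) (F : ℕ → ℝ) {Y : Ω → ℝ} (hY : Measurable[others χ v q₀] Y) :
    ∫ ω, F (χ q₀.1 q₀.2 ω) * Y ω ∂μ =
      (∑ x ∈ Finset.range (Ch.maxDelay q₀.1 + 1), Ch.p q₀.1 x * F x) * ∫ ω, Y ω ∂μ := by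
  have hF : Measurable F := measurable_of_countable F
  have h1 : IndepFun (fun ω => F (χ q₀.1 q₀.2 ω)) Y μ := by
    rw [IndepFun_iff_Indep]
    refine indep_of_indep_of_le_left (indep_of_indep_of_le_right
      (indep_others hχ hv hind q₀) hY.comap_le) ?_
    exact (hF.comp (comap_measurable (χ q₀.1 q₀.2))).comap_le
  rw [h1.integral_fun_mul_eq_mul_integral
    (hF.comp (hχ.measurable q₀.1 q₀.2)).aestronglyMeasurable
    (hY.mono (others_le hχ.measurable hv) le_rfl).aestronglyMeasurable, integral_comp_delay hχ]

end Others

/-! ### The second moments of the feedback loop -/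

section Moments

variable {m : ℕ} {Ω : Type} [MeasurableSpace Ω] {μ : Measure Ω}
  {Ch : Channel m} {G : TFMatrix m} {χ : Fin m → ℕ → Ω → ℕ} {v u : ℕ → Ω → Fin m → ℝ}

/-- The recursion satisfied by the input of the channels. -/
def IsInputRecursion (Ch : Channel m) (G : TFMatrix m) (χ : Fin m → ℕ → Ω → ℕ)
    (v u : ℕ → Ω → Fin m → ℝ) : Prop :=
  ∀ k ω i, u k ω i = Channel.noiseResponse G (fun l => v l ω) k i -
    ∑ q ∈ Finset.univ ×ˢ Finset.range k, Ch.kern G i q.1 (χ q.1 q.2 ω) (k - q.2) * u q.2 ω q.1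

theorem isLoop_iff (hG : ∀ i j, IsProper (G i j)) (hG0 : ∀ i j, impulseResponse (G i j) 0 = 0)
    {e : ℕ → Ω → Fin m → ℝ} : IsLoop Ch G χ v e u ↔ IsInputRecursion Ch G χ v u ∧
      ∀ k ω i, e k ω i = v k ω i -
        Ch.uncertaintyOutput i (fun l => χ i l ω) (fun l => u l ω i) k := by
  constructor
  · intro h
    have he := fun k ω i => (h k ω i).1
    refine ⟨fun k ω i => ?_, he⟩
    rw [← Channel.sum_loop_eq hG hG0 (fun i l => χ i l ω) (fun l => v l ω) (fun l => u l ω),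
      (h k ω i).2]
    simp_rw [he]
  · rintro ⟨hu, he⟩ k ω i
    refine ⟨he k ω i, ?_⟩
    simp_rw [he]
    rw [hu k ω i, Channel.sum_loop_eq hG hG0 (fun i l => χ i l ω) (fun l => v l ω)
      (fun l => u l ω)]

theorem measurable_noiseResponse_others (q₀ : Fin m × ℕ) (k : ℕ) (i : Fin m) :
    Measurable[others χ v q₀] fun ω => Channel.noiseResponse G (fun l => v l ω) k i := by
  unfold Channel.noiseResponse
  refine Finset.measurable_sum _ fun l _ => Finset.measurable_sum _ fun j _ => ?_
  exact (measurable_noise_others l j).const_mul _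

theorem measurable_kern_others {q₀ q : Fin m × ℕ} (hq : q ≠ q₀) (i : Fin m) (t : ℕ) :
    Measurable[others χ v q₀] fun ω => Ch.kern G i q.1 (χ q.1 q.2 ω) t :=
  (measurable_of_countable fun x => Ch.kern G i q.1 x t).comp (measurable_delay_others hq)

/-- Causality: u(n) involves only packets sent strictly before n, hence not the packet q₀ sent at
time n or later. -/
theorem IsInputRecursion.measurable_others (hu : IsInputRecursion Ch G χ v u) (n : ℕ)
    {q₀ : Fin m × ℕ} (hn : n ≤ q₀.2) (i : Fin m) :
    Measurable[others χ v q₀] fun ω => u n ω i := by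
  induction n using Nat.strong_induction_on generalizing i with
  | _ n ih =>
    have h1 : (fun ω => u n ω i) = fun ω => Channel.noiseResponse G (fun l => v l ω) n i -
        ∑ q ∈ Finset.univ ×ˢ Finset.range n, Ch.kern G i q.1 (χ q.1 q.2 ω) (n - q.2) *
          u q.2 ω q.1 := funext fun ω => hu n ω i
    rw [h1]
    refine (measurable_noiseResponse_others q₀ n i).sub (Finset.measurable_sum _ fun q hq => ?_)
    have hq2 : q.2 < n := Finset.mem_range.1 (Finset.mem_product.1 hq).2
    refine (measurable_kern_others (fun h => ?_) i _).mul (ih q.2 hq2 (by omega) q.1)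
    rw [h] at hq2
    omega

variable [IsProbabilityMeasure μ]

theorem memLp_noiseResponse (hv : ∀ k i, MemLp (fun ω => v k ω i) 2 μ) (k : ℕ) (i : Fin m) :
    MemLp (fun ω => Channel.noiseResponse G (fun l => v l ω) k i) 2 μ :=
  memLp_finsetSum _ fun l _ => memLp_finsetSum _ fun j _ => (hv l j).const_mul _

theorem memLp_kern_mul (hG : ∀ i j, IsProper (G i j)) (hχ : ∀ i k, Measurable (χ i k))
    {Y : Ω → ℝ} (hY : MemLp Y 2 μ) (i : Fin m) (q : Fin m × ℕ) (t : ℕ) :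
    MemLp (fun ω => Ch.kern G i q.1 (χ q.1 q.2 ω) t * Y ω) 2 μ := by
  obtain ⟨c, hc⟩ := Channel.exists_abs_kern_le (Ch := Ch) hG i q.1 t
  refine MemLp.of_le_mul (c := c) hY (AEStronglyMeasurable.mul ?_ hY.1)
    (Filter.Eventually.of_forall fun ω => ?_)
  · exact ((measurable_of_countable fun x => Ch.kern G i q.1 x t).comp
      (hχ q.1 q.2)).aestronglyMeasurable
  · rw [norm_mul]
    exact mul_le_mul_of_nonneg_right (hc _) (norm_nonneg _)

theorem IsInputRecursion.memLp (hu : IsInputRecursion Ch G χ v u) (hG : ∀ i j, IsProper (G i j))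
    (hχ : ∀ i k, Measurable (χ i k)) (hv : ∀ k i, MemLp (fun ω => v k ω i) 2 μ) (n : ℕ)
    (i : Fin m) : MemLp (fun ω => u n ω i) 2 μ := by
  induction n using Nat.strong_induction_on generalizing i with
  | _ n ih =>
    have h1 : (fun ω => u n ω i) = fun ω => Channel.noiseResponse G (fun l => v l ω) n i -
        ∑ q ∈ Finset.univ ×ˢ Finset.range n, Ch.kern G i q.1 (χ q.1 q.2 ω) (n - q.2) *
          u q.2 ω q.1 := funext fun ω => hu n ω i
    rw [h1]
    refine (memLp_noiseResponse hv n i).sub (memLp_finsetSum _ fun q hq => ?_)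
    exact memLp_kern_mul hG hχ (ih q.2 (Finset.mem_range.1 (Finset.mem_product.1 hq).2) q.1) i q _

theorem integral_sub_sum_sq {ι : Type*} {s : Finset ι} {f : Ω → ℝ} {Z : ι → Ω → ℝ}
    (hf : MemLp f 2 μ) (hZ : ∀ q ∈ s, MemLp (Z q) 2 μ)
    (h1 : ∀ q ∈ s, ∫ ω, f ω * Z q ω ∂μ = 0)
    (h2 : ∀ q ∈ s, ∀ r ∈ s, q ≠ r → ∫ ω, Z q ω * Z r ω ∂μ = 0) :
    ∫ ω, (f ω - ∑ q ∈ s, Z q ω) ^ 2 ∂μ = ∫ ω, f ω ^ 2 ∂μ + ∑ q ∈ s, ∫ ω, Z q ω ^ 2 ∂μ := by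
  have i1 : ∀ q ∈ s, Integrable (fun ω => f ω * Z q ω) μ := fun q hq => hf.integrable_mul (hZ q hq)
  have i2 : ∀ q ∈ s, ∀ r ∈ s, Integrable (fun ω => Z q ω * Z r ω) μ := fun q hq r hr =>
    (hZ q hq).integrable_mul (hZ r hr)
  have e : (fun ω => (f ω - ∑ q ∈ s, Z q ω) ^ 2) = fun ω =>
      (f ω ^ 2 - 2 * ∑ q ∈ s, f ω * Z q ω) + ∑ q ∈ s, ∑ r ∈ s, Z q ω * Z r ω := by
    funext ω
    rw [← Finset.sum_mul_sum, ← Finset.mul_sum]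
    ring
  have j1 : Integrable (fun ω => ∑ q ∈ s, f ω * Z q ω) μ := integrable_finsetSum _ i1
  have j2 : Integrable (fun ω => ∑ q ∈ s, ∑ r ∈ s, Z q ω * Z r ω) μ :=
    integrable_finsetSum _ fun q hq => integrable_finsetSum _ fun r hr => i2 q hq r hr
  have j3 : Integrable (fun ω => f ω ^ 2 - 2 * ∑ q ∈ s, f ω * Z q ω) μ :=
    hf.integrable_sq.sub (j1.const_mul 2)
  rw [e, integral_add j3 j2, integral_sub hf.integrable_sq
    (j1.const_mul 2), integral_const_mul, integral_finsetSum _ i1, Finset.sum_eq_zero h1, mul_zero,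
    sub_zero, integral_finsetSum _ fun q hq => integrable_finsetSum _ fun r hr => i2 q hq r hr]
  congr 1
  refine Finset.sum_congr rfl fun q hq => ?_
  rw [integral_finsetSum _ fun r hr => i2 q hq r hr, Finset.sum_eq_single q
    (fun r hr hne => h2 q hq r hr hne.symm) fun h => absurd hq h]
  simp_rw [sq]

/-- Pythagoras for the packet expansion. Every cross term contains the centred kernel of a delay
that is independent of all other factors, and in the diagonal terms that kernel squared averages to
the energy. -/
theorem IsInputRecursion.integral_sq (hu : IsInputRecursion Ch G χ v u)
    (hG : ∀ i j, IsProper (G i j)) (hχ : Ch.IsDelayProcess μ χ) (hvm : ∀ k, Measurable (v k))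
    (hv : ∀ k i, MemLp (fun ω => v k ω i) 2 μ)
    (hind : IndepFun (fun ω k => v k ω) (fun ω (q : Fin m × ℕ) => χ q.1 q.2 ω) μ)
    (k : ℕ) (i : Fin m) :
    ∫ ω, u k ω i ^ 2 ∂μ = ∫ ω, Channel.noiseResponse G (fun l => v l ω) k i ^ 2 ∂μ +
      ∑ q ∈ Finset.univ ×ˢ Finset.range k, Ch.energy G i q.1 (k - q.2) *
        ∫ ω, u q.2 ω q.1 ^ 2 ∂μ := by
  have hL2 := fun n i => hu.memLp hG hχ.measurable hv n i
  simp_rw [hu k _ i]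
  rw [integral_sub_sum_sq (memLp_noiseResponse hv k i)
    (fun q _ => memLp_kern_mul hG hχ.measurable (hL2 q.2 q.1) i q _)]
  · congr 1
    refine Finset.sum_congr rfl fun q _ => ?_
    simp_rw [mul_pow]
    rw [integral_delay_mul hχ hvm hind q (fun x => Ch.kern G i q.1 x (k - q.2) ^ 2)
      ((hu.measurable_others q.2 le_rfl q.1).pow_const 2)]
    rfl
  · intro q _
    simp_rw [mul_left_comm]
    have hY : Measurable[others χ v q] fun ω =>
        Channel.noiseResponse G (fun l => v l ω) k i * u q.2 ω q.1 :=
      (measurable_noiseResponse_others q k i).mul (hu.measurable_others q.2 le_rfl q.1)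
    rw [integral_delay_mul hχ hvm hind q (fun x => Ch.kern G i q.1 x (k - q.2)) hY,
      Channel.sum_p_mul_kern hG, zero_mul]
  -- The delay of the packet sent last is averaged out first. Equal times are allowed, since packets
  -- of different channels are independent too.
  · have key : ∀ q r : Fin m × ℕ, q ≠ r → r.2 ≤ q.2 →
        ∫ ω, (Ch.kern G i q.1 (χ q.1 q.2 ω) (k - q.2) * u q.2 ω q.1) *
          (Ch.kern G i r.1 (χ r.1 r.2 ω) (k - r.2) * u r.2 ω r.1) ∂μ = 0 := by
      intro q r hqr hle
      simp_rw [mul_assoc]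
      have hY : Measurable[others χ v q] fun ω => u q.2 ω q.1 *
          (Ch.kern G i r.1 (χ r.1 r.2 ω) (k - r.2) * u r.2 ω r.1) :=
        (hu.measurable_others q.2 le_rfl q.1).mul ((measurable_kern_others hqr.symm i _).mul
          (hu.measurable_others r.2 hle r.1))
      rw [integral_delay_mul hχ hvm hind q (fun x => Ch.kern G i q.1 x (k - q.2)) hY,
        Channel.sum_p_mul_kern hG, zero_mul]
    intro q _ r _ hqr
    rcases le_total r.2 q.2 with h | h
    · exact key q r hqr h
    · rw [← key r q hqr.symm h]
      exact integral_congr_ae (Filter.Eventually.of_forall fun ω => mul_comm _ _)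

end Moments

end MSStab

end

noncomputable section

namespace MSStab

set_option linter.unusedSectionVars false

/-! ### Renewal inequalities -/

theorem sum_range_sub_le {c : ℕ → ℝ} (hc : ∀ t, 0 ≤ c t) {a : ℝ} (h : HasSum c a) (k : ℕ) :
    ∑ n ∈ Finset.range k, c (k - n) ≤ a := by
  calc ∑ n ∈ Finset.range k, c (k - n) ≤ ∑ n ∈ Finset.range (k + 1), c (k - n) :=
        Finset.sum_le_sum_of_subset_of_nonneg (Finset.range_mono (Nat.le_succ k))
          fun _ _ _ => hc _
    _ = ∑ t ∈ Finset.range (k + 1), c t := Finset.sum_flip c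
    _ ≤ a := sum_le_hasSum _ (fun t _ => hc t) h

section Renewal

variable {m : ℕ} {c : Fin m → Fin m → ℕ → ℝ} {J : Matrix (Fin m) (Fin m) ℝ} {U F : ℕ → Fin m → ℝ}

/-- A positive vector with J x < x, scaled by a large constant κ, is a supersolution that also
absorbs the forcing; induction on time keeps U below it. -/
theorem renewal_bounded (hc : ∀ i j t, 0 ≤ c i j t) (hJ : ∀ i j, HasSum (c i j) (J i j))
    (hU : ∀ k i, U k i = F k i + ∑ q ∈ Finset.univ ×ˢ Finset.range k,
      c i q.1 (k - q.2) * U q.2 q.1) {b : ℝ} (hb : 0 ≤ b) (hF : ∀ k i, F k i ≤ b)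
    (hρ : specRad J < 1) : ∃ B, 0 ≤ B ∧ ∀ k i, U k i ≤ B := by
  have hJ0 : ∀ i j, 0 ≤ J i j := fun i j => (hJ i j).nonneg (hc i j)
  obtain ⟨x, hx, hlt⟩ := exists_mulVec_lt_of_specRad_lt hJ0 hρ
  simp only [one_mul] at hlt
  -- The sum dominates each of its terms, so κ(x - Jx)_i ≥ b for all i at once.
  set κ := ∑ i, b / (x i - ∑ j, J i j * x j) with hκ
  have hterm : ∀ i, 0 ≤ b / (x i - ∑ j, J i j * x j) := fun i =>
    div_nonneg hb (sub_nonneg.2 (hlt i).le)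
  have hκ0 : 0 ≤ κ := Finset.sum_nonneg fun i _ => hterm i
  have hκi : ∀ i, b + ∑ j, J i j * (κ * x j) ≤ κ * x i := by
    intro i
    have h1 : b / (x i - ∑ j, J i j * x j) ≤ κ :=
      Finset.single_le_sum (fun i _ => hterm i) (Finset.mem_univ i)
    rw [div_le_iff₀ (sub_pos.2 (hlt i))] at h1
    have h2 : ∑ j, J i j * (κ * x j) = κ * ∑ j, J i j * x j := by
      rw [Finset.mul_sum]; exact Finset.sum_congr rfl fun j _ => by ring
    rw [h2]
    linarith
  have hmain : ∀ k i, U k i ≤ κ * x i := by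
    intro k
    induction k using Nat.strong_induction_on with
    | _ k ih =>
      intro i
      rw [hU k i]
      refine le_trans (add_le_add (hF k i) ?_) (hκi i)
      rw [Finset.sum_product]
      refine Finset.sum_le_sum fun j _ => ?_
      calc ∑ n ∈ Finset.range k, c i j (k - n) * U n j ≤
          ∑ n ∈ Finset.range k, c i j (k - n) * (κ * x j) :=
            Finset.sum_le_sum fun n hn => mul_le_mul_of_nonneg_left
              (ih n (Finset.mem_range.1 hn) j) (hc _ _ _)
        _ = (∑ n ∈ Finset.range k, c i j (k - n)) * (κ * x j) :=
            (Finset.sum_mul _ _ _).symm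
        _ ≤ J i j * (κ * x j) := mul_le_mul_of_nonneg_right (sum_range_sub_le (hc i j) (hJ i j) k)
            (mul_nonneg hκ0 (hx j).le)
  refine ⟨∑ i, κ * x i, Finset.sum_nonneg fun i _ => mul_nonneg hκ0 (hx i).le, fun k i =>
    (hmain k i).trans (Finset.single_le_sum (f := fun i => κ * x i)
      (fun i _ => mul_nonneg hκ0 (hx i).le) (Finset.mem_univ i))⟩

/-- If U ≥ a x from some time on, a long enough window of the convolution returns at least (a - ε/2)
x because J x ≥ x, and the forcing adds ε x. Each round therefore raises the eventual lower bound by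
(ε/2) x. -/
theorem renewal_unbounded (hc : ∀ i j t, 0 ≤ c i j t) (hc0 : ∀ i j, c i j 0 = 0)
    (hJ : ∀ i j, HasSum (c i j) (J i j))
    (hU : ∀ k i, U k i = F k i + ∑ q ∈ Finset.univ ×ˢ Finset.range k,
      c i q.1 (k - q.2) * U q.2 q.1) (hU0 : ∀ k i, 0 ≤ U k i) {x : Fin m → ℝ}
    (hx0 : ∀ i, 0 ≤ x i) (hx : ∀ i, x i ≤ ∑ j, J i j * x j) {ε : ℝ} (hε : 0 < ε) {k₀ : ℕ}
    (hF : ∀ k ≥ k₀, ∀ i, ε * x i ≤ F k i) (N : ℕ) :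
    ∃ K, ∀ k ≥ K, ∀ i, N * (ε / 2) * x i ≤ U k i := by
  induction N with
  | zero => exact ⟨0, fun k _ i => by simpa using hU0 k i⟩
  | succ N ih =>
    obtain ⟨K, hK⟩ := ih
    set a := N * (ε / 2) with ha
    have ha0 : 0 ≤ a := by positivity
    -- The window of length T loses at most (ε/2) x_i. If x_i = 0 nothing has to be shown; otherwise
    -- the loss is strictly positive and the partial sums reach the limit up to it.
    have hT : ∀ i, ∀ᶠ T : ℕ in Filter.atTop,
        a * x i - ε / 2 * x i ≤ ∑ j, ∑ t ∈ Finset.range T, c i j t * (a * x j) := by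
      intro i
      rcases (hx0 i).lt_or_eq with hi | hi
      · have h1 : Filter.Tendsto (fun T : ℕ => ∑ j, ∑ t ∈ Finset.range T, c i j t * (a * x j))
            Filter.atTop (nhds (∑ j, J i j * (a * x j))) :=
          tendsto_finsetSum _ fun j _ => ((hJ i j).mul_right (a * x j)).tendsto_sum_nat
        refine (h1.eventually_const_lt ?_).mono fun T h => h.le
        have h2 : ∑ j, J i j * (a * x j) = a * ∑ j, J i j * x j := by
          rw [Finset.mul_sum]; exact Finset.sum_congr rfl fun j _ => by ring
        rw [h2]
        have := mul_le_mul_of_nonneg_left (hx i) ha0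
        have : 0 < ε / 2 * x i := by positivity
        linarith
      · refine Filter.Eventually.of_forall fun T => ?_
        rw [← hi, mul_zero, mul_zero, sub_zero]
        exact Finset.sum_nonneg fun j _ => Finset.sum_nonneg fun t _ =>
          mul_nonneg (hc _ _ _) (mul_nonneg ha0 (hx0 j))
    obtain ⟨T, hT⟩ := (Filter.eventually_all.2 hT).exists
    refine ⟨max k₀ (K + T), fun k hk i => ?_⟩
    have hk1 : k₀ ≤ k := (le_max_left _ _).trans hk
    have hk2 : K + T ≤ k := (le_max_right _ _).trans hk
    have hsum : ∑ j, ∑ t ∈ Finset.range T, c i j t * (a * x j) ≤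
        ∑ q ∈ Finset.univ ×ˢ Finset.range k, c i q.1 (k - q.2) * U q.2 q.1 := by
      rw [Finset.sum_product]
      refine Finset.sum_le_sum fun j _ => ?_
      calc ∑ t ∈ Finset.range T, c i j t * (a * x j) ≤
          ∑ t ∈ Finset.range T, c i j t * U (k - t) j := by
            refine Finset.sum_le_sum fun t ht => mul_le_mul_of_nonneg_left ?_ (hc _ _ _)
            have := Finset.mem_range.1 ht
            exact hK (k - t) (by omega) j
        _ ≤ ∑ t ∈ Finset.range (k + 1), c i j t * U (k - t) j :=
            Finset.sum_le_sum_of_subset_of_nonneg (Finset.range_mono (by omega))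
              fun t _ _ => mul_nonneg (hc _ _ _) (hU0 _ _)
        _ = ∑ n ∈ Finset.range (k + 1), c i j (k - n) * U n j := by
            rw [← Finset.sum_flip]
            refine Finset.sum_congr rfl fun n hn => ?_
            have : n ≤ k := by simpa [Nat.lt_succ_iff] using hn
            rw [show k - (k - n) = n by omega]
        _ = _ := by rw [Finset.sum_range_succ, Nat.sub_self, hc0, zero_mul, add_zero]
    rw [hU k i]
    push_cast
    have h1 := hF k hk1 i
    have h2 := (hT i).trans hsum
    have h3 : (N + 1 : ℝ) * (ε / 2) * x i = a * x i + ε / 2 * x i := by rw [ha]; ring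
    rw [h3]
    linarith

end Renewal

/-! ### Boundedness of the second moments -/

section Sufficiency

variable {m : ℕ} {Ω : Type} [MeasurableSpace Ω] {μ : Measure Ω} [IsProbabilityMeasure μ]
  {Ch : Channel m} {G : TFMatrix m} {χ : Fin m → ℕ → Ω → ℕ} {v u e : ℕ → Ω → Fin m → ℝ}

theorem IsWhiteNoise.integral_sq (hv : IsWhiteNoise μ v) (k : ℕ) (i : Fin m) :
    ∫ ω, v k ω i ^ 2 ∂μ = ∫ ω, v 0 ω i ^ 2 ∂μ := by
  have h : Measurable fun w : Fin m → ℝ => w i ^ 2 := by fun_prop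
  exact ((hv.identDistrib k).comp h).integral_eq

theorem sq_sum_mul_le {ι : Type*} (s : Finset ι) (w x : ι → ℝ) {C : ℝ}
    (hC : ∑ a ∈ s, |w a| ≤ C) :
    (∑ a ∈ s, w a * x a) ^ 2 ≤ C * ∑ a ∈ s, |w a| * x a ^ 2 := by
  have hn : ∀ a, 0 ≤ |w a| * x a ^ 2 := fun a => mul_nonneg (abs_nonneg _) (sq_nonneg _)
  refine (Finset.sum_sq_le_sum_mul_sum_of_sq_le_mul s (f := fun a => |w a|)
    (g := fun a => |w a| * x a ^ 2) (fun _ _ => abs_nonneg _) (fun a _ => hn a) fun a _ => ?_).trans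
    (mul_le_mul_of_nonneg_right hC (Finset.sum_nonneg fun a _ => hn a))
  rw [← mul_assoc, abs_mul_abs_self, mul_pow, sq (w a)]

theorem noiseResponse_eq (w : ℕ → Fin m → ℝ) (k : ℕ) (i : Fin m) :
    Channel.noiseResponse G w k i = ∑ a ∈ Finset.range (k + 1) ×ˢ Finset.univ,
      impulseResponse (G i a.2) (k - a.1) * w a.1 a.2 := by
  rw [Finset.sum_product]
  rfl

theorem integral_sq_sum_mul_le {ι : Type*} (s : Finset ι) (w : ι → ℝ) (x : ι → Ω → ℝ) {C S : ℝ}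
    (hx : ∀ a, MemLp (x a) 2 μ) (hC : ∑ a ∈ s, |w a| ≤ C) (hS : ∀ a, ∫ ω, x a ω ^ 2 ∂μ ≤ S)
    (hS0 : 0 ≤ S) : ∫ ω, (∑ a ∈ s, w a * x a ω) ^ 2 ∂μ ≤ C * (C * S) := by
  have hC0 : 0 ≤ C := (Finset.sum_nonneg fun a _ => abs_nonneg (w a)).trans hC
  have hint : ∀ a ∈ s, Integrable (fun ω => |w a| * x a ω ^ 2) μ := fun a _ =>
    (hx a).integrable_sq.const_mul _
  have hL : MemLp (fun ω => ∑ a ∈ s, w a * x a ω) 2 μ :=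
    memLp_finsetSum _ fun a _ => (hx a).const_mul (w a)
  calc ∫ ω, (∑ a ∈ s, w a * x a ω) ^ 2 ∂μ ≤ ∫ ω, C * ∑ a ∈ s, |w a| * x a ω ^ 2 ∂μ :=
        integral_mono hL.integrable_sq ((integrable_finsetSum _ hint).const_mul _)
          fun ω => sq_sum_mul_le s w (fun a => x a ω) hC
    _ = C * ∑ a ∈ s, |w a| * ∫ ω, x a ω ^ 2 ∂μ := by
        rw [integral_const_mul, integral_finsetSum _ hint]
        simp_rw [integral_const_mul]
    _ ≤ C * (C * S) := by
        refine mul_le_mul_of_nonneg_left ?_ hC0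
        refine le_trans ?_ (mul_le_mul_of_nonneg_right hC hS0)
        rw [Finset.sum_mul]
        exact Finset.sum_le_sum fun a _ => mul_le_mul_of_nonneg_left (hS a) (abs_nonneg _)

theorem sum_abs_impulseResponse_le (hG : MatRHInf G) (k : ℕ) (i : Fin m) :
    ∑ a ∈ Finset.range (k + 1) ×ˢ (Finset.univ : Finset (Fin m)),
      |impulseResponse (G i a.2) (k - a.1)| ≤ ∑ j, ∑' t, |impulseResponse (G i j) t| := by
  rw [Finset.sum_product_right]
  refine Finset.sum_le_sum fun j _ => ?_
  have h := Finset.sum_flip (n := k) fun t => |impulseResponse (G i j) t|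
  exact h.le.trans ((summable_impulseResponse (hG i j)).sum_le_tsum _ fun _ _ => abs_nonneg _)

theorem exists_integral_noiseResponse_sq_le (hG : MatRHInf G) (hv : IsWhiteNoise μ v) :
    ∃ b, 0 ≤ b ∧ ∀ k i, ∫ ω, Channel.noiseResponse G (fun l => v l ω) k i ^ 2 ∂μ ≤ b := by
  have hv0 : ∀ j, 0 ≤ ∫ ω, v 0 ω j ^ 2 ∂μ := fun j => integral_nonneg fun _ => sq_nonneg _
  obtain ⟨S, hS0, hS⟩ : ∃ S, 0 ≤ S ∧ ∀ l j, ∫ ω, v l ω j ^ 2 ∂μ ≤ S :=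
    ⟨∑ j, ∫ ω, v 0 ω j ^ 2 ∂μ, Finset.sum_nonneg fun j _ => hv0 j, fun l j =>
      (hv.integral_sq l j).le.trans (Finset.single_le_sum (f := fun j => ∫ ω, v 0 ω j ^ 2 ∂μ)
        (fun j _ => hv0 j) (Finset.mem_univ j))⟩
  obtain ⟨C, hC⟩ : ∃ C : Fin m → ℝ, ∀ k i, ∑ a ∈ Finset.range (k + 1) ×ˢ Finset.univ,
      |impulseResponse (G i a.2) (k - a.1)| ≤ C i := ⟨_, sum_abs_impulseResponse_le hG⟩
  have hmain : ∀ k i, ∫ ω, Channel.noiseResponse G (fun l => v l ω) k i ^ 2 ∂μ ≤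
      C i * (C i * S) := fun k i => by
    simp_rw [noiseResponse_eq]
    exact integral_sq_sum_mul_le (Finset.range (k + 1) ×ˢ Finset.univ)
      (fun a => impulseResponse (G i a.2) (k - a.1)) (fun a ω => v a.1 ω a.2)
      (fun a => hv.memLp a.1 a.2) (hC k i) (fun a => hS a.1 a.2) hS0
  have hn : ∀ i, 0 ≤ C i * (C i * S) := fun i =>
    (integral_nonneg fun _ => sq_nonneg _).trans (hmain 0 i)
  exact ⟨∑ i, C i * (C i * S), Finset.sum_nonneg fun i _ => hn i, fun k i => (hmain k i).trans
    (Finset.single_le_sum (f := fun i => C i * (C i * S)) (fun i _ => hn i) (Finset.mem_univ i))⟩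

theorem boundedVariance_of_integral_sq_le {s : ℕ → Ω → Fin m → ℝ}
    (hs : ∀ k i, MemLp (fun ω => s k ω i) 2 μ) {b : ℝ} (h : ∀ k i, ∫ ω, s k ω i ^ 2 ∂μ ≤ b) :
    BoundedVariance μ s := by
  refine ⟨b, fun k i => ?_⟩
  rw [← ofReal_integral_eq_lintegral_ofReal (hs k i).integrable_sq
    (Filter.Eventually.of_forall fun _ => sq_nonneg _)]
  exact ENNReal.ofReal_le_ofReal (h k i)

theorem boundedVariance_error (hv : IsWhiteNoise μ v)
    (hu : ∀ k i, MemLp (fun ω => u k ω i) 2 μ) {B : ℝ} (hB : 0 ≤ B)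
    (huB : ∀ k i, ∫ ω, u k ω i ^ 2 ∂μ ≤ B)
    (he : ∀ k ω i, e k ω i = v k ω i -
      Ch.uncertaintyOutput i (fun l => χ i l ω) (fun l => u l ω i) k) : BoundedVariance μ e := by
  set A : Fin m → ℕ → ℝ := fun i s => Ch.α i s + |Ch.mean i s| with hA
  have hA0 : ∀ i s, 0 ≤ A i s := fun i s => add_nonneg (Ch.α_nonneg i s) (abs_nonneg _)
  set R : Fin m → ℝ := fun i => 2 * ∫ ω, v 0 ω i ^ 2 ∂μ +
    2 * ((Ch.maxDelay i + 1 : ℕ) * ∑ s ∈ Finset.range (Ch.maxDelay i + 1), A i s ^ 2 * B) with hR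
  have hv0 : ∀ j, 0 ≤ ∫ ω, v 0 ω j ^ 2 ∂μ := fun j => integral_nonneg fun _ => sq_nonneg _
  have hR0 : ∀ i, 0 ≤ R i := fun i => add_nonneg (mul_nonneg zero_le_two (hv0 i))
    (mul_nonneg zero_le_two (mul_nonneg (Nat.cast_nonneg _)
      (Finset.sum_nonneg fun s _ => mul_nonneg (sq_nonneg _) hB)))
  refine ⟨∑ i, R i, fun k i => ?_⟩
  -- An integrable majorant of e². For s > k the truncated index k - s is 0; that spurious term is
  -- nonnegative and only weakens the bound.
  set D : Ω → ℝ := fun ω => 2 * v k ω i ^ 2 + 2 * ((Ch.maxDelay i + 1 : ℕ) *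
    ∑ s ∈ Finset.range (Ch.maxDelay i + 1), A i s ^ 2 * u (k - s) ω i ^ 2) with hD
  have hi1 : Integrable (fun ω => 2 * v k ω i ^ 2) μ := (hv.memLp k i).integrable_sq.const_mul 2
  have hi2 : ∀ s ∈ Finset.range (Ch.maxDelay i + 1),
      Integrable (fun ω => A i s ^ 2 * u (k - s) ω i ^ 2) μ := fun s _ =>
    (hu (k - s) i).integrable_sq.const_mul _
  have hi3 : Integrable (fun ω => 2 * ((Ch.maxDelay i + 1 : ℕ) *
      ∑ s ∈ Finset.range (Ch.maxDelay i + 1), A i s ^ 2 * u (k - s) ω i ^ 2)) μ :=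
    ((integrable_finsetSum _ hi2).const_mul _).const_mul 2
  have hDi : Integrable D μ := hi1.add hi3
  have hle : ∀ ω, e k ω i ^ 2 ≤ D ω := by
    intro ω
    set d := Ch.uncertaintyOutput i (fun l => χ i l ω) (fun l => u l ω i) k with hd
    have h1 : d ^ 2 ≤ (Ch.maxDelay i + 1 : ℕ) *
        ∑ s ∈ Finset.range (Ch.maxDelay i + 1), A i s ^ 2 * u (k - s) ω i ^ 2 := by
      have h2 := sq_sum_le_card_mul_sum_sq (s := Finset.range (Ch.maxDelay i + 1))
        (f := fun s => if s ≤ k then (Ch.h i (χ i (k - s) ω) s - Ch.mean i s) * u (k - s) ω i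
          else 0)
      rw [Finset.card_range] at h2
      refine h2.trans (mul_le_mul_of_nonneg_left (Finset.sum_le_sum fun s _ => ?_)
        (Nat.cast_nonneg _))
      split_ifs
      · rw [mul_pow]
        refine mul_le_mul_of_nonneg_right ?_ (sq_nonneg _)
        rw [← sq_abs]
        exact pow_le_pow_left₀ (abs_nonneg _) (Channel.abs_h_sub_mean_le i _ s) 2
      · rw [zero_pow two_ne_zero]; positivity
    rw [he k ω i, hD]
    nlinarith [sq_nonneg (v k ω i + d)]
  have hDint : ∫ ω, D ω ∂μ ≤ R i := by
    rw [hD, integral_add hi1 hi3, integral_const_mul, integral_const_mul, integral_const_mul,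
      integral_finsetSum _ hi2, hv.integral_sq k i]
    simp_rw [integral_const_mul]
    refine add_le_add_right (mul_le_mul_of_nonneg_left (mul_le_mul_of_nonneg_left
      (Finset.sum_le_sum fun s _ => mul_le_mul_of_nonneg_left (huB _ _) (sq_nonneg _))
      (Nat.cast_nonneg _)) zero_le_two) _
  calc ∫⁻ ω, ENNReal.ofReal (e k ω i ^ 2) ∂μ ≤ ∫⁻ ω, ENNReal.ofReal (D ω) ∂μ :=
        lintegral_mono fun ω => ENNReal.ofReal_le_ofReal (hle ω)
    _ = ENNReal.ofReal (∫ ω, D ω ∂μ) := (ofReal_integral_eq_lintegral_ofReal hDi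
        (Filter.Eventually.of_forall fun ω => (sq_nonneg _).trans (hle ω))).symm
    _ ≤ ENNReal.ofReal (∑ i, R i) := ENNReal.ofReal_le_ofReal (hDint.trans
        (Finset.single_le_sum (fun i _ => hR0 i) (Finset.mem_univ i)))

theorem boundedVariance_of_specRad_lt_one (hG : MatRHInf G)
    (hG0 : ∀ i j, impulseResponse (G i j) 0 = 0) {φ : Fin m → ℝ[X]}
    (hφ : ∀ i, Ch.IsSpectralFactor i (φ i)) {J : Matrix (Fin m) (Fin m) ℝ}
    (hJ : ∀ i j, J i j = h2NormSq (G i j * inZInv (φ j))) (hρ : specRad J < 1)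
    (hχ : Ch.IsDelayProcess μ χ) (hv : IsWhiteNoise μ v)
    (hind : IndepFun (fun ω k => v k ω) (fun ω (q : Fin m × ℕ) => χ q.1 q.2 ω) μ)
    (hloop : IsLoop Ch G χ v e u) : BoundedVariance μ e ∧ BoundedVariance μ u := by
  obtain ⟨hu, he⟩ := (isLoop_iff hG.isProper hG0).1 hloop
  have hL2 := fun k i => hu.memLp hG.isProper hχ.measurable hv.memLp k i
  obtain ⟨b, hb, hF⟩ := exists_integral_noiseResponse_sq_le hG hv
  obtain ⟨B, hB, hUB⟩ := renewal_bounded (fun i j t => Channel.energy_nonneg (Ch := Ch) G i j t)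
    (fun i j => by rw [hJ]; exact Channel.hasSum_energy hG i j (hφ j))
    (U := fun k i => ∫ ω, u k ω i ^ 2 ∂μ)
    (fun k i => hu.integral_sq hG.isProper hχ hv.measurable hv.memLp hind k i) hb hF hρ
  exact ⟨boundedVariance_error hv hL2 hB hUB he,
    boundedVariance_of_integral_sq_le hL2 hUB⟩

end Sufficiency

end MSStab

end

noncomputable section

namespace MSStab

set_option linter.unusedSectionVars false

/-! ### A probability space that carries the delays and a white noise of unit variance -/

theorem iIndepFun_of_measurePreserving {Ω ι : Type*} {X : ι → Type*} [MeasurableSpace Ω]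
    [∀ i, MeasurableSpace (X i)] {P : Measure Ω} [IsProbabilityMeasure P]
    {ν : (i : ι) → Measure (X i)} [∀ i, IsProbabilityMeasure (ν i)] {f : Ω → ∀ i, X i}
    (hf : MeasurePreserving f P (Measure.infinitePi ν)) : iIndepFun (fun i ω => f ω i) P := by
  have hm : ∀ i, Measurable fun ω => f ω i := fun i =>
    (measurable_pi_apply i).comp hf.measurable
  rw [iIndepFun_iff_map_fun_eq_infinitePi_map hm]
  have h : ∀ i, P.map (fun ω => f ω i) = ν i := fun i =>
    ((measurePreserving_eval_infinitePi ν i).comp hf).map_eq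
  simp_rw [h]
  exact hf.map_eq

theorem integral_comp_of_measurePreserving {Ω Ω' : Type*} [MeasurableSpace Ω] [MeasurableSpace Ω']
    {P : Measure Ω} {ν : Measure Ω'} {f : Ω → Ω'} (hf : MeasurePreserving f P ν) {g : Ω' → ℝ}
    (hg : Measurable g) : ∫ ω, g (f ω) ∂P = ∫ x, g x ∂ν := by
  rw [← hf.map_eq]
  exact (integral_map hf.aemeasurable hg.aestronglyMeasurable).symm

/-- The law of the delays of channel `i`. -/
def Channel.delayLaw {m : ℕ} (Ch : Channel m) (i : Fin m) : Measure ℕ :=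
  ∑ x ∈ Finset.range (Ch.maxDelay i + 1), ENNReal.ofReal (Ch.p i x) • Measure.dirac x

theorem Channel.delayLaw_singleton {m : ℕ} (Ch : Channel m) (i : Fin m) {j : ℕ}
    (hj : j ∈ Finset.range (Ch.maxDelay i + 1)) :
    Ch.delayLaw i {j} = ENNReal.ofReal (Ch.p i j) := by
  rw [delayLaw, Measure.finsetSum_apply, Finset.sum_eq_single j]
  · simp
  · intro x _ hx
    simp [hx]
  · exact fun h => absurd hj h

instance {m : ℕ} (Ch : Channel m) (i : Fin m) : IsProbabilityMeasure (Ch.delayLaw i) := by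
  constructor
  rw [Channel.delayLaw, Measure.finsetSum_apply]
  simp only [Measure.smul_apply, measure_univ, smul_eq_mul, mul_one]
  rw [← ENNReal.ofReal_sum_of_nonneg fun j _ => Ch.p_nonneg i j, Ch.p_sum, ENNReal.ofReal_one]

/-- Standard Gaussian white noise. -/
abbrev noiseMeasure (m : ℕ) : Measure (ℕ → Fin m → ℝ) :=
  Measure.infinitePi fun _ => Measure.pi fun _ => gaussianReal 0 1

/-- Independent delays. -/
abbrev Channel.delayMeasure {m : ℕ} (Ch : Channel m) : Measure (Fin m × ℕ → ℕ) :=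
  Measure.infinitePi fun q : Fin m × ℕ => Ch.delayLaw q.1

/-- The joint law of independent noise and delays. -/
abbrev Channel.jointMeasure {m : ℕ} (Ch : Channel m) :
    Measure ((ℕ → Fin m → ℝ) × (Fin m × ℕ → ℕ)) :=
  (noiseMeasure m).prod Ch.delayMeasure

section JointSpace

variable {m : ℕ} (Ch : Channel m)

theorem isDelayProcess_jointMeasure :
    Ch.IsDelayProcess Ch.jointMeasure fun i k ω => ω.2 (i, k) := by
  have h2 : MeasurePreserving Prod.snd Ch.jointMeasure Ch.delayMeasure := measurePreserving_snd
  refine ⟨fun i k => by fun_prop, fun i k j hj => ?_, iIndepFun_of_measurePreserving h2⟩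
  have h := (measurePreserving_eval_infinitePi
    (fun q : Fin m × ℕ => Ch.delayLaw q.1) (i, k)).comp h2
  rw [← Ch.delayLaw_singleton i hj, ← h.measure_preimage (measurableSet_singleton j).nullMeasurableSet]
  rfl

theorem measurePreserving_noise (k : ℕ) : MeasurePreserving
    (fun ω : (ℕ → Fin m → ℝ) × (Fin m × ℕ → ℕ) => ω.1 k) Ch.jointMeasure
      (Measure.pi fun _ => gaussianReal 0 1) :=
  (measurePreserving_eval_infinitePi (fun _ : ℕ => Measure.pi fun _ : Fin m => gaussianReal 0 1)
    k).comp measurePreserving_fst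

theorem measurePreserving_noise_apply (k : ℕ) (i : Fin m) : MeasurePreserving
    (fun ω : (ℕ → Fin m → ℝ) × (Fin m × ℕ → ℕ) => ω.1 k i) Ch.jointMeasure (gaussianReal 0 1) :=
  (measurePreserving_eval (fun _ : Fin m => gaussianReal 0 1) i).comp (measurePreserving_noise Ch k)

theorem integral_noise (k : ℕ) (i : Fin m) : ∫ ω, ω.1 k i ∂Ch.jointMeasure = 0 := by
  have h1 : ∫ ω, ω.1 k i ∂Ch.jointMeasure = ∫ x, x ∂(gaussianReal 0 1) :=
    integral_comp_of_measurePreserving (measurePreserving_noise_apply Ch k i) measurable_id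
  rw [h1, integral_id_gaussianReal]

theorem integral_noise_sq (k : ℕ) (i : Fin m) : ∫ ω, ω.1 k i ^ 2 ∂Ch.jointMeasure = 1 := by
  have h1 : ∫ ω, ω.1 k i ^ 2 ∂Ch.jointMeasure = ∫ x, x ^ 2 ∂(gaussianReal 0 1) :=
    integral_comp_of_measurePreserving (measurePreserving_noise_apply Ch k i)
      (measurable_id.pow_const 2)
  have h2 := variance_of_integral_eq_zero (X := fun x : ℝ => x) (μ := gaussianReal 0 1)
    (by fun_prop) integral_id_gaussianReal
  rw [h1, ← h2, variance_fun_id_gaussianReal]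
  rfl

theorem memLp_noise (k : ℕ) (i : Fin m) :
    MemLp (fun ω : (ℕ → Fin m → ℝ) × (Fin m × ℕ → ℕ) => ω.1 k i) 2 Ch.jointMeasure :=
  MemLp.comp_measurePreserving (memLp_id_gaussianReal 2) (measurePreserving_noise_apply Ch k i)

theorem isWhiteNoise_jointMeasure : IsWhiteNoise Ch.jointMeasure fun k ω => ω.1 k := by
  refine ⟨fun k => by fun_prop, iIndepFun_of_measurePreserving
    (f := Prod.fst) (ν := fun _ : ℕ => Measure.pi fun _ : Fin m => gaussianReal 0 1)
    measurePreserving_fst, fun k => ?_, memLp_noise Ch, integral_noise Ch, fun k i j hij => ?_⟩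
  · exact ⟨by fun_prop, by fun_prop, (measurePreserving_noise Ch k).map_eq.trans
      (measurePreserving_noise Ch 0).map_eq.symm⟩
  · have h := measurePreserving_noise Ch k
    have h0 : IndepFun (fun w : Fin m → ℝ => w i) (fun w => w j)
        (Measure.pi fun _ : Fin m => gaussianReal 0 1) :=
      (iIndepFun_pi (X := fun _ : Fin m => (id : ℝ → ℝ)) fun _ => aemeasurable_id).indepFun hij
    have h1 : ∫ ω, ω.1 k i * ω.1 k j ∂Ch.jointMeasure =
        ∫ w, w i * w j ∂(Measure.pi fun _ : Fin m => gaussianReal 0 1) :=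
      integral_comp_of_measurePreserving h
        ((measurable_pi_apply i).mul (measurable_pi_apply j))
    have h2 : ∫ w : Fin m → ℝ, w i ∂(Measure.pi fun _ : Fin m => gaussianReal 0 1) = 0 :=
      (integral_comp_of_measurePreserving h (measurable_pi_apply i)).symm.trans
        (integral_noise Ch k i)
    rw [h1, h0.integral_fun_mul_eq_mul_integral
      (measurable_pi_apply i).aestronglyMeasurable (measurable_pi_apply j).aestronglyMeasurable,
      h2, zero_mul]

theorem indepFun_jointMeasure : IndepFun
    (fun (ω : (ℕ → Fin m → ℝ) × (Fin m × ℕ → ℕ)) (k : ℕ) => ω.1 k)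
    (fun ω (q : Fin m × ℕ) => ω.2 (q.1, q.2)) Ch.jointMeasure :=
  indepFun_prod (X := id) (Y := id) measurable_id measurable_id

end JointSpace

/-! ### Necessity of the spectral radius condition -/

section Necessity

variable {m : ℕ} {Ch : Channel m} {G : TFMatrix m}

/-- The input of the channels determined by the noise and the delays. -/
def inputSolution (Ch : Channel m) (G : TFMatrix m) (v : ℕ → Fin m → ℝ) (x : Fin m → ℕ → ℕ)
    (k : ℕ) (i : Fin m) : ℝ :=
  Channel.noiseResponse G v k i - ∑ j, ∑ n : Fin k, Ch.kern G i j (x j n) (k - n) *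
    inputSolution Ch G v x n j
termination_by k
decreasing_by exact n.2

theorem isInputRecursion_inputSolution {Ω : Type} (χ : Fin m → ℕ → Ω → ℕ)
    (v : ℕ → Ω → Fin m → ℝ) : IsInputRecursion Ch G χ v fun k ω i =>
      inputSolution Ch G (fun l => v l ω) (fun j n => χ j n ω) k i := by
  intro k ω i
  beta_reduce
  rw [inputSolution, Finset.sum_product]
  congr 1
  refine Finset.sum_congr rfl fun j _ => ?_
  exact Fin.sum_univ_eq_sum_range (fun n => Ch.kern G i j (χ j n ω) (k - n) *
    inputSolution Ch G (fun l => v l ω) (fun j n => χ j n ω) n j) k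

variable {Ω : Type} [MeasurableSpace Ω] {μ : Measure Ω} [IsProbabilityMeasure μ]
  {v : ℕ → Ω → Fin m → ℝ}

theorem IsWhiteNoise.integral_mul_eq_zero (hv : IsWhiteNoise μ v) {a b : ℕ × Fin m}
    (hab : a ≠ b) : ∫ ω, v a.1 ω a.2 * v b.1 ω b.2 ∂μ = 0 := by
  by_cases h : a.1 = b.1
  · rw [h]
    exact hv.cov_diag _ _ _ fun h' => hab (Prod.ext h h')
  · have h1 : IndepFun (fun ω => v a.1 ω a.2) (fun ω => v b.1 ω b.2) μ :=
      (hv.indep.indepFun h).comp (measurable_pi_apply a.2) (measurable_pi_apply b.2)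
    rw [h1.integral_fun_mul_eq_mul_integral (hv.memLp _ _).1 (hv.memLp _ _).1, hv.mean_zero,
      zero_mul]

theorem integral_sq_sum_eq {ι : Type*} (s : Finset ι) (w : ι → ℝ) {x : ι → Ω → ℝ}
    (hx : ∀ a, MemLp (x a) 2 μ) (h : ∀ a b, a ≠ b → ∫ ω, x a ω * x b ω ∂μ = 0) :
    ∫ ω, (∑ a ∈ s, w a * x a ω) ^ 2 ∂μ = ∑ a ∈ s, w a ^ 2 * ∫ ω, x a ω ^ 2 ∂μ := by
  have h1 := integral_sub_sum_sq (μ := μ) (s := s) (f := fun _ => 0)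
    (Z := fun a ω => w a * x a ω) (memLp_const 0) (fun a _ => (hx a).const_mul (w a)) (by simp)
    fun a _ b _ hab => by
      have : (fun ω => w a * x a ω * (w b * x b ω)) = fun ω => w a * w b * (x a ω * x b ω) := by
        funext ω; ring
      rw [this, integral_const_mul, h a b hab, mul_zero]
  simp only [zero_sub, neg_sq, mul_pow, integral_const_mul] at h1
  rw [h1]
  simp

/-- Uncorrelated noise of unit variance turns the second moment into a sum of squared coefficients,
of which one is kept. -/
theorem le_integral_noiseResponse_sq (hv : IsWhiteNoise μ v)
    (hσ : ∀ k i, ∫ ω, v k ω i ^ 2 ∂μ = 1) (i j : Fin m) {t k : ℕ} (htk : t ≤ k) :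
    impulseResponse (G i j) t ^ 2 ≤
      ∫ ω, Channel.noiseResponse G (fun l => v l ω) k i ^ 2 ∂μ := by
  simp_rw [noiseResponse_eq]
  rw [integral_sq_sum_eq (Finset.range (k + 1) ×ˢ Finset.univ)
    (fun a => impulseResponse (G i a.2) (k - a.1)) (x := fun a ω => v a.1 ω a.2)
    (fun a => hv.memLp a.1 a.2) fun a b hab => hv.integral_mul_eq_zero hab]
  have h := Finset.single_le_sum (s := Finset.range (k + 1) ×ˢ Finset.univ)
    (f := fun a : ℕ × Fin m => impulseResponse (G i a.2) (k - a.1) ^ 2 *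
      ∫ ω, v a.1 ω a.2 ^ 2 ∂μ)
    (fun a _ => mul_nonneg (sq_nonneg _) (integral_nonneg fun _ => sq_nonneg _))
    (show (k - t, j) ∈ Finset.range (k + 1) ×ˢ Finset.univ by simp)
  refine le_trans (le_of_eq ?_) h
  rw [hσ, mul_one, show k - (k - t) = t by omega]

theorem exists_impulseResponse_ne_zero {f : RatFunc ℝ} (hf : f ≠ 0) :
    ∃ t, impulseResponse f t ≠ 0 := by
  by_contra! h
  exact hf (eq_zero_of_imp_eq_zero (PowerSeries.ext fun t => by simpa using h t))

theorem h2NormSq_zero : h2NormSq 0 = 0 := by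
  simp [h2NormSq, evalC]

/-- If the spectral radius were at least one, a subinvariant vector x ≤ J x would exist. Gaussian
noise on an explicit product space excites every coordinate in which x is positive, and the renewal
argument then drives the second moments beyond any bound. -/
theorem specRad_lt_one_of_boundedVariance (hm : 0 < m) (hG : MatRHInf G)
    (hG0 : ∀ i j, impulseResponse (G i j) 0 = 0) {φ : Fin m → ℝ[X]}
    (hφ : ∀ i, Ch.IsSpectralFactor i (φ i)) {J : Matrix (Fin m) (Fin m) ℝ}
    (hJ : ∀ i j, J i j = h2NormSq (G i j * inZInv (φ j)))
    (h : ∀ (Ω : Type) [MeasurableSpace Ω] (μ : Measure Ω) [IsProbabilityMeasure μ]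
      (χ : Fin m → ℕ → Ω → ℕ) (v e u : ℕ → Ω → Fin m → ℝ),
      Ch.IsDelayProcess μ χ → IsWhiteNoise μ v →
      IndepFun (fun ω k => v k ω) (fun ω (q : Fin m × ℕ) => χ q.1 q.2 ω) μ →
      IsLoop Ch G χ v e u → BoundedVariance μ e ∧ BoundedVariance μ u) : specRad J < 1 := by
  by_contra! hρ
  have hsum : ∀ i j, HasSum (Ch.energy G i j) (J i j) := fun i j => by
    rw [hJ]; exact Channel.hasSum_energy hG i j (hφ j)
  have hJ0 : ∀ i j, 0 ≤ J i j := fun i j => (hsum i j).nonneg (Channel.energy_nonneg G i j)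
  obtain ⟨x, hx0, hxne, hx⟩ := exists_le_mulVec_of_le_specRad hm hJ0
  have hx1 : ∀ i, x i ≤ ∑ j, J i j * x j := fun i =>
    (le_mul_of_one_le_left (hx0 i) hρ).trans (hx i)
  obtain ⟨χ, v, hχ, hv, hind, hσ⟩ : ∃ (χ : Fin m → ℕ → (ℕ → Fin m → ℝ) × (Fin m × ℕ → ℕ) → ℕ)
      (v : ℕ → (ℕ → Fin m → ℝ) × (Fin m × ℕ → ℕ) → Fin m → ℝ),
      Ch.IsDelayProcess Ch.jointMeasure χ ∧ IsWhiteNoise Ch.jointMeasure v ∧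
      IndepFun (fun ω k => v k ω) (fun ω (q : Fin m × ℕ) => χ q.1 q.2 ω) Ch.jointMeasure ∧
      ∀ k i, ∫ ω, v k ω i ^ 2 ∂Ch.jointMeasure = 1 :=
    ⟨_, _, isDelayProcess_jointMeasure Ch, isWhiteNoise_jointMeasure Ch, indepFun_jointMeasure Ch,
      integral_noise_sq Ch⟩
  obtain ⟨u, hu⟩ : ∃ u, IsInputRecursion Ch G χ v u := ⟨_, isInputRecursion_inputSolution χ v⟩
  obtain ⟨b, hb⟩ := (h _ Ch.jointMeasure χ v (fun k ω i => v k ω i -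
    Ch.uncertaintyOutput i (fun l => χ i l ω) (fun l => u l ω i) k) u hχ hv hind
    ((isLoop_iff hG.isProper hG0).2 ⟨hu, fun _ _ _ => rfl⟩)).2
  have hL2 := fun k i => hu.memLp hG.isProper hχ.measurable hv.memLp k i
  have hF : ∀ i, ∃ ε > 0, ∃ k₀, ∀ k ≥ k₀, ε * x i ≤
      ∫ ω, Channel.noiseResponse G (fun l => v l ω) k i ^ 2 ∂Ch.jointMeasure := by
    intro i
    rcases (hx0 i).lt_or_eq with hi | hi
    -- From 0 < x_i ≤ (Jx)_i some J_ij is nonzero, so G_ij is nonzero and passes noise to output i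
    -- from some time on.
    · obtain ⟨j, -, hj⟩ := Finset.exists_ne_zero_of_sum_ne_zero (hi.trans_le (hx1 i)).ne'
      have hGij : G i j ≠ 0 := by
        rintro hz
        refine hj ?_
        rw [hJ, hz, zero_mul, h2NormSq_zero, zero_mul]
      obtain ⟨t, ht⟩ := exists_impulseResponse_ne_zero hGij
      refine ⟨impulseResponse (G i j) t ^ 2 / x i, by positivity, t, fun k hk => ?_⟩
      rw [div_mul_cancel₀ _ hi.ne']
      exact le_integral_noiseResponse_sq hv hσ i j hk
    · refine ⟨1, one_pos, 0, fun k _ => ?_⟩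
      rw [← hi, mul_zero]
      exact integral_nonneg fun _ => sq_nonneg _
  choose ε hε k₀ hk₀ using hF
  obtain ⟨δ, hδ, hδle⟩ : ∃ δ > 0, ∀ i, δ ≤ ε i := by
    have : Nonempty (Fin m) := ⟨⟨0, hm⟩⟩
    obtain ⟨i, hi⟩ := Finite.exists_min ε
    exact ⟨ε i, hε i, hi⟩
  obtain ⟨i₀, hi₀⟩ := Function.ne_iff.1 hxne
  have hi₀ : 0 < x i₀ := (hx0 i₀).lt_of_ne' hi₀
  -- Enough rounds of the renewal argument to exceed the assumed bound; |b| is used because b may be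
  -- negative.
  obtain ⟨N, hN⟩ := exists_nat_gt (|b| / (δ / 2 * x i₀))
  obtain ⟨K, hK⟩ := renewal_unbounded
    (fun i j t => Channel.energy_nonneg (Ch := Ch) G i j t)
    (fun i j => by simp [Channel.energy, Channel.kern_zero hG.isProper hG0]) hsum
    (U := fun k i => ∫ ω, u k ω i ^ 2 ∂Ch.jointMeasure)
    (fun k i => hu.integral_sq hG.isProper hχ hv.measurable hv.memLp hind k i)
    (fun k i => integral_nonneg fun _ => sq_nonneg _) hx0 hx1 hδ (k₀ := ∑ i, k₀ i)
    (fun k hk i => (mul_le_mul_of_nonneg_right (hδle i) (hx0 i)).trans (hk₀ i k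
      ((Finset.single_le_sum (fun _ _ => Nat.zero_le _) (Finset.mem_univ i)).trans hk))) N
  have h1 := hK K le_rfl i₀
  have h2 := hb K i₀
  rw [← ofReal_integral_eq_lintegral_ofReal (hL2 K i₀).integrable_sq
    (Filter.Eventually.of_forall fun _ => sq_nonneg _)] at h2
  have h3 := (ENNReal.ofReal_le_ofReal_iff (abs_nonneg b)).1
    (h2.trans (ENNReal.ofReal_le_ofReal (le_abs_self b)))
  rw [div_lt_iff₀ (by positivity)] at hN
  have h4 : (N : ℝ) * (δ / 2) * x i₀ = N * (δ / 2 * x i₀) := by ring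
  linarith

end Necessity

end MSStab

end

noncomputable section

namespace MSStab

/-! ### The inner-outer factorization and the stabilizability criterion -/

variable {m n : ℕ} {Ch : Channel m} {φ : Fin m → ℝ[X]} {P N M Nt Mt U V Ut Vt : TFMatrix m}

theorem exists_youlaData (hH : Ch.MeanMinPhase) (hφ : ∀ i, Ch.IsSpectralFactor i (φ i))
    (hP : ∀ i j, IsStrictlyProper (P i j))
    (hcop : IsDoublyCoprime (P * Ch.H) N M Nt Mt U V Ut Vt)
    {τ : Fin m → ℕ} (hτ : ∀ i, 1 ≤ τ i) {Nout : TFMatrix m} (hNout : MatRHInfUnit Nout)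
    (hNt : Nt = Nout * Matrix.diagonal fun i => (RatFunc.X : RatFunc ℝ)⁻¹ ^ τ i)
    {Min Mout : TFMatrix m} (hin : IsInner Min) (hout : IsOuter Mout) (hM : M = Min * Mout)
    {A : Matrix (Fin n) (Fin n) ℝ} {B : Matrix (Fin n) (Fin m) ℝ} {C : Matrix (Fin m) (Fin n) ℝ}
    {D : Matrix (Fin m) (Fin m) ℝ} (hreal : IsRealization Min A B C D) (hmin : IsMinimal A B C) :
    ∃ Nout' X, YoulaData U M Nt Vt Nout Nout' Mout A B C D X (Ch.W φ) τ := by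
  obtain ⟨hL, -, hL0⟩ := coefM_plant (Ch := Ch) hP
  rw [isRealization_iff] at hreal
  obtain ⟨hNo, Nout', hNo', -, hmul⟩ := hNout
  -- Invertibility of M at infinity passes to both factors. It gives D invertible and M_out
  -- nonsingular at infinity, a point that `IsOuter` does not cover.
  have h0 := (hcop.coefM_zero hL hL0).1
  rw [hM, coefM_zero_mul hin.1.isProper hout.1.isProper, Matrix.det_mul, hreal,
    coefM_tf_zero, ← (isProper_det_and_adjugate hout.1.isProper).2.1] at h0
  exact ⟨Nout', _, {
    real := innerRealization hin hreal hmin (left_ne_zero_of_mul h0).isUnit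
    inner := hreal ▸ hin
    M_eq := hreal ▸ hM
    outer := hout
    det_outer := right_ne_zero_of_mul h0
    bezout := hcop.identities.2.2.2
    Nt_eq := hNt
    rh_U := hcop.rhInf.2.2.2.2.1
    rh_Vt := hcop.rhInf.2.2.2.2.2.2.2
    rh_Nout := hNo
    rh_Nout' := hNo'
    Nout_mul := hmul
    one_le := hτ
    rh_W := fun i => Channel.isRHInf_W hH i
    W_zero := Channel.impulseResponse_W_zero_ne hH hφ
    W_ne := fun i _ hz => Channel.evalC_W_ne hH hφ i hz }⟩

/-- The strict inequality makes attainment of the infimum irrelevant: a stabilizing K provides a Q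
with radius below one, and conversely an infimum below one provides such a Q and its controller. -/
theorem mSStabilizable_iff (hm : 0 < m) (hH : Ch.MeanMinPhase)
    (hφ : ∀ i, Ch.IsSpectralFactor i (φ i)) (hP : ∀ i j, IsStrictlyProper (P i j))
    (hcop : IsDoublyCoprime (P * Ch.H) N M Nt Mt U V Ut Vt) :
    MSStabilizable Ch P ↔ rhoMin U M Nt (Ch.W φ) < 1 := by
  obtain ⟨hL, -, hL0⟩ := coefM_plant (Ch := Ch) hP
  constructor
  · rintro ⟨K, hK, hbdd⟩
    obtain ⟨Q, hQ, hT⟩ := hcop.exists_param hK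
    obtain ⟨hG, hG0, hJ⟩ := nominalG_properties (φ := φ) hH hP hK hT
    exact (rhoMin_le hQ).trans_lt (specRad_lt_one_of_boundedVariance hm hG hG0 hφ hJ hbdd)
  · intro h
    obtain ⟨Q, hQ, hρ⟩ := exists_specRad_lt h
    obtain ⟨K, hK, hT⟩ := hcop.exists_controller hL hL0 hQ
    obtain ⟨hG, hG0, hJ⟩ := nominalG_properties (φ := φ) hH hP hK hT
    exact ⟨K, hK, fun Ω _ μ _ χ v e u hχ hv hind hloop =>
      boundedVariance_of_specRad_lt_one hG hG0 hφ hJ hρ hχ hv hind hloop⟩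

end MSStab

end

/-- The infima are expressed by `IsGLB`, which over ℝ also asserts that the sets are nonempty;
`sInf` would have a default value on an empty set. -/
theorem theorem2 {m n : ℕ} (hm : 0 < m)
    (Ch : MSStab.Channel m) (hH : Ch.MeanMinPhase)
    (φ : Fin m → Polynomial ℝ) (hφ : ∀ i, Ch.IsSpectralFactor i (φ i))
    (P : MSStab.TFMatrix m) (hP : ∀ i j, MSStab.IsStrictlyProper (P i j))
    (N M Nt Mt U V Ut Vt : MSStab.TFMatrix m)
    (hcop : MSStab.IsDoublyCoprime (P * Ch.H) N M Nt Mt U V Ut Vt)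
    (τ : Fin m → ℕ) (hτ : ∀ i, 1 ≤ τ i)
    (Nout : MSStab.TFMatrix m) (hNout : MSStab.MatRHInfUnit Nout)
    (hNt : Nt = Nout * Matrix.diagonal fun i => (RatFunc.X : RatFunc ℝ)⁻¹ ^ τ i)
    (Min Mout : MSStab.TFMatrix m) (hin : MSStab.IsInner Min) (hout : MSStab.IsOuter Mout)
    (hM : M = Min * Mout)
    (A : Matrix (Fin n) (Fin n) ℝ) (B : Matrix (Fin n) (Fin m) ℝ)
    (C : Matrix (Fin m) (Fin n) ℝ) (D : Matrix (Fin m) (Fin m) ℝ)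
    (hreal : MSStab.IsRealization Min A B C D) (hmin : MSStab.IsMinimal A B C) :
    (∀ γ : Fin m → ℝ, (∀ i, 0 < γ i) → ∃! X : Matrix (Fin n) (Fin n) ℝ,
      X.PosDef ∧ MSStab.IsDARESolution A B C D (Matrix.diagonal γ) X) ∧
    IsGLB (MSStab.riccatiSet A B C D (Ch.W φ) τ) (MSStab.rhoMin U M Nt (Ch.W φ)) ∧
    (∃ Xs : Fin m → Matrix (Fin n) (Fin n) ℝ,
      (∀ i, (Xs i).PosSemidef ∧ MSStab.IsLyapunovSolution A B C D i (Xs i) ∧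
        ∀ Y, MSStab.IsLyapunovSolution A B C D i Y → Y = Xs i) ∧
      IsGLB (MSStab.lmiSet A B C D (Ch.W φ) τ Xs) (MSStab.rhoMin U M Nt (Ch.W φ))) ∧
    (MSStab.MSStabilizable Ch P ↔ MSStab.rhoMin U M Nt (Ch.W φ) < 1) := by
  obtain ⟨Nout', X, h⟩ := MSStab.exists_youlaData hH hφ hP hcop hτ hNout hNt hin hout hM hreal hmin
  exact ⟨fun γ hγ => h.real.existsUnique_isDARESolution hγ, h.isGLB_riccatiSet hm,
    ⟨_, fun i => ⟨h.real.lyapSol_single_posSemidef i, (h.real.isLyapunovSolution_iff i _).2 rfl,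
      fun Y hY => (h.real.isLyapunovSolution_iff i Y).1 hY⟩, h.isGLB_lmiSet hm⟩,
    MSStab.mSStabilizable_iff hm hH hφ hP hcop⟩
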